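/- **Models.** Let $x\in\{0,1\}^N$. On a register $|j\rangle|b\rangle$ ($j\in[N]$, $b\in\{0,1\}$), tensored with an arbitrary finite-dimensional workspace on which they act trivially, let $Q_x|j\rangle|b\rangle=(-1)^{bx_j}|j\rangle|b\rangle$, $Q_x^\alpha|j\rangle|b\rangle=e^{-i\pi\alpha bx_j}|j\rangle|b\rangle$ and $H_x|j\rangle|b\rangle=\pi bx_j|j\rangle|b\rangle$. A *fractional-query algorithm* is a product $U_mQ_x^{\alpha_m}U_{m-1}\cdots U_1Q_x^{\alpha_1}U_0$ with $x$-independent unitaries $U_i$ and $\alpha_i\in(0,1]$; its complexity is $T=\sum_i\alpha_i$. A *continuous-query algorithm* of complexity $T$ is given by an $x$-independent driving Hamiltonian $H_D(t)$, $t\in[0,T]$, Hermitian and integrable in $t$; it implements $U(T)$, where $i\,\frac{d}{dt}U(t)=(H_x+H_D(t))U(t)$ and $U(0)=1$ (in the integrated sense). A *discrete-query algorithm* consists of $x$-independent unitaries and gates $Q_x$, and may use ancillas that start in a fixed state $|0\rangle$. It simulates a family of operators $V_x$ with error at most $\epsilon$ if, for every $x$, its unitary $A_x$ satisfies $\|A_x|\psi\rangle|0\rangle-(V_x|\psi\rangle)|0\rangle\|\le\epsilon$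 for all unit vectors $|\psi\rangle$. All norms of operators are operator norms. **Theorem.** There are absolute constants $C,c,\kappa>0$ such that the following holds for all $T\ge1$ and $\epsilon>0$ with $T/\epsilon>e$. 1. Every fractional-query algorithm and every continuous-query algorithm of complexity $T$ can be simulated with error at most $\epsilon$ by a discrete-query algorithm making at most $C\,T\,\frac{\log(T/\epsilon)}{\log\log(T/\epsilon)}$ queries. 2. Consider a continuous-query algorithm of complexity $T$ on qubits ($N=2^n$, any number of workspace qubits), and let $\bar h=\frac1T\int_0^T\|H_D(t)\|\,dt$. For some $r$ with $2^r\ge\kappa\,\bar hT^2/\epsilon$, suppose that there is one circuit of at most $g$ two-qubit gates which, given in two registers any two times $t_1\le t_2$ from the grid $\{jT/2^r:0\le j\le2^r\}$, implements the evolution $U_{H_D}(t_2,t_1)$ due to $H_D$ from $t_1$ to $t_2$ with precision $c\,\epsilon/T$, i.e. maps $|\psi\rangle|t_1\rangle|t_2\rangle|0\rangle$ to within $c\,\epsilon/T$ of $(U_{H_D}(t_2,t_1)|\psi\rangle)|t_1\rangle|t_2\rangle|0\rangle$ for every unit vector $|\psi\rangle$. Then a single circuit simulates the algorithm with error at most $\epsilon$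 using at most $C\,T\,\frac{\log(T/\epsilon)}{\log\log(T/\epsilon)}$ queries and at most $$C\,T\,\frac{\log(T/\epsilon)}{\log\log(T/\epsilon)}\Big[g+\log\Big(2+\frac{\bar hT}{\epsilon}\Big)\Big]$$ additional two-qubit gates. -/

import Mathlib

open scoped Matrix.Norms.L2Operator

noncomputable section

namespace QuerySim

/-! Operators on a finite-dimensional space with orthonormal basis `β` are complex matrices indexed
by `β`; `‖·‖` is the operator norm induced by the Euclidean norms. An input `x` enters an operator on
such a space through the function `f : β → Bool` that sends the basis state `|j⟩|b⟩⋯` to `b ∧ x_j`. -/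

section Models

variable {β : Type*} [Fintype β] [DecidableEq β]

/-- The discrete query `|j,b⟩ ↦ (-1)^(b x_j) |j,b⟩`. -/
def discreteQuery (f : β → Bool) : Matrix β β ℂ :=
  Matrix.diagonal fun s => if f s then -1 else 1

/-- The fractional query `|j,b⟩ ↦ exp(-i π α b x_j) |j,b⟩`. -/
def fractionalQuery (f : β → Bool) (α : ℝ) : Matrix β β ℂ :=
  Matrix.diagonal fun s => Complex.exp (-Complex.I * Real.pi * α * (if f s then 1 else 0))

/-- The query Hamiltonian `|j,b⟩ ↦ π b x_j |j,b⟩`. -/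
def queryHamiltonian (f : β → Bool) : Matrix β β ℂ :=
  Matrix.diagonal fun s => (Real.pi : ℂ) * (if f s then 1 else 0)

variable (β) in
/-- A discrete-query algorithm `U_m Q U_{m-1} ⋯ U_1 Q U_0`, with `init = U_0` and
`steps = [U_1, …, U_m]`. -/
structure DiscreteAlgorithm where
  init : Matrix.unitaryGroup β ℂ
  steps : List (Matrix.unitaryGroup β ℂ)

/-- The number of queries of a discrete-query algorithm. -/
def DiscreteAlgorithm.queries (A : DiscreteAlgorithm β) : ℕ := A.steps.length

/-- The unitary implemented by a discrete-query algorithm. -/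
def DiscreteAlgorithm.eval (A : DiscreteAlgorithm β) (f : β → Bool) : Matrix β β ℂ :=
  A.steps.foldl (fun M U => (U : Matrix β β ℂ) * discreteQuery f * M) (A.init : Matrix β β ℂ)

variable (β) in
/-- A fractional-query algorithm `U_m Q^{α_m} U_{m-1} ⋯ U_1 Q^{α_1} U_0`, with `init = U_0` and
`steps = [(α_1, U_1), …, (α_m, U_m)]`. -/
structure FractionalAlgorithm where
  init : Matrix.unitaryGroup β ℂ
  steps : List (ℝ × Matrix.unitaryGroup β ℂ)
  pos : ∀ p ∈ steps, 0 < p.1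
  le_one : ∀ p ∈ steps, p.1 ≤ 1

/-- The fractional-query complexity `∑ α_i`. -/
def FractionalAlgorithm.cost (A : FractionalAlgorithm β) : ℝ := (A.steps.map Prod.fst).sum

/-- The unitary implemented by a fractional-query algorithm. -/
def FractionalAlgorithm.eval (A : FractionalAlgorithm β) (f : β → Bool) : Matrix β β ℂ :=
  A.steps.foldl (fun M p => (p.2 : Matrix β β ℂ) * fractionalQuery f p.1 * M)
    (A.init : Matrix β β ℂ)

/-- `V` is the evolution from time `t₁` to time `t₂` generated by the Hamiltonian `H`:
`V = U(t₂)` for the continuous solution `U` of `i dU/dt = H(t) U(t)`, `U(t₁) = 1`. The equation is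
taken in integrated form, so that piecewise constant or merely integrable Hamiltonians are covered. -/
def IsEvolution (H : ℝ → Matrix β β ℂ) (t₁ t₂ : ℝ) (V : Matrix β β ℂ) : Prop :=
  ∃ U : ℝ → Matrix β β ℂ, ContinuousOn U (Set.Icc t₁ t₂) ∧
    (∀ t ∈ Set.Icc t₁ t₂, U t = 1 - Complex.I • ∫ τ in t₁..t, H τ * U τ) ∧ U t₂ = V

/-- A driving Hamiltonian on `[0, T]`. -/
def IsDriving (T : ℝ) (HD : ℝ → Matrix β β ℂ) : Prop :=
  (∀ t ∈ Set.Icc 0 T, (HD t).IsHermitian) ∧ IntervalIntegrable HD MeasureTheory.volume 0 T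

/-- The average norm of the driving Hamiltonian. -/
def averageNorm (T : ℝ) (HD : ℝ → Matrix β β ℂ) : ℝ := (1 / T) * ∫ t in (0 : ℝ)..T, ‖HD t‖

/-- `V` is the unitary implemented by the continuous-query algorithm with driving Hamiltonian `HD`
and total evolution time `T`. -/
def ContinuousImplements (f : β → Bool) (T : ℝ) (HD : ℝ → Matrix β β ℂ) (V : Matrix β β ℂ) : Prop :=
  IsEvolution (fun t => queryHamiltonian f + HD t) 0 T V

end Models

/-! Query complexity: index register `Fin N`, target bit, and an arbitrary workspace `W`. -/

/-- `b ∧ x_j` on the basis state `|j⟩|b⟩|w⟩`. -/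
def registerBit {N : ℕ} {W : Type*} (x : Fin N → Bool) (s : Fin N × Bool × W) : Bool :=
  s.2.1 && x s.1

/-- The isometry `|j⟩|b⟩|w⟩ ↦ |j⟩|b⟩|w⟩|0⟩` that adds a `(d+1)`-dimensional ancilla. -/
def addAncilla (N : ℕ) (W : Type*) [DecidableEq W] (d : ℕ) :
    Matrix (Fin N × Bool × (W × Fin (d + 1))) (Fin N × Bool × W) ℂ :=
  fun s t => if s = (t.1, t.2.1, (t.2.2, 0)) then 1 else 0

/-- The family of operators `V x` can be simulated, within error `ε` for every input `x`, by one
discrete-query algorithm making at most `q` queries (`q` real), with ancillas that start in a fixed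
state and are returned to it. -/
def DiscretelySimulable {N : ℕ} {W : Type*} [Fintype W] [DecidableEq W]
    (V : (Fin N → Bool) → Matrix (Fin N × Bool × W) (Fin N × Bool × W) ℂ) (ε q : ℝ) : Prop :=
  ∃ (d : ℕ) (A : DiscreteAlgorithm (Fin N × Bool × (W × Fin (d + 1)))),
    (A.queries : ℝ) ≤ q ∧
    ∀ x : Fin N → Bool,
      ‖A.eval (registerBit x) * addAncilla N W d - addAncilla N W d * V x‖ ≤ ε

/-! Gate complexity: circuits on finitely many labelled qubits (wires) `Q`, with computational basis
`Q → Bool`. -/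

section Circuits

variable {Q : Type*} [Fintype Q] [DecidableEq Q]

variable (Q) in
/-- An arbitrary unitary gate on two distinct wires. -/
structure TwoQubitGate where
  fst : Q
  snd : Q
  ne : fst ≠ snd
  gate : Matrix.unitaryGroup (Bool × Bool) ℂ

/-- The action of a two-qubit gate on all wires. -/
def TwoQubitGate.toMatrix (G : TwoQubitGate Q) : Matrix (Q → Bool) (Q → Bool) ℂ :=
  fun s t => if ∀ k, k ≠ G.fst → k ≠ G.snd → s k = t k then
    (G.gate : Matrix (Bool × Bool) (Bool × Bool) ℂ) (s G.fst, s G.snd) (t G.fst, t G.snd) else 0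

/-- A query-free circuit; the head of the list acts first. -/
def evalGates (D : List (TwoQubitGate Q)) : Matrix (Q → Bool) (Q → Bool) ℂ :=
  D.foldl (fun M G => G.toMatrix * M) 1

/-- `b ∧ x_j` when the `n`-bit index `j` and the bit `b` are read from the wires chosen by `e`. -/
def wireBit {n : ℕ} (e : Fin n ⊕ Unit ↪ Q) (x : (Fin n → Bool) → Bool) (s : Q → Bool) : Bool :=
  s (e (Sum.inr ())) && x fun i => s (e (Sum.inl i))

variable (Q) in
/-- A gate of a circuit with oracle access to an input `x` of length `2^n`. -/
inductive Gate (n : ℕ) where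
  | twoQubit (G : TwoQubitGate Q)
  | query (e : Fin n ⊕ Unit ↪ Q)

/-- The action of a gate, given the input `x`. -/
def Gate.toMatrix {n : ℕ} (x : (Fin n → Bool) → Bool) :
    Gate Q n → Matrix (Q → Bool) (Q → Bool) ℂ
  | .twoQubit G => G.toMatrix
  | .query e => discreteQuery (wireBit e x)

/-- Whether a gate is a query. -/
def Gate.isQuery {n : ℕ} : Gate Q n → Bool
  | .twoQubit _ => false
  | .query _ => true

/-- The unitary performed by a circuit on input `x`; the head of the list acts first. -/
def evalCircuit {n : ℕ} (x : (Fin n → Bool) → Bool) (K : List (Gate Q n)) :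
    Matrix (Q → Bool) (Q → Bool) ℂ :=
  K.foldl (fun M G => G.toMatrix x * M) 1

/-- The number of query gates of a circuit. -/
def queryCount {n : ℕ} (K : List (Gate Q n)) : ℕ := K.countP fun G => G.isQuery

/-- The number of two-qubit gates of a circuit. -/
def gateCount {n : ℕ} (K : List (Gate Q n)) : ℕ := K.countP fun G => !G.isQuery

/-- The isometry `|ψ⟩ ↦ |ψ⟩|c⟩` that adds wires `R` in the computational basis state `c`. -/
def attach (S : Type*) {R : Type*} [Fintype S] [Fintype R] (c : R → Bool) :
    Matrix (S ⊕ R → Bool) (S → Bool) ℂ :=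
  fun s t => if s = Sum.elim t c then 1 else 0

end Circuits

/-- The wires of a continuous-query algorithm on qubits: `n` index wires, the target bit and `w`
workspace wires. -/
abbrev SysWire (n w : ℕ) := (Fin n ⊕ Unit) ⊕ Fin w

/-- `b ∧ x_j` on a basis state of the system wires. -/
def sysBit {n w : ℕ} (x : (Fin n → Bool) → Bool) : (SysWire n w → Bool) → Bool :=
  wireBit Function.Embedding.inl x

/-- The time `j T / 2^r`. -/
def gridTime (T : ℝ) (r j : ℕ) : ℝ := j * T / 2 ^ r

/-- The wires of a driving circuit besides the system: two time registers of `r + 1` qubits and `a`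
ancillas. -/
abbrev TimeWire (r a : ℕ) := (Fin (r + 1) ⊕ Fin (r + 1)) ⊕ Fin a

/-- Time registers holding `j₁` and `j₂` in binary, and ancillas in the zero state. -/
def timeState (r a j₁ j₂ : ℕ) : TimeWire r a → Bool :=
  Sum.elim (Sum.elim (fun i => j₁.testBit i) (fun i => j₂.testBit i)) fun _ => false

/-- The query-free circuit `D` implements, with precision `δ`, the evolution due to `HD` between any
two times `t₁ ≤ t₂` of the grid of step `T / 2^r` on `[0, T]`, the times being given to it in two
registers: `|ψ⟩|t₁⟩|t₂⟩|0⟩ ↦ (U_{HD}(t₂,t₁)|ψ⟩)|t₁⟩|t₂⟩|0⟩`. -/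
def ImplementsDriving {n w r a : ℕ} (D : List (TwoQubitGate (SysWire n w ⊕ TimeWire r a)))
    (T : ℝ) (HD : ℝ → Matrix (SysWire n w → Bool) (SysWire n w → Bool) ℂ) (δ : ℝ) : Prop :=
  ∀ j₁ j₂ : ℕ, j₁ ≤ j₂ → j₂ ≤ 2 ^ r →
    ∃ V, IsEvolution HD (gridTime T r j₁) (gridTime T r j₂) V ∧
      ‖evalGates D * attach (SysWire n w) (timeState r a j₁ j₂) -
        attach (SysWire n w) (timeState r a j₁ j₂) * V‖ ≤ δ

/-- `log(T/ε) / log log(T/ε)`. -/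
def logRatio (T ε : ℝ) : ℝ := Real.log (T / ε) / Real.log (Real.log (T / ε))

end QuerySim

end

set_option linter.unusedSectionVars false

open scoped Matrix.Norms.L2Operator

open MeasureTheory

/-! Seen in the interaction picture of the driving, both models become a time-ordered product of
operators `U_j† Q^δ U_j` with equal exponents `δ`, followed by one fixed unitary. For a driving
Hamiltonian this is a Trotter estimate with error at most `2πδ ∫ ‖H_D‖`, valid for merely integrable
`H_D` (`norm_continuous_sub_timeProd_le`). For fractional queries it amounts to rounding the
exponents (`exists_uniform_steps`).

The product is cut into about `4T` segments of `M` steps. With `θ = πδ/2`, `Q^δ = e^{-iθ} (cos θ + i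
sin θ Q)`. So a segment is, up to a phase, `(cos θ + sin θ)^M` times a product of mixtures `(1 - p)
+ p X_j` with `X_j = i U_j† Q U_j`, that is, a multiple of an average of words in the `X_j` over
random positions ("events"). Since `M θ ≤ 1/2`, the multiple is at most 2 and the expected number of
events at most `1/2`. Averaging over two phases raises the multiple to exactly 2, whatever `M` is.
Keeping at most `K` events costs `4 / K!`, which is small enough for `K` of order `log(T/ε) / log
log(T/ε)`. A linear combination of unitaries puts half of the segment into a block of a unitary that
makes `K` queries. Because the amplitude is `1/2 = sin (π/6)`, one round of oblivious amplitude
amplification produces the segment itself (`norm_amplify_segment_sub_le`). This takes `3K` queries,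
independently of `M`, so for the query bound `M` can be arbitrarily large.

The gate count depends on how the random positions are encoded. They are stored as gaps between
events. The gaps are geometric, and a geometric variable below `2^l` has independent binary digits
(`isGeometric_gapWeight`), so one-qubit rotations prepare the superposition. Adders turn gaps into
positions, and the position bits serve directly as part of the time register of the driving circuit.
Here `M = 2^l` of order `h̄T/ε` is enough, which gives the `log(2 + h̄T/ε)` term. An error of the
driving circuit counts only at an event. It is therefore weighted by the mean number of events
rather than by `K`, and precision of order `ε/T` suffices (`walkMean_wordCount_le`). -/

namespace QuerySim

/-! ### Integration by parts for integrable matrix-valued functions -/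

section ProductRule

variable {E : Type*} [NormedRing E] [NormedAlgebra ℝ E] [CompleteSpace E]

/-- The product rule for indefinite integrals of integrable functions. -/
theorem mul_eq_integral_of_primitives {f g F G : ℝ → E} {a b : ℝ} (hab : a ≤ b)
    (hf : IntervalIntegrable f volume a b) (hg : IntervalIntegrable g volume a b)
    (hF : ∀ t ∈ Set.Icc a b, F t = F a + ∫ s in a..t, f s)
    (hG : ∀ t ∈ Set.Icc a b, G t = G a + ∫ s in a..t, g s) :
    F b * G b = F a * G a + ∫ t in a..b, (f t * G t + F t * g t) := by
  have huI : Set.uIcc a b = Set.Icc a b := Set.uIcc_of_le hab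
  -- `F` and `G` are controlled only on `[a, b]`; these formulas make sense for all times, so they
  -- can be differentiated.
  let F' : ℝ → E := fun t => F a + ∫ s in a..t, f s
  let G' : ℝ → E := fun t => G a + ∫ s in a..t, g s
  have sub {u v : ℝ} (hu : u ∈ Set.Icc a b) (hv : v ∈ Set.Icc a b) : Set.uIcc u v ⊆ Set.uIcc a b := by
    rw [huI]; exact Set.uIcc_subset_Icc hu hv
  have ha : a ∈ Set.Icc a b := ⟨le_rfl, hab⟩
  have hb : b ∈ Set.Icc a b := ⟨hab, le_rfl⟩
  have cF : ContinuousOn F' (Set.uIcc a b) :=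
    continuousOn_const.add (intervalIntegral.continuousOn_primitive_interval
      (by rw [huI]; exact (intervalIntegrable_iff_integrableOn_Icc_of_le hab).1 hf))
  have cG : ContinuousOn G' (Set.uIcc a b) :=
    continuousOn_const.add (intervalIntegral.continuousOn_primitive_interval
      (by rw [huI]; exact (intervalIntegrable_iff_integrableOn_Icc_of_le hab).1 hg))
  have ifG : IntervalIntegrable (fun t => f t * G' t) volume a b := hf.mul_continuousOn cG
  have iFg : IntervalIntegrable (fun t => F' t * g t) volume a b := hg.continuousOn_mul cF
  have iH := ifG.add iFg
  obtain ⟨C₁, hC₁⟩ := isCompact_uIcc.exists_bound_of_continuousOn cF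
  obtain ⟨C₂, hC₂⟩ := isCompact_uIcc.exists_bound_of_continuousOn cG
  let h : ℝ → E := fun t => f t * G' t + F' t * g t
  -- `φ` is absolutely continuous with derivative zero almost everywhere, hence constant; the claim
  -- compares its values at `a` and `b`.
  let φ : ℝ → E := fun t => F' t * G' t - ∫ s in a..t, h s
  -- Increments of `φ` are dominated by the integral of `lam`, so `φ` inherits absolute continuity
  -- from a real primitive.
  let lam : ℝ → ℝ := fun t => (C₂ * ‖f t‖ + C₁ * ‖g t‖) + ‖h t‖
  have ilam : IntervalIntegrable lam volume a b :=
    ((hf.norm.const_mul _).add (hg.norm.const_mul _)).add iH.norm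
  have hAC : AbsolutelyContinuousOnInterval φ a b := by
    have := ilam.absolutelyContinuousOnInterval_intervalIntegral (c := a) (by simp)
    unfold AbsolutelyContinuousOnInterval at this ⊢
    refine squeeze_zero' (Filter.Eventually.of_forall fun _ =>
      Finset.sum_nonneg fun i hi => dist_nonneg) ?_ this
    rw [Filter.eventually_inf_principal]
    refine Filter.Eventually.of_forall fun ⟨n, I⟩ hnI => Finset.sum_le_sum fun i hi => ?_
    have key : ∀ u v, u ∈ Set.Icc a b → v ∈ Set.Icc a b → u ≤ v →
        dist (φ u) (φ v) ≤ dist (∫ s in a..u, lam s) (∫ s in a..v, lam s) := by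
      intro u v hu hv huv
      have e1 : ∀ {w : ℝ → E}, IntervalIntegrable w volume a b →
          (∫ s in a..v, w s) - (∫ s in a..u, w s) = ∫ s in u..v, w s := fun hw =>
        intervalIntegral.integral_interval_sub_left (hw.mono_set (sub ha hv))
          (hw.mono_set (sub ha hu))
      have e2 : (∫ s in a..v, lam s) - (∫ s in a..u, lam s) = ∫ s in u..v, lam s :=
        intervalIntegral.integral_interval_sub_left (ilam.mono_set (sub ha hv))
          (ilam.mono_set (sub ha hu))
      rw [dist_comm, dist_eq_norm, dist_comm, Real.dist_eq, e2]
      refine le_trans ?_ (le_abs_self _)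
      have e3 : φ v - φ u = (∫ s in u..v, f s) * G' v + F' u * (∫ s in u..v, g s)
          - ∫ s in u..v, h s := by
        have := e1 iH
        rw [← this, ← e1 hf, ← e1 hg]
        simp only [φ, F', G']
        simp only [h, F', G']
        noncomm_ring
      rw [e3]
      have b1 : ‖∫ s in u..v, f s‖ ≤ ∫ s in u..v, ‖f s‖ :=
        intervalIntegral.norm_integral_le_integral_norm huv
      have b2 : ‖∫ s in u..v, g s‖ ≤ ∫ s in u..v, ‖g s‖ :=
        intervalIntegral.norm_integral_le_integral_norm huv
      have b3 : ‖∫ s in u..v, h s‖ ≤ ∫ s in u..v, ‖h s‖ :=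
        intervalIntegral.norm_integral_le_integral_norm huv
      have c1 := hC₁ u (huI ▸ hu)
      have c2 := hC₂ v (huI ▸ hv)
      have jf := (hf.norm.mono_set (sub hu hv))
      have jg := (hg.norm.mono_set (sub hu hv))
      have jh := (iH.norm.mono_set (sub hu hv))
      have e4 : ∫ s in u..v, lam s = C₂ * (∫ s in u..v, ‖f s‖) + C₁ * (∫ s in u..v, ‖g s‖)
          + ∫ s in u..v, ‖h s‖ := by
        simp only [lam]
        rw [intervalIntegral.integral_add ((jf.const_mul _).add (jg.const_mul _)) jh,
          intervalIntegral.integral_add (jf.const_mul _) (jg.const_mul _),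
          intervalIntegral.integral_const_mul, intervalIntegral.integral_const_mul]
      rw [e4]
      refine (norm_sub_le _ _).trans (add_le_add ((norm_add_le _ _).trans (add_le_add ?_ ?_)) b3)
      · refine (norm_mul_le _ _).trans ?_
        rw [mul_comm]
        exact mul_le_mul c2 b1 (norm_nonneg _) ((norm_nonneg _).trans c2)
      · refine (norm_mul_le _ _).trans ?_
        exact mul_le_mul c1 b2 (norm_nonneg _) ((norm_nonneg _).trans c1)
    have h12 := hnI.1 i hi
    rw [huI] at h12
    rcases le_total (I i).1 (I i).2 with hle | hle
    · exact key _ _ h12.1 h12.2 hle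
    · have := key _ _ h12.2 h12.1 hle
      rwa [dist_comm, dist_comm (∫ s in a..(I i).2, lam s)] at this
  have hder : ∀ᵐ x, x ∈ Set.uIcc a b → HasDerivAt φ 0 x := by
    filter_upwards [hf.ae_hasDerivAt_integral, hg.ae_hasDerivAt_integral,
      iH.ae_hasDerivAt_integral] with x h1 h2 h3 hx
    have d1 : HasDerivAt F' (f x) x := (h1 hx a (by simp)).const_add _
    have d2 : HasDerivAt G' (g x) x := (h2 hx a (by simp)).const_add _
    have d3 := h3 hx a (by simp)
    have := (d1.mul d2).sub d3
    convert! this using 1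
    simp
  obtain ⟨c, hc⟩ := hAC.const_of_ae_hasDerivAt_zero hder
  have p1 := hc a (by simp)
  have p2 := hc b (by simp)
  have hFa : F' a = F a := by simp [F']
  have hGa : G' a = G a := by simp [G']
  have hFb : F' b = F b := (hF b hb).symm
  have hGb : G' b = G b := (hG b hb).symm
  have e5 : ∫ t in a..b, (f t * G t + F t * g t) = ∫ t in a..b, h t := by
    refine intervalIntegral.integral_congr fun t ht => ?_
    rw [huI] at ht
    simp only [h, F', G']
    rw [← hF t ht, ← hG t ht]
  rw [e5]
  simp only [φ, intervalIntegral.integral_same, sub_zero] at p1 p2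
  rw [hFa, hGa] at p1
  rw [hFb, hGb] at p2
  rw [p1, ← p2]; abel

end ProductRule

/-- The time-ordered product `X (a + n - 1) * ⋯ * X (a + 1) * X a`. -/
def timeProd {R : Type*} [Monoid R] (X : ℕ → R) (a : ℕ) : ℕ → R
  | 0 => 1
  | n + 1 => X (a + n) * timeProd X a n

/-! ### Algebra of time-ordered products -/

section TimeProd

variable {R : Type*} [Monoid R] (X : ℕ → R)

theorem timeProd_add (a m n : ℕ) :
    timeProd X a (m + n) = timeProd X (a + m) n * timeProd X a m := by
  induction n with
  | zero => simp [timeProd]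
  | succ n ih => rw [← add_assoc, timeProd, timeProd, ih, mul_assoc, add_assoc]

theorem timeProd_succ' (a n : ℕ) : timeProd X a (n + 1) = timeProd X (a + 1) n * X a := by
  rw [add_comm n 1, timeProd_add]; simp [timeProd]

theorem timeProd_congr {X Y : ℕ → R} {a n : ℕ} (h : ∀ j, a ≤ j → j < a + n → X j = Y j) :
    timeProd X a n = timeProd Y a n := by
  induction n with
  | zero => rfl
  | succ n ih => rw [timeProd, timeProd, h _ (by omega) (by omega), ih fun j h1 h2 => h j h1 (by omega)]

theorem timeProd_shift (a b n : ℕ) :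
    timeProd (fun j => X (b + j)) a n = timeProd X (b + a) n := by
  induction n with
  | zero => rfl
  | succ n ih => simp [timeProd, ih, add_assoc]

end TimeProd

/-! ### Schrödinger evolutions and the Trotter estimate -/

section Evolution

variable {β : Type*} [Fintype β] [DecidableEq β]

/-- `U` solves `i dU/dt = H U` on `[a, b]`, in integrated form. -/
def IsSolution (H : ℝ → Matrix β β ℂ) (a b : ℝ) (U : ℝ → Matrix β β ℂ) : Prop :=
  ContinuousOn U (Set.Icc a b) ∧
    ∀ t ∈ Set.Icc a b, U t = U a - Complex.I • ∫ τ in a..t, H τ * U τ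

theorem IsEvolution.exists_isSolution {H : ℝ → Matrix β β ℂ} {a b : ℝ} {V : Matrix β β ℂ}
    (hab : a ≤ b) (h : IsEvolution H a b V) : ∃ U, IsSolution H a b U ∧ U a = 1 ∧ U b = V := by
  obtain ⟨U, hc, hU, hV⟩ := h
  have h1 : U a = 1 := by simpa using hU a ⟨le_rfl, hab⟩
  exact ⟨U, ⟨hc, by rwa [h1]⟩, h1, hV⟩

theorem intervalIntegrable_of_subset {E : Type*} [NormedAddCommGroup E] {f : ℝ → E} {a b s t : ℝ}
    (i : IntervalIntegrable f volume a b) (hs : a ≤ s) (hst : s ≤ t) (ht : t ≤ b) :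
    IntervalIntegrable f volume s t :=
  i.mono_set (by
    rw [Set.uIcc_of_le hst, Set.uIcc_of_le (hs.trans (hst.trans ht))]
    exact Set.Icc_subset_Icc hs ht)

theorem IsSolution.integrable {H U : ℝ → Matrix β β ℂ} {a b : ℝ} (hab : a ≤ b)
    (h : IsSolution H a b U) (i : IntervalIntegrable H volume a b) :
    IntervalIntegrable (fun t => H t * U t) volume a b :=
  i.mul_continuousOn (by rw [Set.uIcc_of_le hab]; exact h.1)

theorem IsSolution.mono {H U : ℝ → Matrix β β ℂ} {a b s t : ℝ} (h : IsSolution H a b U)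
    (i : IntervalIntegrable H volume a b) (hs : a ≤ s) (hst : s ≤ t) (ht : t ≤ b) :
    IsSolution H s t U := by
  refine ⟨h.1.mono (Set.Icc_subset_Icc hs ht), fun u hu => ?_⟩
  have iU := h.integrable (hs.trans (hst.trans ht)) i
  rw [h.2 u ⟨hs.trans hu.1, hu.2.trans ht⟩, h.2 s ⟨hs, hst.trans ht⟩,
    ← intervalIntegral.integral_interval_sub_left
      (intervalIntegrable_of_subset iU le_rfl (hs.trans hu.1) (hu.2.trans ht))
      (intervalIntegrable_of_subset iU le_rfl hs (hst.trans ht)), smul_sub]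
  abel

/-- The product rule for `A† B`: as `H₁` is Hermitian, the two Hamiltonians enter only through their
difference. Unitarity, uniqueness, the passage to the interaction picture and all perturbation
bounds are instances of this formula. -/
theorem IsSolution.conjTranspose_mul {H₁ H₂ A B : ℝ → Matrix β β ℂ} {a b : ℝ} (hab : a ≤ b)
    (hH : ∀ t ∈ Set.Icc a b, (H₁ t).IsHermitian)
    (i₁ : IntervalIntegrable H₁ volume a b) (i₂ : IntervalIntegrable H₂ volume a b)
    (hA : IsSolution H₁ a b A) (hB : IsSolution H₂ a b B) :
    (A b).conjTranspose * B b =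
      (A a).conjTranspose * B a - Complex.I • ∫ t in a..b, (A t).conjTranspose * (H₂ t - H₁ t) * B t := by
  have huI : Set.uIcc a b = Set.Icc a b := Set.uIcc_of_le hab
  have cA := hA.1
  have cB := hB.1
  rw [← huI] at cA cB
  have iA : IntervalIntegrable (fun t => H₁ t * A t) volume a b := i₁.mul_continuousOn cA
  have iB : IntervalIntegrable (fun t => H₂ t * B t) volume a b := i₂.mul_continuousOn cB
  let L : Matrix β β ℂ →L[ℝ] Matrix β β ℂ := (starL' ℝ : Matrix β β ℂ ≃L[ℝ] Matrix β β ℂ)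
  have hL : ∀ M, L M = M.conjTranspose := fun M => rfl
  have hstar : IntervalIntegrable (fun t => L (H₁ t * A t)) volume a b :=
    ⟨L.integrable_comp iA.1, L.integrable_comp iA.2⟩
  have h1 : ∀ t ∈ Set.Icc a b, (A t).conjTranspose = (A a).conjTranspose +
      ∫ s in a..t, Complex.I • L (H₁ s * A s) := by
    intro t ht
    rw [intervalIntegral.integral_smul, L.intervalIntegral_comp_comm
      (iA.mono_set (by rw [huI]; exact Set.uIcc_subset_Icc ⟨le_rfl, hab⟩ ht)), hA.2 t ht, hL]
    simp [Matrix.conjTranspose_sub, Matrix.conjTranspose_smul]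
  have h2 : ∀ t ∈ Set.Icc a b, B t = B a + ∫ s in a..t, (-Complex.I) • (H₂ s * B s) := by
    intro t ht
    rw [intervalIntegral.integral_smul, neg_smul, ← sub_eq_add_neg]
    exact hB.2 t ht
  have := mul_eq_integral_of_primitives hab (hstar.smul Complex.I) (iB.smul (-Complex.I)) h1 h2
  rw [this, sub_eq_add_neg, ← smul_neg,
    ← intervalIntegral.integral_neg, ← intervalIntegral.integral_smul]
  congr 1
  refine intervalIntegral.integral_congr fun t ht => ?_
  rw [huI] at ht
  simp only [hL, Matrix.conjTranspose_mul, (hH t ht).eq, Pi.smul_apply]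
  simp only [Matrix.mul_sub, Matrix.sub_mul, smul_mul_assoc, Matrix.mul_smul, neg_smul, Matrix.mul_neg,
    Matrix.mul_assoc, smul_sub, neg_sub]
  abel

theorem IsSolution.conjTranspose_mul_self {H U : ℝ → Matrix β β ℂ} {a b : ℝ}
    (hH : ∀ t ∈ Set.Icc a b, (H t).IsHermitian) (i : IntervalIntegrable H volume a b)
    (hU : IsSolution H a b U) (h1 : U a = 1) {t : ℝ} (ht : t ∈ Set.Icc a b) :
    (U t).conjTranspose * U t = 1 := by
  have i' := intervalIntegrable_of_subset i le_rfl ht.1 ht.2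
  have hU' := hU.mono i le_rfl ht.1 ht.2
  have := IsSolution.conjTranspose_mul ht.1 (fun s hs => hH s ⟨hs.1, hs.2.trans ht.2⟩) i' i'
    hU' hU'
  simpa [h1] using this

/-- With equal Hamiltonians `U† V` is constant, and `U` is unitary. -/
theorem IsSolution.eq {H U V : ℝ → Matrix β β ℂ} {a b : ℝ} (hab : a ≤ b)
    (hH : ∀ t ∈ Set.Icc a b, (H t).IsHermitian) (i : IntervalIntegrable H volume a b)
    (hU : IsSolution H a b U) (hV : IsSolution H a b V) (hUa : U a = 1) (hVa : V a = 1) :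
    U b = V b := by
  have h1 := hU.conjTranspose_mul_self hH i hUa (t := b) ⟨hab, le_rfl⟩
  have h2 := IsSolution.conjTranspose_mul hab hH i i hU hV
  simp only [sub_self, mul_zero, zero_mul, intervalIntegral.integral_zero, smul_zero,
    sub_zero, hUa, hVa, Matrix.conjTranspose_one, mul_one] at h2
  have h3 := mul_eq_one_comm.1 h1
  calc U b = U b * ((U b).conjTranspose * V b) := by rw [h2, mul_one]
    _ = V b := by rw [← mul_assoc, h3, one_mul]

theorem norm_le_one_of_conjTranspose_mul_self {γ : Type*} [Fintype γ] [DecidableEq γ]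
    {U : Matrix γ β ℂ} (h : U.conjTranspose * U = 1) : ‖U‖ ≤ 1 := by
  have h1 := Matrix.l2_opNorm_conjTranspose_mul_self U
  rw [h] at h1
  have h2 : ‖(1 : Matrix β β ℂ)‖ ≤ 1 := by
    rw [← Matrix.diagonal_one, Matrix.l2_opNorm_diagonal]
    exact (pi_norm_le_iff_of_nonneg zero_le_one).2 fun _ => by simp
  nlinarith [norm_nonneg U]

theorem IsSolution.norm_sub_le {H U : ℝ → Matrix β β ℂ} {a b : ℝ}
    (hH : ∀ t ∈ Set.Icc a b, (H t).IsHermitian) (i : IntervalIntegrable H volume a b)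
    (hU : IsSolution H a b U) (h1 : U a = 1) {s t : ℝ} (hs : a ≤ s) (hst : s ≤ t) (ht : t ≤ b) :
    ‖U t - U s‖ ≤ ∫ τ in s..t, ‖H τ‖ := by
  have hU' := hU.mono i hs hst ht
  rw [hU'.2 t ⟨hst, le_rfl⟩, sub_sub_cancel_left, norm_neg, norm_smul, Complex.norm_I, one_mul]
  refine intervalIntegral.norm_integral_le_of_norm_le hst (ae_of_all _ fun τ hτ => ?_)
    (intervalIntegrable_of_subset i hs hst ht).norm
  have hτ' : τ ∈ Set.Icc a b := ⟨by linarith [hτ.1], by linarith [hτ.2]⟩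
  refine (norm_mul_le _ _).trans ?_
  have := norm_le_one_of_conjTranspose_mul_self (hU.conjTranspose_mul_self hH i h1 hτ')
  exact mul_le_of_le_one_right (norm_nonneg _) this

/-- The phase `exp (-i π α)` of a fractional query. -/
noncomputable def queryPhase (α : ℝ) : ℂ := Complex.exp (-Complex.I * Real.pi * α)

/-- The projection onto the basis states with `f s = true`. -/
def queryProj (f : β → Bool) : Matrix β β ℂ := Matrix.diagonal fun s => if f s then 1 else 0

theorem queryProj_mul_self (f : β → Bool) : queryProj f * queryProj f = queryProj f := by
  simp [queryProj, Matrix.diagonal_mul_diagonal]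

theorem queryProj_isHermitian (f : β → Bool) : (queryProj f).IsHermitian := by
  rw [queryProj, Matrix.isHermitian_diagonal_iff]
  intro s; by_cases h : f s <;> simp [h, isSelfAdjoint_iff]

theorem norm_queryProj_le (f : β → Bool) : ‖queryProj f‖ ≤ 1 := by
  rw [queryProj, Matrix.l2_opNorm_diagonal]
  exact (pi_norm_le_iff_of_nonneg zero_le_one).2 fun s => by by_cases h : f s <;> simp [h]

theorem queryHamiltonian_eq (f : β → Bool) :
    queryHamiltonian f = (Real.pi : ℂ) • queryProj f := by
  ext s t; by_cases h : s = t <;> simp [queryHamiltonian, queryProj, Matrix.diagonal, h]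

theorem fractionalQuery_eq (f : β → Bool) (α : ℝ) :
    fractionalQuery f α = 1 + (queryPhase α - 1) • queryProj f := by
  ext s t
  by_cases h : s = t
  · subst h
    by_cases hf : f s <;> simp [fractionalQuery, queryProj, queryPhase, hf]
  · simp [fractionalQuery, queryProj, Matrix.diagonal, h]

theorem norm_queryPhase (α : ℝ) : ‖queryPhase α‖ = 1 := by
  rw [queryPhase, Complex.norm_exp]; simp

theorem queryPhase_add (α α' : ℝ) : queryPhase (α + α') = queryPhase α * queryPhase α' := by
  rw [queryPhase, queryPhase, queryPhase, ← Complex.exp_add]; push_cast; ring_nf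

theorem conj_queryPhase_mul (α : ℝ) : star (queryPhase α) * queryPhase α = 1 := by
  rw [Complex.star_def, mul_comm, Complex.mul_conj, Complex.normSq_eq_norm_sq, norm_queryPhase]
  simp

theorem hasDerivAt_queryPhase (t : ℝ) :
    HasDerivAt queryPhase ((-Complex.I * Real.pi) * queryPhase t) t := by
  have h1 : HasDerivAt (fun α : ℝ => -Complex.I * Real.pi * (α : ℂ)) (-Complex.I * Real.pi) t := by
    simpa using (Complex.ofRealCLM.hasDerivAt (x := t)).const_mul (-Complex.I * Real.pi)
  have := h1.cexp
  rw [mul_comm]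
  exact this

/-- The rotation `1 + (exp (-i π α) - 1) P` generated by the projection `P`. -/
noncomputable def projRotation (P : Matrix β β ℂ) (α : ℝ) : Matrix β β ℂ := 1 + (queryPhase α - 1) • P

theorem isSolution_projRotation {P : Matrix β β ℂ} (hP : P * P = P) {a b : ℝ} :
    IsSolution (fun _ => (Real.pi : ℂ) • P) a b (fun t => projRotation P (t - a)) := by
  have hd : ∀ t, HasDerivAt (fun t => projRotation P (t - a))
      ((-Complex.I) • (((Real.pi : ℂ) • P) * projRotation P (t - a))) t := by
    intro t
    have h1 : HasDerivAt (fun t : ℝ => queryPhase (t - a) - 1)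
        ((-Complex.I * Real.pi) * queryPhase (t - a)) t := by
      simpa using ((hasDerivAt_queryPhase (t - a)).comp_sub_const t a).sub_const 1
    have h2 := (h1.smul_const P).const_add (1 : Matrix β β ℂ)
    convert! h2 using 1
    rw [projRotation, mul_add, mul_one, mul_smul_comm, smul_mul_assoc, hP, smul_smul, smul_add,
      smul_smul, smul_smul, ← add_smul]
    congr 1; ring
  have hc : Continuous (fun t => projRotation P (t - a)) :=
    continuous_iff_continuousAt.2 fun t => (hd t).continuousAt
  refine ⟨hc.continuousOn, fun t ht => ?_⟩
  have hi : IntervalIntegrable (fun t => (-Complex.I) •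
      (((Real.pi : ℂ) • P) * projRotation P (t - a))) volume a t :=
    Continuous.intervalIntegrable (by fun_prop) _ _
  have := intervalIntegral.integral_eq_sub_of_hasDerivAt (fun x _ => hd x) hi
  rw [intervalIntegral.integral_smul, neg_smul] at this
  rw [sub_eq_add_neg, this]
  abel

theorem conjTranspose_projRotation_mul {P : Matrix β β ℂ} (hP : P * P = P)
    (hH : P.IsHermitian) (α : ℝ) : (projRotation P α).conjTranspose * projRotation P α = 1 := by
  have h := conj_queryPhase_mul α
  rw [projRotation, Matrix.conjTranspose_add, Matrix.conjTranspose_smul, hH.eq,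
    Matrix.conjTranspose_one, add_mul, one_mul, mul_add, mul_one,
    smul_mul_assoc, mul_smul_comm, hP, star_sub, star_one, add_assoc]
  conv_rhs => rw [← add_zero (1 : Matrix β β ℂ)]
  congr 1
  rw [smul_smul, ← add_smul, ← add_smul]
  have : queryPhase α - 1 + (star (queryPhase α) - 1 + (star (queryPhase α) - 1) *
    (queryPhase α - 1)) = 0 := by linear_combination h
  rw [this, zero_smul]

/-- Trotter formula for a projection and an integrable driving Hamiltonian, in the interaction
picture of the driving Hamiltonian. -/
theorem norm_interaction_sub_timeProd_le {P : Matrix β β ℂ} (hP : P * P = P) (hPH : P.IsHermitian)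
    (hPn : ‖P‖ ≤ 1) {HD U V : ℝ → Matrix β β ℂ} {T : ℝ}
    (hD : IsDriving T HD) (hU : IsSolution HD 0 T U) (hU0 : U 0 = 1)
    (hV : IsSolution (fun t => (Real.pi : ℂ) • P + HD t) 0 T V) (hV0 : V 0 = 1)
    {δ : ℝ} (hδ : 0 ≤ δ) (n : ℕ) (hn : n * δ ≤ T) :
    ‖(U (n * δ)).conjTranspose * V (n * δ) - timeProd
      (fun j : ℕ => (U (j * δ)).conjTranspose * projRotation P δ * U (j * δ)) 0 n‖ ≤
      2 * Real.pi * δ * ∫ t in (0 : ℝ)..(n * δ), ‖HD t‖ := by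
  have hT : 0 ≤ T := le_trans (by positivity) hn
  obtain ⟨hDH, hDi⟩ := hD
  have hpi : ((Real.pi : ℂ) • P).IsHermitian := by
    rw [Matrix.IsHermitian, Matrix.conjTranspose_smul, hPH.eq]; simp
  have hVH : ∀ t ∈ Set.Icc 0 T, ((Real.pi : ℂ) • P + HD t).IsHermitian := fun t ht =>
    hpi.add (hDH t ht)
  have hVi : IntervalIntegrable (fun t => (Real.pi : ℂ) • P + HD t) volume 0 T :=
    intervalIntegrable_const.add hDi
  have uU : ∀ {t}, t ∈ Set.Icc 0 T → (U t).conjTranspose * U t = 1 := fun ht =>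
    hU.conjTranspose_mul_self hDH hDi hU0 ht
  have uV : ∀ {t}, t ∈ Set.Icc 0 T → (V t).conjTranspose * V t = 1 := fun ht =>
    hV.conjTranspose_mul_self hVH hVi hV0 ht
  have uU' : ∀ {t}, t ∈ Set.Icc 0 T → U t * (U t).conjTranspose = 1 := fun ht =>
    mul_eq_one_comm.1 (uU ht)
  have nU : ∀ {t}, t ∈ Set.Icc 0 T → ‖U t‖ ≤ 1 := fun ht =>
    norm_le_one_of_conjTranspose_mul_self (uU ht)
  have nU' : ∀ {t}, t ∈ Set.Icc 0 T → ‖(U t).conjTranspose‖ ≤ 1 := fun ht => by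
    rw [Matrix.l2_opNorm_conjTranspose]; exact nU ht
  let Y : ℝ → Matrix β β ℂ := fun t => (U t).conjTranspose * V t
  let HI : ℝ → Matrix β β ℂ := fun t => (Real.pi : ℂ) • ((U t).conjTranspose * P * U t)
  have cUs : ContinuousOn (fun t => (U t).conjTranspose) (Set.Icc 0 T) :=
    continuous_star.comp_continuousOn hU.1
  have cHI : ContinuousOn HI (Set.Icc 0 T) :=
    ContinuousOn.const_smul ((cUs.mul (continuousOn_const (c := P))).mul hU.1) (Real.pi : ℂ)
  have iHI : IntervalIntegrable HI volume 0 T :=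
    ContinuousOn.intervalIntegrable (by rwa [Set.uIcc_of_le hT])
  have hY : IsSolution HI 0 T Y := by
    refine ⟨cUs.mul hV.1, fun t ht => ?_⟩
    have h := IsSolution.conjTranspose_mul ht.1 (fun s hs => hDH s ⟨hs.1, hs.2.trans ht.2⟩)
      (intervalIntegrable_of_subset hDi le_rfl ht.1 ht.2)
      (intervalIntegrable_of_subset hVi le_rfl ht.1 ht.2)
      (hU.mono hDi le_rfl ht.1 ht.2) (hV.mono hVi le_rfl ht.1 ht.2)
    simp only [Y]
    rw [h]
    congr 2
    refine intervalIntegral.integral_congr fun s hs => ?_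
    rw [Set.uIcc_of_le ht.1] at hs
    have hs' : s ∈ Set.Icc 0 T := ⟨hs.1, hs.2.trans ht.2⟩
    simp only [HI, add_sub_cancel_right, smul_mul_assoc, Matrix.mul_smul]
    congr 1
    calc (U s).conjTranspose * P * V s
        = (U s).conjTranspose * P * (U s * (U s).conjTranspose) * V s := by rw [uU' hs', mul_one]
      _ = _ := by noncomm_ring
  have nY : ∀ {t}, t ∈ Set.Icc 0 T → ‖Y t‖ ≤ 1 := fun ht =>
    norm_le_one_of_conjTranspose_mul_self (by
      simp only [Y, Matrix.conjTranspose_mul, Matrix.conjTranspose_conjTranspose]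
      calc _ = (V _).conjTranspose * (U _ * (U _).conjTranspose) * V _ := by noncomm_ring
        _ = 1 := by rw [uU' ht, mul_one, uV ht])
  have step : ∀ s t, 0 ≤ s → s ≤ t → t ≤ T →
      ‖Y t - (U s).conjTranspose * projRotation P (t - s) * U s * Y s‖ ≤
        2 * Real.pi * (t - s) * ∫ τ in s..t, ‖HD τ‖ := by
    intro s t hs hst ht
    have ms : s ∈ Set.Icc 0 T := ⟨hs, hst.trans ht⟩
    -- The frozen interaction Hamiltonian `π P'` is again `π` times a projection, so its evolution
    -- is an explicit rotation, equal to the rotation by `P` conjugated by `U s`.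
    let P' := (U s).conjTranspose * P * U s
    have hP' : P' * P' = P' := by
      calc P' * P' = (U s).conjTranspose * P * (U s * (U s).conjTranspose) * P * U s := by
            simp only [P']; noncomm_ring
        _ = P' := by rw [uU' ms, mul_one, mul_assoc _ P P, hP]
    have hPH' : P'.IsHermitian := by
      simp only [P', Matrix.IsHermitian, Matrix.conjTranspose_mul,
        Matrix.conjTranspose_conjTranspose, hPH.eq, mul_assoc]
    have hrot : ∀ α, projRotation P' α = (U s).conjTranspose * projRotation P α * U s := by
      intro α
      simp only [projRotation, P', mul_add, add_mul, mul_one, uU ms, Matrix.mul_smul,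
        Matrix.smul_mul]
    have hsol := isSolution_projRotation hP' (a := s) (b := t)
    have hpi' : ((Real.pi : ℂ) • P').IsHermitian := by
      rw [Matrix.IsHermitian, Matrix.conjTranspose_smul, hPH'.eq]; simp
    have h := IsSolution.conjTranspose_mul hst (fun _ _ => hpi')
      intervalIntegrable_const (intervalIntegrable_of_subset iHI hs hst ht)
      hsol (hY.mono iHI hs hst ht)
    have r0 : projRotation P' 0 = 1 := by simp [projRotation, queryPhase]
    simp only [sub_self, r0, Matrix.conjTranspose_one, one_mul] at h
    have nR : ∀ α, ‖projRotation P' α‖ ≤ 1 := fun α =>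
      norm_le_one_of_conjTranspose_mul_self (conjTranspose_projRotation_mul hP' hPH' α)
    -- The deviation of `Y t` from the frozen evolution is a unitary times the increment of `R† Y`,
    -- to which the comparison formula applies.
    have e : Y t - (U s).conjTranspose * projRotation P (t - s) * U s * Y s =
        projRotation P' (t - s) * ((projRotation P' (t - s)).conjTranspose * Y t - Y s) := by
      rw [mul_sub, ← mul_assoc (projRotation P' (t - s)) _ (Y t),
        mul_eq_one_comm.1 (conjTranspose_projRotation_mul hP' hPH' _), one_mul, ← hrot]
    rw [e, h, sub_sub_cancel_left]
    refine (norm_mul_le _ _).trans ((mul_le_of_le_one_left (norm_nonneg _) (nR _)).trans ?_)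
    rw [norm_neg, norm_smul, Complex.norm_I, one_mul]
    have hnn : 0 ≤ ∫ τ in s..t, ‖HD τ‖ :=
      intervalIntegral.integral_nonneg hst fun _ _ => norm_nonneg _
    have := intervalIntegral.norm_integral_le_of_norm_le_const (a := s) (b := t)
      (f := fun x => (projRotation P' (x - s)).conjTranspose * (HI x - (Real.pi : ℂ) • P') * Y x)
      (C := 2 * Real.pi * ∫ τ in s..t, ‖HD τ‖) (by
      intro x hx
      rw [Set.uIoc_of_le hst] at hx
      have mx : x ∈ Set.Icc 0 T := ⟨hs.trans hx.1.le, hx.2.trans ht⟩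
      refine (norm_mul_le _ _).trans ((mul_le_of_le_one_right (norm_nonneg _) (nY mx)).trans ?_)
      refine (norm_mul_le _ _).trans ((mul_le_of_le_one_left (norm_nonneg _) (by
        rw [Matrix.l2_opNorm_conjTranspose]; exact nR _)).trans ?_)
      -- On `[s, t]` the interaction Hamiltonian drifts from its value at `s` by at most `2π` times
      -- the displacement of `U`, which is bounded by the integral of `‖HD‖`; no regularity of `HD`
      -- is used.
      have e2 : HI x - (Real.pi : ℂ) • P' = (Real.pi : ℂ) •
          ((U x).conjTranspose * P * (U x - U s) + (U x - U s).conjTranspose * P * U s) := by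
        simp only [HI, P', ← smul_sub, Matrix.conjTranspose_sub]
        congr 1; noncomm_ring
      have hd : ‖U x - U s‖ ≤ ∫ τ in s..t, ‖HD τ‖ := by
        refine (hU.norm_sub_le hDH hDi hU0 hs hx.1.le mx.2).trans ?_
        exact intervalIntegral.integral_mono_interval le_rfl hx.1.le hx.2
          (ae_of_all _ fun _ => norm_nonneg _) (intervalIntegrable_of_subset hDi hs hst ht).norm
      have hd' : ‖(U x - U s).conjTranspose‖ ≤ ∫ τ in s..t, ‖HD τ‖ := by
        rw [Matrix.l2_opNorm_conjTranspose]; exact hd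
      rw [e2, norm_smul, Complex.norm_real, Real.norm_of_nonneg Real.pi_pos.le]
      have b1 : ‖(U x).conjTranspose * P * (U x - U s)‖ ≤ 1 * 1 * ∫ τ in s..t, ‖HD τ‖ :=
        (norm_mul_le _ _).trans (mul_le_mul ((norm_mul_le _ _).trans
          (mul_le_mul (nU' mx) hPn (norm_nonneg _) zero_le_one)) hd (norm_nonneg _) (by norm_num))
      have b2 : ‖(U x - U s).conjTranspose * P * U s‖ ≤ (∫ τ in s..t, ‖HD τ‖) * 1 * 1 :=
        (norm_mul_le _ _).trans (mul_le_mul ((norm_mul_le _ _).trans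
          (mul_le_mul hd' hPn (norm_nonneg _) hnn)) (nU ms) (norm_nonneg _) (by linarith))
      have b3 := (norm_add_le _ _).trans (add_le_add b1 b2)
      calc _ ≤ Real.pi * _ := mul_le_mul_of_nonneg_left b3 Real.pi_pos.le
        _ = _ := by ring)
    rw [abs_of_nonneg (by linarith)] at this
    calc _ ≤ _ := this
      _ = _ := by ring
  induction n with
  | zero => simp [hU0, hV0, timeProd]
  | succ n ih =>
    have hnδ : (n : ℝ) * δ ≤ (n + 1 : ℕ) * δ := by push_cast; nlinarith
    have ih := ih (hnδ.trans hn)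
    have h0 : (0 : ℝ) ≤ n * δ := by positivity
    have hs := step (n * δ) ((n + 1 : ℕ) * δ) h0 hnδ hn
    have m : (n * δ : ℝ) ∈ Set.Icc 0 T := ⟨h0, hnδ.trans hn⟩
    rw [timeProd, zero_add]
    have hdiff : ((n + 1 : ℕ) : ℝ) * δ - n * δ = δ := by push_cast; ring
    rw [hdiff] at hs
    rw [← intervalIntegral.integral_add_adjacent_intervals
      (intervalIntegrable_of_subset hDi le_rfl h0 m.2).norm
      (intervalIntegrable_of_subset hDi h0 hnδ hn).norm]
    have nR : ‖(U (n * δ)).conjTranspose * projRotation P δ * U (n * δ)‖ ≤ 1 := by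
      have h1 := norm_le_one_of_conjTranspose_mul_self (conjTranspose_projRotation_mul hP hPH δ)
      calc _ ≤ 1 * 1 * 1 := (norm_mul_le _ _).trans (mul_le_mul ((norm_mul_le _ _).trans
          (mul_le_mul (nU' m) h1 (norm_nonneg _) zero_le_one)) (nU m) (norm_nonneg _) (by norm_num))
        _ = 1 := by norm_num
    have e : (U ((n + 1 : ℕ) * δ)).conjTranspose * V ((n + 1 : ℕ) * δ) -
        (U (n * δ)).conjTranspose * projRotation P δ * U (n * δ) * timeProd
          (fun j : ℕ => (U (j * δ)).conjTranspose * projRotation P δ * U (j * δ)) 0 n =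
        (Y ((n + 1 : ℕ) * δ) - (U (n * δ)).conjTranspose * projRotation P δ * U (n * δ) * Y (n * δ))
        + (U (n * δ)).conjTranspose * projRotation P δ * U (n * δ) * (Y (n * δ) - timeProd
          (fun j : ℕ => (U (j * δ)).conjTranspose * projRotation P δ * U (j * δ)) 0 n) := by
      rw [mul_sub]; simp only [Y]; abel
    rw [e]
    refine (norm_add_le _ _).trans ?_
    have := (norm_mul_le _ _).trans ((mul_le_of_le_one_left (norm_nonneg _) nR).trans ih)
    linarith

theorem fractionalQuery_eq_projRotation (f : β → Bool) (α : ℝ) :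
    fractionalQuery f α = projRotation (queryProj f) α := fractionalQuery_eq f α

/-- The interaction picture bound, carried back by the unitary `U T`. First order in `T / m` is good
enough, because the number of queries will not depend on `m`. -/
theorem norm_continuous_sub_timeProd_le {f : β → Bool} {HD U : ℝ → Matrix β β ℂ} {T : ℝ}
    {V : Matrix β β ℂ} (hT : 0 ≤ T) (hD : IsDriving T HD) (hU : IsSolution HD 0 T U)
    (hU0 : U 0 = 1) (hV : ContinuousImplements f T HD V) {m : ℕ} (hm : 0 < m) :
    ‖V - U T * timeProd (fun j : ℕ => (U (j * (T / m))).conjTranspose *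
      fractionalQuery f (T / m) * U (j * (T / m))) 0 m‖ ≤
      2 * Real.pi * (T / m) * ∫ t in (0 : ℝ)..T, ‖HD t‖ := by
  obtain ⟨Y, hY, hY0, rfl⟩ := IsEvolution.exists_isSolution hT hV
  have hm' : (m : ℝ) * (T / m) = T := by field_simp
  have h := norm_interaction_sub_timeProd_le (queryProj_mul_self f) (queryProj_isHermitian f)
    (norm_queryProj_le f) hD hU hU0 (by rwa [queryHamiltonian_eq] at hY) hY0
    (by positivity : 0 ≤ T / m) m hm'.le
  rw [hm'] at h
  simp_rw [fractionalQuery_eq_projRotation]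
  have hu := hU.conjTranspose_mul_self hD.1 hD.2 hU0 (t := T) ⟨hT, le_rfl⟩
  have e : Y T = U T * ((U T).conjTranspose * Y T) := by
    rw [← mul_assoc, mul_eq_one_comm.1 hu, one_mul]
  rw [e, ← mul_sub]
  exact (norm_mul_le _ _).trans ((mul_le_of_le_one_left (norm_nonneg _)
    (norm_le_one_of_conjTranspose_mul_self hu)).trans h)

end Evolution

/-! ### Averages along a walk with geometric gaps -/

section Walk

/-- The average of `Φ` over `K` independent gaps. -/
noncomputable def walkMean {Γ E : Type*} [Fintype Γ] [AddCommGroup E] [Module ℝ E] (w : Γ → ℝ)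
    (gap : Γ → ℕ) (Φ : List ℕ → ℕ → E) (K j : ℕ) : E :=
  ∑ g : Fin K → Γ, (∏ i, w (g i)) • Φ (List.ofFn fun i => gap (g i)) j

variable {Γ E : Type*} [Fintype Γ] [DecidableEq Γ] [AddCommGroup E] [Module ℝ E]
  {w : Γ → ℝ} {gap : Γ → ℕ} {M : ℕ} {p q : ℝ}

/-- The gap distribution: geometric below `M`. -/
structure IsGeometric (w : Γ → ℝ) (gap : Γ → ℕ) (M : ℕ) (p q : ℝ) : Prop where
  nonneg : ∀ γ, 0 ≤ w γ
  sum_eq : ∑ γ, w γ = 1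
  geom : ∀ i < M, ∑ γ with gap γ = i, w γ = p * q ^ i

theorem IsGeometric.sum_prod (h : IsGeometric w gap M p q) (K : ℕ) :
    ∑ g : Fin K → Γ, ∏ i, w (g i) = 1 := by
  rw [← Fintype.piFinset_univ, Finset.sum_prod_piFinset]
  simp [h.sum_eq]

/-- Every gap that leaves the segment gives the same value `e`, so only the geometric law below `M`
matters; how the remaining weight is spread is free. This lets the same analysis serve two encodings
of the gaps. -/
theorem IsGeometric.sum_smul (h : IsGeometric w gap M p q) (hpq : p + q = 1) {n : ℕ} (hn : n ≤ M)
    (φ : ℕ → E) (e : E) :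
    ∑ γ, w γ • (if gap γ < n then φ (gap γ) else e) =
      ∑ i ∈ Finset.range n, (p * q ^ i) • φ i + q ^ n • e := by
  -- Subtracting `e` makes the terms outside the range vanish.
  have h1 : ∑ γ, w γ • (if gap γ < n then φ (gap γ) else e) =
      ∑ γ, w γ • (if gap γ < n then φ (gap γ) - e else 0) + e := by
    have he : e = ∑ γ, w γ • e := by rw [← Finset.sum_smul, h.sum_eq, one_smul]
    conv_rhs => arg 2; rw [he]
    rw [← Finset.sum_add_distrib]
    refine Finset.sum_congr rfl fun γ _ => ?_
    by_cases hγ : gap γ < n <;> simp [hγ, smul_sub]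
  have h2 : ∑ γ, w γ • (if gap γ < n then φ (gap γ) - e else 0) =
      ∑ i ∈ Finset.range n, (p * q ^ i) • (φ i - e) := by
    calc _ = ∑ γ, ∑ i ∈ Finset.range n, if gap γ = i then w γ • (φ i - e) else 0 := by
          refine Finset.sum_congr rfl fun γ _ => ?_
          rw [Finset.sum_ite_eq]; simp
      _ = _ := by
          rw [Finset.sum_comm]
          refine Finset.sum_congr rfl fun i hi => ?_
          rw [← h.geom i ((Finset.mem_range.1 hi).trans_le hn), Finset.sum_smul,
            Finset.sum_filter]
  have h3 : ∑ i ∈ Finset.range n, p * q ^ i = 1 - q ^ n := by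
    have hp : p = 1 - q := by linarith
    rw [← Finset.mul_sum, hp, mul_neg_geom_sum]
  rw [h1, h2]
  simp only [smul_sub, Finset.sum_sub_distrib, ← Finset.sum_smul, h3, sub_smul, one_smul]
  abel

/-- The recursion that determines the average of a quantity along the walk. -/
structure IsWalk (M : ℕ) (T : ℕ → E →ₗ[ℝ] E) (c e : E) (Φ : List ℕ → ℕ → E) : Prop where
  nil : ∀ j, Φ [] j = e
  cons : ∀ d l j, Φ (d :: l) j = if j + d < M then T (j + d) (Φ l (j + d + 1)) + c else e

variable {T : ℕ → E →ₗ[ℝ] E} {c e : E} {Φ : List ℕ → ℕ → E}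

theorem walkMean_zero (hΦ : IsWalk M T c e Φ) (j : ℕ) : walkMean w gap Φ 0 j = e := by
  simp [walkMean, hΦ.nil]

theorem walkMean_succ_eq_sum (h : IsGeometric w gap M p q) (hΦ : IsWalk M T c e Φ) (K j : ℕ) :
    walkMean w gap Φ (K + 1) j = ∑ γ, w γ • (if j + gap γ < M then
      T (j + gap γ) (walkMean w gap Φ K (j + gap γ + 1)) + c else e) := by
  rw [walkMean, ← (Fin.consEquiv fun _ => Γ).sum_comp, Fintype.sum_prod_type]
  refine Finset.sum_congr rfl fun γ _ => ?_
  simp only [Fin.consEquiv_apply, Fin.prod_univ_succ, Fin.cons_zero, Fin.cons_succ,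
    List.ofFn_succ, hΦ.cons, mul_smul, ← Finset.smul_sum]
  congr 1
  split_ifs with hj
  · simp only [smul_add, Finset.sum_add_distrib, ← Finset.sum_smul, h.sum_prod, one_smul, walkMean,
      map_sum, map_smul]
  · rw [← Finset.sum_smul, h.sum_prod, one_smul]

theorem walkMean_of_le (h : IsGeometric w gap M p q) (hΦ : IsWalk M T c e Φ) {K j : ℕ}
    (hj : M ≤ j) : walkMean w gap Φ K j = e := by
  cases K with
  | zero => exact walkMean_zero hΦ j
  | succ K =>
    rw [walkMean_succ_eq_sum h hΦ]
    have : ∀ γ, ¬ (j + gap γ < M) := fun γ => by omega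
    simp [this, ← Finset.sum_smul, h.sum_eq]

/-- Memorylessness: with probability `p` there is an event at `j` and one gap is used up; otherwise
the walk looks exactly as if it started at `j + 1` with all its gaps. -/
theorem walkMean_succ (h : IsGeometric w gap M p q) (hpq : p + q = 1) (hΦ : IsWalk M T c e Φ)
    {K j : ℕ} (hj : j < M) :
    walkMean w gap Φ (K + 1) j =
      p • (T j (walkMean w gap Φ K (j + 1)) + c) + q • walkMean w gap Φ (K + 1) (j + 1) := by
  have key : ∀ j ≤ M, walkMean w gap Φ (K + 1) j = ∑ i ∈ Finset.range (M - j),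
      (p * q ^ i) • (T (j + i) (walkMean w gap Φ K (j + i + 1)) + c) + q ^ (M - j) • e := by
    intro j hj
    rw [walkMean_succ_eq_sum h hΦ, ← h.sum_smul hpq (Nat.sub_le M j)
      (fun i => T (j + i) (walkMean w gap Φ K (j + i + 1)) + c)]
    refine Finset.sum_congr rfl fun γ _ => ?_
    have : j + gap γ < M ↔ gap γ < M - j := by omega
    simp [this]
  rw [key j hj.le, key (j + 1) hj, show M - j = (M - (j + 1)) + 1 by omega,
    Finset.sum_range_succ', smul_add q, Finset.smul_sum, smul_smul, pow_succ']
  have hs : ∀ i ∈ Finset.range (M - (j + 1)),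
      (p * q ^ (i + 1)) • (T (j + (i + 1)) (walkMean w gap Φ K (j + (i + 1) + 1)) + c) =
      q • (p * q ^ i) • (T (j + 1 + i) (walkMean w gap Φ K (j + 1 + i + 1)) + c) := by
    intro i _
    rw [smul_smul, show j + (i + 1) = j + 1 + i by ring, pow_succ']
    congr 1; ring
  rw [Finset.sum_congr rfl hs]
  simp only [pow_zero, mul_one, add_zero]
  abel

end Walk

/-! ### Truncated words against the full product -/

section Words

variable {R : Type*}

/-- The product of `X` along the events of a walk that starts at `j`; the walk stops at `M`. -/
def wordProd [Monoid R] (X : ℕ → R) (M : ℕ) : List ℕ → ℕ → R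
  | [], _ => 1
  | d :: l, j => if j + d < M then wordProd X M l (j + d + 1) * X (j + d) else 1

/-- The number of events of a walk. -/
def wordCount (M : ℕ) : List ℕ → ℕ → ℝ
  | [], _ => 0
  | d :: l, j => if j + d < M then wordCount M l (j + d + 1) + 1 else 0

variable {β : Type*} [Fintype β] [DecidableEq β]
  {Γ : Type*} [Fintype Γ] [DecidableEq Γ] {w : Γ → ℝ} {gap : Γ → ℕ} {M : ℕ} {p q : ℝ}

theorem isWalk_wordProd (X : ℕ → Matrix β β ℂ) :
    IsWalk M (fun i => LinearMap.mulRight ℝ (X i)) 0 1 (wordProd X M) :=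
  ⟨fun _ => rfl, fun _ _ _ => by simp [wordProd]⟩

theorem isWalk_wordCount : IsWalk M (fun _ => LinearMap.id) 1 0 (wordCount M) :=
  ⟨fun _ => rfl, fun _ _ _ => by simp [wordCount]⟩

theorem norm_one_le : ‖(1 : Matrix β β ℂ)‖ ≤ 1 :=
  norm_le_one_of_conjTranspose_mul_self (by simp)

theorem norm_timeProd_le_one {X : ℕ → Matrix β β ℂ} {a n : ℕ}
    (hX : ∀ i, a ≤ i → i < a + n → ‖X i‖ ≤ 1) : ‖timeProd X a n‖ ≤ 1 := by
  induction n with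
  | zero => exact norm_one_le
  | succ n ih =>
    exact (norm_mul_le _ _).trans (mul_le_one₀ (hX _ (by omega) (by omega)) (norm_nonneg _)
      (ih fun i h1 h2 => hX i h1 (by omega)))

/-- The product of mixtures obeys the recursion of the walk without a limit on the number of events.
The difference therefore obeys Pascal's recursion, starting from the trivial bound 2 at `K = 0`. The
quantity `n.choose K * p ^ K` is the union bound for at least `K` events. -/
theorem norm_walkMean_sub_timeProd_le (h : IsGeometric w gap M p q) (hp : 0 ≤ p) (hq : 0 ≤ q)
    (hpq : p + q = 1) {X : ℕ → Matrix β β ℂ} (hX : ∀ i < M, ‖X i‖ ≤ 1) (n : ℕ) :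
    ∀ K j, j + n = M → ‖walkMean w gap (wordProd X M) K j -
      timeProd (fun i => q • (1 : Matrix β β ℂ) + p • X i) j n‖ ≤ 2 * (n.choose K * p ^ K) := by
  have hY : ∀ i < M, ‖q • (1 : Matrix β β ℂ) + p • X i‖ ≤ 1 := by
    intro i hi
    refine (norm_add_le _ _).trans ?_
    rw [norm_smul, norm_smul, Real.norm_of_nonneg hp, Real.norm_of_nonneg hq]
    have h1 := norm_one_le (β := β)
    have h2 := hX i hi
    nlinarith
  induction n with
  | zero =>
    intro K j hj
    rw [walkMean_of_le h (isWalk_wordProd X) (by omega)]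
    simp only [timeProd, sub_self, norm_zero]
    positivity
  | succ n ih =>
    intro K j hj
    cases K with
    | zero =>
      rw [walkMean_zero (isWalk_wordProd X)]
      refine (norm_sub_le _ _).trans ?_
      have := norm_timeProd_le_one (X := fun i => q • (1 : Matrix β β ℂ) + p • X i) (a := j)
        (n := n + 1) (fun i _ h2 => hY i (by omega))
      have := norm_one_le (β := β)
      simp; linarith
    | succ K =>
      rw [walkMean_succ h hpq (isWalk_wordProd X) (by omega), timeProd_succ']
      have h1 := ih K (j + 1) (by omega)
      have h2 := ih (K + 1) (j + 1) (by omega)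
      set G := timeProd (fun i => q • (1 : Matrix β β ℂ) + p • X i) (j + 1) n
      have e : p • ((LinearMap.mulRight ℝ (X j)) (walkMean w gap (wordProd X M) K (j + 1)) + 0) +
          q • walkMean w gap (wordProd X M) (K + 1) (j + 1) - G * (q • 1 + p • X j) =
          p • ((walkMean w gap (wordProd X M) K (j + 1) - G) * X j) +
          q • (walkMean w gap (wordProd X M) (K + 1) (j + 1) - G) := by
        simp only [LinearMap.mulRight_apply, add_zero, mul_add, mul_smul_comm, mul_one, sub_mul,
          smul_sub]
        abel
      rw [e]
      refine (norm_add_le _ _).trans ?_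
      rw [norm_smul, norm_smul, Real.norm_of_nonneg hp, Real.norm_of_nonneg hq]
      have h3 : ‖(walkMean w gap (wordProd X M) K (j + 1) - G) * X j‖ ≤
          2 * (n.choose K * p ^ K) :=
        (norm_mul_le _ _).trans ((mul_le_of_le_one_right (norm_nonneg _) (hX j (by omega))).trans h1)
      -- Replacing `q` by 1 loses little and leaves exactly Pascal's rule.
      have h4 : q * ‖walkMean w gap (wordProd X M) (K + 1) (j + 1) - G‖ ≤
          1 * (2 * (n.choose (K + 1) * p ^ (K + 1))) :=
        mul_le_mul (by linarith) h2 (norm_nonneg _) zero_le_one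
      calc _ ≤ p * (2 * (n.choose K * p ^ K)) + 1 * (2 * (n.choose (K + 1) * p ^ (K + 1))) :=
            add_le_add (mul_le_mul_of_nonneg_left h3 hp) h4
        _ = _ := by rw [Nat.choose_succ_succ]; push_cast; ring

/-- Each of the `n` positions carries an event with probability at most `p`. This mean, and not the
maximum `K`, is what multiplies the error of the driving circuit. -/
theorem walkMean_wordCount_le (h : IsGeometric w gap M p q) (hp : 0 ≤ p) (hq : 0 ≤ q)
    (hpq : p + q = 1) (n : ℕ) : ∀ K j, j + n = M →
      walkMean w gap (wordCount M) K j ≤ n * p := by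
  induction n with
  | zero =>
    intro K j hj
    rw [walkMean_of_le h isWalk_wordCount (by omega)]; simp
  | succ n ih =>
    intro K j hj
    cases K with
    | zero => rw [walkMean_zero isWalk_wordCount]; positivity
    | succ K =>
      rw [walkMean_succ h hpq isWalk_wordCount (by omega)]
      have h1 := ih K (j + 1) (by omega)
      have h2 := ih (K + 1) (j + 1) (by omega)
      simp only [LinearMap.id_apply, smul_eq_mul]
      have h3 := mul_le_mul_of_nonneg_left h1 hp
      have h4 := mul_le_mul_of_nonneg_left h2 hq
      calc _ ≤ p * (n * p) + p + q * (n * p) := by rw [mul_add, mul_one]; linarith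
        _ = (p + q) * (n * p) + p := by ring
        _ = _ := by rw [hpq]; push_cast; ring

end Words

/-! ### Oblivious amplitude amplification and linear combinations of unitaries -/

section Amplification

variable {I S : Type*} [Fintype I] [DecidableEq I] [Fintype S] [DecidableEq S]

/-- One round of oblivious amplitude amplification. -/
def amplify (W Pr : Matrix I I ℂ) : Matrix I I ℂ :=
  -(W * (1 - (2 : ℂ) • Pr) * W.conjTranspose * (1 - (2 : ℂ) • Pr) * W)

theorem norm_mul_le_of_le {A B C : Type*} [Fintype A] [Fintype B] [Fintype C] [DecidableEq A]
    [DecidableEq B] [DecidableEq C]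
    {X : Matrix A B ℂ} {Y : Matrix B C ℂ} {a b : ℝ} (hX : ‖X‖ ≤ a) (hY : ‖Y‖ ≤ b) :
    ‖X * Y‖ ≤ a * b :=
  (Matrix.l2_opNorm_mul X Y).trans
    (mul_le_mul hX hY (norm_nonneg _) ((norm_nonneg _).trans hX))

/-- In the exact case `Pr W J = J A`, `Pr W† J = J A†`, `2A = V`, the amplified operator on `J` is
`2 J A + W J (1 - 4 A† A)`. The last term vanishes because `V` is unitary, so the result is `J V`
for every input state. The proof keeps track of both errors in this identity: `1 + 3` times `η₂`,
and `2 + 4 + 4` times `η₁`. -/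
theorem norm_amplify_sub_le {W Pr : Matrix I I ℂ} {J : Matrix I S ℂ} {A V : Matrix S S ℂ}
    {η₁ η₂ : ℝ} (hW : W.conjTranspose * W = 1) (hJ : J.conjTranspose * J = 1)
    (hV : V.conjTranspose * V = 1) (hPr : ‖Pr‖ ≤ 1) (hPJ : Pr * J = J) (hA : ‖A‖ ≤ 1)
    (h₁ : ‖Pr * W * J - J * A‖ ≤ η₁)
    (h₁' : ‖Pr * W.conjTranspose * J - J * A.conjTranspose‖ ≤ η₁)
    (h₂ : ‖(2 : ℂ) • A - V‖ ≤ η₂) :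
    ‖amplify W Pr * J - J * V‖ ≤ 4 * η₂ + 10 * η₁ := by
  set e₁ := Pr * W * J - J * A with he₁
  set e₂ := Pr * W.conjTranspose * J - J * A.conjTranspose with he₂
  have nW : ‖W‖ ≤ 1 := norm_le_one_of_conjTranspose_mul_self hW
  have nW' : ‖W.conjTranspose‖ ≤ 1 := by rwa [Matrix.l2_opNorm_conjTranspose]
  have nJ : ‖J‖ ≤ 1 := norm_le_one_of_conjTranspose_mul_self hJ
  have nV : ‖V.conjTranspose‖ ≤ 1 := by
    rw [Matrix.l2_opNorm_conjTranspose]; exact norm_le_one_of_conjTranspose_mul_self hV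
  have E1 : Pr * W * J = J * A + e₁ := by rw [he₁]; abel
  have E2 : Pr * W.conjTranspose * J = J * A.conjTranspose + e₂ := by rw [he₂]; abel
  have E3 : amplify W Pr * J = (2 : ℂ) • (Pr * W * J) +
      W * (J - (4 : ℂ) • (Pr * W.conjTranspose * (Pr * W * J))) := by
    have a1 : (1 - (2 : ℂ) • Pr) * (W * J) = W * J - (2 : ℂ) • (Pr * W * J) := by
      rw [Matrix.sub_mul, Matrix.one_mul, Matrix.smul_mul, Matrix.mul_assoc]
    have a2 : W.conjTranspose * (W * J - (2 : ℂ) • (Pr * W * J)) =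
        J - (2 : ℂ) • (W.conjTranspose * (Pr * W * J)) := by
      rw [Matrix.mul_sub, ← Matrix.mul_assoc, hW, Matrix.one_mul, Matrix.mul_smul]
    have a3 : (1 - (2 : ℂ) • Pr) * (J - (2 : ℂ) • (W.conjTranspose * (Pr * W * J))) =
        -J - (2 : ℂ) • (W.conjTranspose * (Pr * W * J)) +
          (4 : ℂ) • (Pr * W.conjTranspose * (Pr * W * J)) := by
      rw [Matrix.sub_mul, Matrix.one_mul, Matrix.smul_mul, Matrix.mul_sub, hPJ, Matrix.mul_smul,
        smul_sub, smul_smul, ← Matrix.mul_assoc Pr]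
      rw [show (4 : ℂ) = 2 * 2 by norm_num, two_smul ℂ J]; abel
    have a4 : W * W.conjTranspose = 1 := mul_eq_one_comm.1 hW
    rw [amplify, Matrix.neg_mul, Matrix.mul_assoc, Matrix.mul_assoc, Matrix.mul_assoc,
      Matrix.mul_assoc, a1, a2, a3]
    rw [Matrix.mul_add, Matrix.mul_sub, Matrix.mul_sub, Matrix.mul_smul, ← Matrix.mul_assoc W (W.conjTranspose),
      a4, Matrix.one_mul, Matrix.mul_neg]
    simp only [Matrix.mul_smul]
    abel
  have E4 : Pr * W.conjTranspose * (J * A + e₁) =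
      J * (A.conjTranspose * A) + e₂ * A + Pr * W.conjTranspose * e₁ := by
    rw [Matrix.mul_add, ← Matrix.mul_assoc (Pr * W.conjTranspose) J A, E2, Matrix.add_mul,
      Matrix.mul_assoc]
  have E5 : amplify W Pr * J - J * V = J * ((2 : ℂ) • A - V) + (2 : ℂ) • e₁ +
      W * (J * (1 - (4 : ℂ) • (A.conjTranspose * A)) - (4 : ℂ) • (e₂ * A) -
        (4 : ℂ) • (Pr * W.conjTranspose * e₁)) := by
    rw [E3, E1, E4]
    simp only [smul_add, Matrix.mul_sub, Matrix.mul_add, Matrix.mul_smul, Matrix.mul_one]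
    abel
  have n1 : ‖J * ((2 : ℂ) • A - V)‖ ≤ 1 * η₂ := norm_mul_le_of_le nJ h₂
  have n2 : ‖(2 : ℂ) • e₁‖ ≤ 2 * η₁ := by
    rw [norm_smul]; simpa using h₁
  have n3 : ‖(1 : Matrix S S ℂ) - (4 : ℂ) • (A.conjTranspose * A)‖ ≤ 3 * η₂ := by
    -- Both summands contain the factor `2A - V`, and the other factors have norms at most 1 and 2.
    have : (1 : Matrix S S ℂ) - (4 : ℂ) • (A.conjTranspose * A) =
        -(V.conjTranspose * ((2 : ℂ) • A - V)) -
          ((2 : ℂ) • A - V).conjTranspose * ((2 : ℂ) • A) := by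
      rw [Matrix.mul_sub, hV, Matrix.conjTranspose_sub, Matrix.sub_mul, Matrix.conjTranspose_smul,
        Matrix.smul_mul, Matrix.mul_smul, Matrix.mul_smul, smul_smul]
      norm_num
    rw [this]
    have m1 := norm_mul_le_of_le nV h₂
    have m2 : ‖((2 : ℂ) • A - V).conjTranspose * ((2 : ℂ) • A)‖ ≤ η₂ * 2 :=
      norm_mul_le_of_le (by rwa [Matrix.l2_opNorm_conjTranspose]) (by
        rw [norm_smul]; simp; linarith)
    refine (norm_sub_le _ _).trans ?_
    rw [norm_neg]; linarith
  have n4 : ‖J * (1 - (4 : ℂ) • (A.conjTranspose * A))‖ ≤ 1 * (3 * η₂) := norm_mul_le_of_le nJ n3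
  have n5 : ‖(4 : ℂ) • (e₂ * A)‖ ≤ 4 * η₁ := by
    rw [norm_smul]; have := norm_mul_le_of_le h₁' hA; simp; linarith
  have n6 : ‖(4 : ℂ) • (Pr * W.conjTranspose * e₁)‖ ≤ 4 * η₁ := by
    rw [norm_smul]
    have := norm_mul_le_of_le (norm_mul_le_of_le hPr nW') h₁
    simp; linarith
  have n7 := norm_mul_le_of_le nW (((norm_sub_le _ _).trans
    (add_le_add ((norm_sub_le _ _).trans (add_le_add n4 n5)) n6)))
  rw [E5]
  refine ((norm_add_le _ _).trans (add_le_add ((norm_add_le _ _).trans (add_le_add n1 n2)) n7)).trans ?_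
  linarith

/-- The block of a linear combination of unitaries. -/
theorem norm_lcu_block_sub_le {ι : Type*} [Fintype ι] {a err : ι → ℝ} {P Sel Pr : Matrix I I ℂ}
    {J : Matrix I S ℂ} {Jg : ι → Matrix I S ℂ} {word : ι → Matrix S S ℂ} (ha : ∀ g, 0 ≤ a g)
    (hPJ : P * J = ∑ g, (a g : ℂ) • Jg g)
    (hJg : ∀ g, Pr * P.conjTranspose * Jg g = (a g : ℂ) • J)
    (herr : ∀ g, ‖Pr * P.conjTranspose * (Sel * Jg g - Jg g * word g)‖ ≤ a g * err g) :
    ‖Pr * (P.conjTranspose * Sel * P) * J - J * ∑ g, ((a g ^ 2 : ℝ) : ℂ) • word g‖ ≤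
      ∑ g, a g ^ 2 * err g := by
  -- Preparation contributes one amplitude `a g` and the projection after `P†` a second one, so the
  -- errors are averaged with the probabilities `a g ^ 2`.
  have e : Pr * (P.conjTranspose * Sel * P) * J - J * ∑ g, ((a g ^ 2 : ℝ) : ℂ) • word g =
      ∑ g, (a g : ℂ) • (Pr * P.conjTranspose * (Sel * Jg g - Jg g * word g)) := by
    have : Pr * (P.conjTranspose * Sel * P) * J = Pr * P.conjTranspose * (Sel * (P * J)) := by
      simp only [Matrix.mul_assoc]
    rw [this, hPJ, Matrix.mul_sum, Matrix.mul_sum, Matrix.mul_sum, ← Finset.sum_sub_distrib]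
    refine Finset.sum_congr rfl fun g _ => ?_
    rw [Matrix.mul_sub, ← Matrix.mul_assoc _ (Jg g), hJg, smul_sub, Matrix.mul_smul,
      Matrix.mul_smul, Matrix.mul_smul, Matrix.smul_mul, smul_smul]
    push_cast; rw [sq]
  rw [e]
  refine (norm_sum_le _ _).trans (Finset.sum_le_sum fun g _ => ?_)
  rw [norm_smul, Complex.norm_real, Real.norm_of_nonneg (ha g), sq, mul_assoc]
  exact mul_le_mul_of_nonneg_left (herr g) (ha g)

end Amplification

/-! ### One segment as twice an average of words -/

section Segment

/-- Both eigenvalues are treated by Euler's formula. Attaching the factor `i` to the discrete query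
makes the two coefficients nonnegative for small angles, so they can be read as unnormalized
probabilities. -/
theorem fractionalQuery_eq_cos {β : Type*} [Fintype β] [DecidableEq β] (f : β → Bool) (α : ℝ) :
    fractionalQuery f α = Complex.exp (-Complex.I * ((Real.pi * α / 2 : ℝ) : ℂ)) •
      ((Real.cos (Real.pi * α / 2) : ℂ) • (1 : Matrix β β ℂ) +
        (Real.sin (Real.pi * α / 2) : ℂ) • Complex.I • discreteQuery f) := by
  ext s t
  by_cases h : s = t
  · subst h
    by_cases hf : f s
    · simp only [fractionalQuery, discreteQuery, hf, Matrix.diagonal_apply_eq, if_true,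
        Matrix.smul_apply, Matrix.add_apply, Matrix.one_apply_eq, smul_eq_mul, mul_one]
      have : (Real.cos (Real.pi * α / 2) : ℂ) + (Real.sin (Real.pi * α / 2) : ℂ) *
          (Complex.I * -1) = Complex.exp (-Complex.I * ((Real.pi * α / 2 : ℝ) : ℂ)) := by
        rw [Complex.ofReal_cos, Complex.ofReal_sin, show -Complex.I * ((Real.pi * α / 2 : ℝ) : ℂ) =
          (-((Real.pi * α / 2 : ℝ) : ℂ)) * Complex.I by ring, Complex.exp_mul_I, Complex.cos_neg,
          Complex.sin_neg]
        ring
      rw [this, ← Complex.exp_add]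
      push_cast; ring_nf
    · simp only [fractionalQuery, discreteQuery, hf, Matrix.diagonal_apply_eq,
        Matrix.smul_apply, Matrix.add_apply, Matrix.one_apply_eq, smul_eq_mul, mul_one]
      have : (Real.cos (Real.pi * α / 2) : ℂ) + (Real.sin (Real.pi * α / 2) : ℂ) *
          Complex.I = Complex.exp (Complex.I * ((Real.pi * α / 2 : ℝ) : ℂ)) := by
        rw [Complex.ofReal_cos, Complex.ofReal_sin, mul_comm Complex.I, Complex.exp_mul_I]
      simp only [Bool.false_eq_true, if_false, mul_zero, Complex.exp_zero, mul_one]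
      rw [this, ← Complex.exp_add]
      ring_nf; simp
  · simp [fractionalQuery, discreteQuery, Matrix.diagonal, h]

/-- The angle `π α / 2`. -/
noncomputable def stepAngle (α : ℝ) : ℝ := Real.pi * α / 2

/-- The weight of an event in the walk for steps of size `α`. -/
noncomputable def eventProb (α : ℝ) : ℝ :=
  Real.sin (stepAngle α) / (Real.cos (stepAngle α) + Real.sin (stepAngle α))

/-- The total weight of a segment. -/
noncomputable def segmentWeight (α : ℝ) (M : ℕ) : ℝ :=
  (Real.cos (stepAngle α) + Real.sin (stepAngle α)) ^ M

/-- The two phases whose average is `exp (-i M θ) * segmentWeight / 2`. -/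
noncomputable def halfPhase (α : ℝ) (M : ℕ) (h : Bool) : ℂ :=
  Complex.exp (Complex.I * (((if h then 1 else -1) * Real.arccos (segmentWeight α M / 2) -
    M * stepAngle α : ℝ) : ℂ))

/-- The step size `α` and the number `M` of steps of a segment. -/
structure IsSegment (α : ℝ) (M : ℕ) : Prop where
  pos : 0 < α
  pos' : 0 < M
  le : M * stepAngle α ≤ 1 / 2

namespace IsSegment

variable {α : ℝ} {M : ℕ} (h : IsSegment α M)

include h

theorem angle_pos : 0 < stepAngle α := by
  have := h.pos; unfold stepAngle; positivity

theorem angle_le : stepAngle α ≤ 1 / 2 := by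
  have h1 : (1 : ℝ) ≤ M := by exact_mod_cast h.pos'
  nlinarith [h.le, h.angle_pos]

theorem sin_pos : 0 < Real.sin (stepAngle α) :=
  Real.sin_pos_of_pos_of_lt_pi h.angle_pos (by linarith [h.angle_le, Real.pi_gt_three])

theorem cos_pos : 0 < Real.cos (stepAngle α) :=
  Real.cos_pos_of_mem_Ioo ⟨by linarith [h.angle_pos, Real.pi_gt_three],
    by linarith [h.angle_le, Real.pi_gt_three]⟩

theorem one_le_sum : 1 ≤ Real.cos (stepAngle α) + Real.sin (stepAngle α) := by
  nlinarith [h.sin_pos, h.cos_pos, Real.sin_sq_add_cos_sq (stepAngle α)]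

theorem eventProb_pos : 0 < eventProb α :=
  div_pos h.sin_pos (by linarith [h.one_le_sum])

theorem one_sub_eventProb : 1 - eventProb α =
    Real.cos (stepAngle α) / (Real.cos (stepAngle α) + Real.sin (stepAngle α)) := by
  have := h.one_le_sum
  rw [eventProb]; field_simp; ring

theorem eventProb_lt_one : eventProb α < 1 := by
  have h1 := h.one_sub_eventProb
  have h2 : 0 < 1 - eventProb α := by
    rw [h1]; exact div_pos h.cos_pos (by linarith [h.one_le_sum])
  linarith

theorem mul_eventProb_le : M * eventProb α ≤ 1 / 2 := by
  refine le_trans ?_ h.le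
  have h1 : eventProb α ≤ stepAngle α :=
    (div_le_self h.sin_pos.le h.one_le_sum).trans (Real.sin_le h.angle_pos.le)
  gcongr

/-- `(cos θ + sin θ)^M ≤ e^{Mθ} ≤ e^{1/2} < 2`. The bound 2 is what lets half of the weight be the
cosine of an angle. -/
theorem segmentWeight_le : segmentWeight α M ≤ 2 := by
  have h1 : Real.cos (stepAngle α) + Real.sin (stepAngle α) ≤ Real.exp (stepAngle α) := by
    have := Real.cos_le_one (stepAngle α)
    have := Real.sin_le h.angle_pos.le
    have := Real.add_one_le_exp (stepAngle α)
    linarith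
  calc segmentWeight α M ≤ Real.exp (stepAngle α) ^ M :=
        pow_le_pow_left₀ (by linarith [h.one_le_sum]) h1 M
    _ = Real.exp (M * stepAngle α) := by rw [← Real.exp_nat_mul]
    _ ≤ Real.exp (1 / 2) := Real.exp_le_exp.2 h.le
    _ ≤ 2 := by
        have h2 : Real.exp (1 / 2) * Real.exp (1 / 2) = Real.exp 1 := by
          rw [← Real.exp_add]; norm_num
        nlinarith [Real.exp_one_lt_d9, Real.exp_pos (1 / 2)]

theorem segmentWeight_nonneg : 0 ≤ segmentWeight α M :=
  pow_nonneg (by linarith [h.one_le_sum]) _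

/-- `2 cos φ = e^{iφ} + e^{-iφ}` with `cos φ` half of the segment weight. This pads the weight to
exactly 2, the value for which a single round of amplification is exact. -/
theorem sum_halfPhase : halfPhase α M true + halfPhase α M false =
    segmentWeight α M * Complex.exp (-Complex.I * stepAngle α) ^ M := by
  have h1 : Real.cos (Real.arccos (segmentWeight α M / 2)) = segmentWeight α M / 2 :=
    Real.cos_arccos (by linarith [h.segmentWeight_nonneg]) (by linarith [h.segmentWeight_le])
  set φ := Real.arccos (segmentWeight α M / 2)
  have h2 : (segmentWeight α M : ℂ) = 2 * Complex.cos φ := by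
    rw [← Complex.ofReal_cos, h1]; push_cast; ring
  rw [h2, Complex.two_cos, ← Complex.exp_nat_mul, add_mul, ← Complex.exp_add, ← Complex.exp_add]
  simp only [halfPhase]
  congr 2 <;> (simp only [if_true, Bool.false_eq_true, if_false]; push_cast; simp only [φ]; ring)

end IsSegment

theorem norm_halfPhase (α : ℝ) (M : ℕ) (h : Bool) : ‖halfPhase α M h‖ = 1 := by
  rw [halfPhase, mul_comm, Complex.norm_exp_ofReal_mul_I]

variable {β : Type*} [Fintype β] [DecidableEq β]

theorem discreteQuery_mul_self (f : β → Bool) : discreteQuery f * discreteQuery f = 1 := by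
  rw [discreteQuery, Matrix.diagonal_mul_diagonal, ← Matrix.diagonal_one]
  congr 1; ext s; by_cases h : f s <;> simp [h]

theorem conjTranspose_discreteQuery (f : β → Bool) :
    (discreteQuery f).conjTranspose = discreteQuery f := by
  rw [discreteQuery, Matrix.diagonal_conjTranspose]
  congr 1; ext s; by_cases h : f s <;> simp [h]

/-- The event operator `i U† Q U`. -/
noncomputable def eventOp (f : β → Bool) (U : Matrix β β ℂ) : Matrix β β ℂ :=
  Complex.I • (U.conjTranspose * discreteQuery f * U)

theorem eventOp_unitary (f : β → Bool) {U : Matrix β β ℂ} (hU : U.conjTranspose * U = 1) :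
    (eventOp f U).conjTranspose * eventOp f U = 1 := by
  have hU' := mul_eq_one_comm.1 hU
  rw [eventOp, Matrix.conjTranspose_smul, Matrix.conjTranspose_mul, Matrix.conjTranspose_mul,
    Matrix.conjTranspose_conjTranspose, conjTranspose_discreteQuery, smul_mul_smul_comm]
  have : U.conjTranspose * (discreteQuery f * U) * (U.conjTranspose * discreteQuery f * U) =
      U.conjTranspose * (discreteQuery f * (U * U.conjTranspose) * discreteQuery f) * U := by
    noncomm_ring
  rw [this, hU', mul_one, discreteQuery_mul_self, mul_one, hU]
  simp

/-- The fractional queries of a segment in the interaction picture. -/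
noncomputable def segmentProd (f : β → Bool) (U : ℕ → Matrix β β ℂ) (α : ℝ) (a M : ℕ) :
    Matrix β β ℂ :=
  timeProd (fun j => (U j).conjTranspose * fractionalQuery f α * U j) a M

theorem timeProd_smul {X : ℕ → Matrix β β ℂ} (z : ℂ) (a n : ℕ) :
    timeProd (fun j => z • X j) a n = z ^ n • timeProd X a n := by
  induction n with
  | zero => simp [timeProd]
  | succ n ih => rw [timeProd, timeProd, ih, smul_mul_smul_comm, pow_succ']

/-- Conjugation by `U j` fixes the identity part and turns the query into the event operator; the
scalars of all steps are collected into the two phases. -/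
theorem segmentProd_eq {α : ℝ} {M : ℕ} (h : IsSegment α M) (f : β → Bool) {U : ℕ → Matrix β β ℂ}
    (hU : ∀ j < M, (U j).conjTranspose * U j = 1) :
    segmentProd f U α 0 M = (halfPhase α M true + halfPhase α M false) •
      timeProd (fun i => (1 - eventProb α) • (1 : Matrix β β ℂ) +
        eventProb α • eventOp f (U i)) 0 M := by
  rw [h.sum_halfPhase, segmentWeight]
  push_cast
  rw [← mul_pow, ← timeProd_smul]
  refine timeProd_congr fun j _ hj => ?_
  have h1 := h.one_le_sum
  have h0 : (Real.cos (stepAngle α) : ℂ) + Real.sin (stepAngle α) ≠ 0 := by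
    rw [← Complex.ofReal_add]; exact_mod_cast (by linarith : _ ≠ (0 : ℝ)).symm.symm
  rw [fractionalQuery_eq_cos, mul_comm ((Complex.cos _) + _), mul_smul, Matrix.mul_smul,
    Matrix.smul_mul]
  change Complex.exp (-Complex.I * (stepAngle α : ℂ)) • _ = _
  congr 1
  rw [h.one_sub_eventProb, eventProb, eventOp]
  simp only [← Complex.coe_smul, smul_add, smul_smul, Matrix.mul_add, Matrix.add_mul,
    Matrix.mul_smul, Matrix.smul_mul, mul_one, hU j (by omega)]
  change (Real.cos (stepAngle α) : ℂ) • _ + ((Real.sin (stepAngle α) : ℂ) * _) • _ = _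
  rw [← Complex.ofReal_cos, ← Complex.ofReal_sin]
  congr 2
  · push_cast at h0 ⊢; field_simp
  · push_cast at h0 ⊢; field_simp

theorem wordProd_unitary {X : ℕ → Matrix β β ℂ} {M : ℕ}
    (hX : ∀ j < M, (X j).conjTranspose * X j = 1) (l : List ℕ) :
    ∀ j, (wordProd X M l j).conjTranspose * wordProd X M l j = 1 := by
  induction l with
  | nil => intro j; simp [wordProd]
  | cons d l ih =>
    intro j
    rw [wordProd]
    split_ifs with h
    · rw [Matrix.conjTranspose_mul, mul_assoc, ← mul_assoc _ (wordProd X M l _), ih, one_mul,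
        hX _ h]
    · simp

variable {Γ : Type*} [Fintype Γ] [DecidableEq Γ]

/-- The weight of a sequence of gaps and a sign. -/
noncomputable def wordWeight (w : Γ → ℝ) {K : ℕ} (x : (Fin K → Γ) × Bool) : ℝ :=
  (∏ i, w (x.1 i)) / 2

/-- The unitary selected by a sequence of gaps and a sign. -/
noncomputable def wordOp (gap : Γ → ℕ) (f : β → Bool) (U : ℕ → Matrix β β ℂ) (α : ℝ) (M : ℕ)
    {K : ℕ} (x : (Fin K → Γ) × Bool) : Matrix β β ℂ :=
  halfPhase α M x.2 • wordProd (fun j => eventOp f (U j)) M (List.ofFn fun i => gap (x.1 i)) 0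

theorem wordOp_unitary {gap : Γ → ℕ} (f : β → Bool) {U : ℕ → Matrix β β ℂ} (α : ℝ) {M : ℕ}
    (hU : ∀ j < M, (U j).conjTranspose * U j = 1) {K : ℕ} (x : (Fin K → Γ) × Bool) :
    (wordOp gap f U α M x).conjTranspose * wordOp gap f U α M x = 1 := by
  rw [wordOp, Matrix.conjTranspose_smul, smul_mul_smul_comm,
    wordProd_unitary fun j hj => eventOp_unitary f (hU j hj), Complex.star_def, mul_comm,
    Complex.mul_conj, Complex.normSq_eq_norm_sq, norm_halfPhase]
  simp

theorem wordWeight_nonneg {w : Γ → ℝ} (hw : ∀ γ, 0 ≤ w γ) {K : ℕ} (x : (Fin K → Γ) × Bool) :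
    0 ≤ wordWeight w x := div_nonneg (Finset.prod_nonneg fun _ _ => hw _) zero_le_two

theorem sum_wordWeight {w : Γ → ℝ} {gap : Γ → ℕ} {M : ℕ} {p q : ℝ}
    (hw : IsGeometric w gap M p q) (K : ℕ) :
    ∑ x : (Fin K → Γ) × Bool, wordWeight w x = 1 := by
  simp only [wordWeight, Fintype.sum_prod_type, Fintype.sum_bool, add_halves]
  exact hw.sum_prod K

theorem sum_wordWeight_smul_wordOp {w : Γ → ℝ} {gap : Γ → ℕ} (f : β → Bool)
    (U : ℕ → Matrix β β ℂ) (α : ℝ) (M K : ℕ) :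
    (2 : ℂ) • ∑ x : (Fin K → Γ) × Bool, (wordWeight w x : ℂ) • wordOp gap f U α M x =
      (halfPhase α M true + halfPhase α M false) •
        walkMean w gap (wordProd (fun j => eventOp f (U j)) M) K 0 := by
  rw [walkMean, Fintype.sum_prod_type, Finset.smul_sum, Finset.smul_sum]
  refine Finset.sum_congr rfl fun g _ => ?_
  rw [Fintype.sum_bool]
  simp only [wordWeight, wordOp, ← Complex.coe_smul, smul_smul, ← add_smul]
  congr 1
  push_cast; ring

/-- The sum of phases contributes 2, the truncation `2 * M.choose K * p ^ K`, and `M.choose K * p ^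
K ≤ (M p)^K / K! ≤ 1 / K!`. -/
theorem norm_sum_wordOp_sub_le {w : Γ → ℝ} {gap : Γ → ℕ} {α : ℝ} {M : ℕ} (h : IsSegment α M)
    (hw : IsGeometric w gap M (eventProb α) (1 - eventProb α)) (f : β → Bool)
    {U : ℕ → Matrix β β ℂ} (hU : ∀ j < M, (U j).conjTranspose * U j = 1) (K : ℕ) :
    ‖(2 : ℂ) • ∑ x : (Fin K → Γ) × Bool, (wordWeight w x : ℂ) • wordOp gap f U α M x -
      segmentProd f U α 0 M‖ ≤ 4 / K.factorial := by
  rw [sum_wordWeight_smul_wordOp, segmentProd_eq h f hU, ← smul_sub, norm_smul]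
  have h1 : ‖halfPhase α M true + halfPhase α M false‖ ≤ 2 := by
    refine (norm_add_le _ _).trans ?_
    rw [norm_halfPhase, norm_halfPhase]; norm_num
  have h2 := norm_walkMean_sub_timeProd_le hw h.eventProb_pos.le
    (by linarith [h.eventProb_lt_one]) (by ring)
    (X := fun j => eventOp f (U j))
    (fun i hi => norm_le_one_of_conjTranspose_mul_self (eventOp_unitary f (hU i hi))) M K 0
    (by ring)
  have h3 : (M.choose K : ℝ) * eventProb α ^ K ≤ 1 / K.factorial := by
    have h4 : (M.choose K : ℝ) ≤ (M : ℝ) ^ K / K.factorial := Nat.choose_le_pow_div K M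
    calc (M.choose K : ℝ) * eventProb α ^ K ≤ (M : ℝ) ^ K / K.factorial * eventProb α ^ K :=
          mul_le_mul_of_nonneg_right h4 (pow_nonneg h.eventProb_pos.le _)
      _ = (M * eventProb α) ^ K / K.factorial := by rw [mul_pow]; ring
      _ ≤ 1 / K.factorial := by
          gcongr
          exact pow_le_one₀ (mul_nonneg (Nat.cast_nonneg _) h.eventProb_pos.le)
            (by linarith [h.mul_eventProb_le])
  calc _ ≤ 2 * (2 * (1 / (K.factorial : ℝ))) :=
        mul_le_mul h1 (h2.trans (mul_le_mul_of_nonneg_left h3 zero_le_two)) (norm_nonneg _)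
          zero_le_two
    _ = 4 / (K.factorial : ℝ) := by ring

theorem segmentProd_unitary (f : β → Bool) {U : ℕ → Matrix β β ℂ} {α : ℝ} {a M : ℕ}
    (hU : ∀ j, a ≤ j → j < a + M → (U j).conjTranspose * U j = 1) :
    (segmentProd f U α a M).conjTranspose * segmentProd f U α a M = 1 := by
  induction M with
  | zero => simp [segmentProd, timeProd]
  | succ M ih =>
    have ih := ih fun j h1 h2 => hU j h1 (by omega)
    have hU' := hU (a + M) (by omega) (by omega)
    have hU'' := mul_eq_one_comm.1 hU'
    have hQ := conjTranspose_projRotation_mul (queryProj_mul_self f) (queryProj_isHermitian f) α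
    rw [← fractionalQuery_eq_projRotation] at hQ
    rw [segmentProd, timeProd]
    change (_ * segmentProd f U α a M).conjTranspose * (_ * segmentProd f U α a M) = 1
    set Z := segmentProd f U α a M
    set u := U (a + M)
    set F := fractionalQuery f α
    calc (u.conjTranspose * F * u * Z).conjTranspose * (u.conjTranspose * F * u * Z)
        = Z.conjTranspose * (u.conjTranspose * (F.conjTranspose * (u * u.conjTranspose) * F) * u)
          * Z := by
            simp only [Matrix.conjTranspose_mul, Matrix.conjTranspose_conjTranspose]; noncomm_ring
      _ = 1 := by rw [hU'', mul_one, hQ, mul_one, hU', mul_one, ih]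

/-- A segment simulated by amplitude amplification of a linear combination of words. -/
theorem norm_amplify_segment_sub_le {I : Type*} [Fintype I] [DecidableEq I]
    {w : Γ → ℝ} {gap : Γ → ℕ} {α : ℝ} {M : ℕ} (h : IsSegment α M)
    (hw : IsGeometric w gap M (eventProb α) (1 - eventProb α)) (f : β → Bool)
    {U : ℕ → Matrix β β ℂ} (hU : ∀ j < M, (U j).conjTranspose * U j = 1) {K : ℕ}
    {P Sel Pr : Matrix I I ℂ} {J : Matrix I β ℂ} {Jg : (Fin K → Γ) × Bool → Matrix I β ℂ} {δ : ℝ}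
    (hP : P.conjTranspose * P = 1) (hS : Sel.conjTranspose * Sel = 1) (hPr : ‖Pr‖ ≤ 1)
    (hJ : J.conjTranspose * J = 1) (hδ : 0 ≤ δ)
    (hPrJ : Pr * J = J) (hPJ : P * J = ∑ x, (√(wordWeight w x) : ℂ) • Jg x)
    (hJg : ∀ x, Pr * P.conjTranspose * Jg x = (√(wordWeight w x) : ℂ) • J)
    (herr : ∀ x, ‖Sel * Jg x - Jg x * wordOp gap f U α M x‖ ≤
      2 * wordCount M (List.ofFn fun i => gap (x.1 i)) 0 * δ)
    (hs₁ : ∀ x, ‖Pr * P.conjTranspose * (Sel * Jg x - Jg x * wordOp gap f U α M x)‖ ≤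
      √(wordWeight w x) * ‖Sel * Jg x - Jg x * wordOp gap f U α M x‖)
    (hs₂ : ∀ x, ‖Pr * P.conjTranspose *
        (Sel.conjTranspose * Jg x - Jg x * (wordOp gap f U α M x).conjTranspose)‖ ≤
      √(wordWeight w x) *
        ‖Sel.conjTranspose * Jg x - Jg x * (wordOp gap f U α M x).conjTranspose‖) :
    ‖amplify (P.conjTranspose * Sel * P) Pr * J - J * segmentProd f U α 0 M‖ ≤
      16 / K.factorial + 10 * δ := by
  have hP' := mul_eq_one_comm.1 hP
  have sq : ∀ x : (Fin K → Γ) × Bool, √(wordWeight w x) ^ 2 = wordWeight w x := fun x =>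
    Real.sq_sqrt (wordWeight_nonneg hw.nonneg x)
  set A := ∑ x : (Fin K → Γ) × Bool, (wordWeight w x : ℂ) • wordOp gap f U α M x with hA
  have nS : ‖Sel.conjTranspose‖ ≤ 1 := by
    rw [Matrix.l2_opNorm_conjTranspose]; exact norm_le_one_of_conjTranspose_mul_self hS
  have nword : ∀ x : (Fin K → Γ) × Bool, ‖wordOp gap f U α M x‖ ≤ 1 := fun x =>
    norm_le_one_of_conjTranspose_mul_self (wordOp_unitary f α hU x)
  -- Since `Sel` and the words are unitary, the error for the adjoints is the original one
  -- multiplied by contractions.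
  have herr' : ∀ x, ‖Sel.conjTranspose * Jg x - Jg x * (wordOp gap f U α M x).conjTranspose‖ ≤
      2 * wordCount M (List.ofFn fun i => gap (x.1 i)) 0 * δ := by
    intro x
    have hw1 := mul_eq_one_comm.1 (wordOp_unitary (gap := gap) f α hU x)
    have e : Sel.conjTranspose * Jg x - Jg x * (wordOp gap f U α M x).conjTranspose =
        -(Sel.conjTranspose * (Sel * Jg x - Jg x * wordOp gap f U α M x) *
          (wordOp gap f U α M x).conjTranspose) := by
      rw [Matrix.mul_sub, ← Matrix.mul_assoc Sel.conjTranspose Sel, hS, Matrix.one_mul,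
        Matrix.sub_mul, Matrix.mul_assoc Sel.conjTranspose, Matrix.mul_assoc (Jg x), hw1,
        Matrix.mul_one, neg_sub]
    rw [e, norm_neg]
    have := norm_mul_le_of_le (norm_mul_le_of_le nS (herr x))
      (by rw [Matrix.l2_opNorm_conjTranspose]; exact nword x :
        ‖(wordOp gap f U α M x).conjTranspose‖ ≤ 1)
    linarith
  -- The mean number of events is at most `1/2`, so the average of `2 * wordCount * δ` is at most
  -- `δ`.
  have hsum : ∑ x : (Fin K → Γ) × Bool, √(wordWeight w x) ^ 2 *
      (2 * wordCount M (List.ofFn fun i => gap (x.1 i)) 0 * δ) ≤ δ := by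
    have h1 := walkMean_wordCount_le hw h.eventProb_pos.le (by linarith [h.eventProb_lt_one])
      (by ring) M K 0 (by ring)
    have h2 : ∑ x : (Fin K → Γ) × Bool, √(wordWeight w x) ^ 2 *
        (2 * wordCount M (List.ofFn fun i => gap (x.1 i)) 0 * δ) =
        2 * δ * walkMean w gap (wordCount M) K 0 := by
      simp only [sq]
      simp only [walkMean, Fintype.sum_prod_type, Fintype.sum_bool, wordWeight, Finset.mul_sum,
        smul_eq_mul]
      exact Finset.sum_congr rfl fun g _ => by ring
    rw [h2]
    have := h.mul_eventProb_le
    nlinarith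
  have b1 := norm_lcu_block_sub_le (Sel := Sel) (word := wordOp gap f U α M)
    (err := fun x => 2 * wordCount M (List.ofFn fun i => gap (x.1 i)) 0 * δ)
    (fun x => Real.sqrt_nonneg (wordWeight w x)) hPJ hJg
    (fun x => (hs₁ x).trans (mul_le_mul_of_nonneg_left (herr x) (Real.sqrt_nonneg _)))
  have b2 := norm_lcu_block_sub_le (Sel := Sel.conjTranspose)
    (word := fun x => (wordOp gap f U α M x).conjTranspose)
    (err := fun x => 2 * wordCount M (List.ofFn fun i => gap (x.1 i)) 0 * δ)
    (fun x => Real.sqrt_nonneg (wordWeight w x)) hPJ hJg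
    (fun x => (hs₂ x).trans (mul_le_mul_of_nonneg_left (herr' x) (Real.sqrt_nonneg _)))
  simp only [sq] at b1 b2
  simp only [sq] at hsum
  have hAt : A.conjTranspose = ∑ x : (Fin K → Γ) × Bool,
      (wordWeight w x : ℂ) • (wordOp gap f U α M x).conjTranspose := by
    simp [hA, Matrix.conjTranspose_sum, Matrix.conjTranspose_smul]
  have hAn : ‖A‖ ≤ 1 := by
    rw [← sum_wordWeight hw K]
    refine (norm_sum_le _ _).trans (Finset.sum_le_sum fun x _ => ?_)
    rw [norm_smul, Complex.norm_real, Real.norm_of_nonneg (wordWeight_nonneg hw.nonneg x)]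
    exact mul_le_of_le_one_right (wordWeight_nonneg hw.nonneg x) (nword x)
  have hWW : (P.conjTranspose * Sel * P).conjTranspose * (P.conjTranspose * Sel * P) = 1 := by
    have : (P.conjTranspose * Sel * P).conjTranspose * (P.conjTranspose * Sel * P) =
        P.conjTranspose * (Sel.conjTranspose * (P * P.conjTranspose) * Sel) * P := by
      simp only [Matrix.conjTranspose_mul, Matrix.conjTranspose_conjTranspose]; noncomm_ring
    rw [this, hP', mul_one, hS, mul_one, hP]
  have := norm_amplify_sub_le hWW hJ
    (segmentProd_unitary f (α := α) (a := 0) fun j _ hj => hU j (by omega)) hPr hPrJ hAn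
    (b1.trans hsum) (by
      rw [hAt]
      have : (P.conjTranspose * Sel * P).conjTranspose =
          P.conjTranspose * Sel.conjTranspose * P := by
        simp only [Matrix.conjTranspose_mul, Matrix.conjTranspose_conjTranspose, mul_assoc]
      rw [this]
      exact b2.trans hsum) (norm_sum_wordOp_sub_le h hw f hU K)
  refine this.trans (le_of_eq ?_)
  ring

end Segment

/-! ### The truncation order -/

section Estimates

/-- `K! ≥ (K/e)^K`. Since `K ≥ 10 √L`, also `K ≥ e √L`, so `log K - 1 ≥ (log L) / 2`, and the
exponent `K (log K - 1)` is at least `K (log L) / 2 ≥ 10 L`. -/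
theorem exp_le_factorial {L : ℝ} (hL : 1 < L) {K : ℕ} (hK : 20 * (L / Real.log L) ≤ K) :
    Real.exp (10 * L) ≤ K.factorial := by
  have hy : 0 < Real.log L := Real.log_pos hL
  have hs : 1 < √L := by rw [Real.lt_sqrt zero_le_one]; simpa
  have hlog : Real.log L ≤ 2 * √L := by
    have h1 := Real.log_le_sub_one_of_pos (show 0 < √L by linarith)
    have h2 : Real.log L = 2 * Real.log √L := by rw [Real.log_sqrt (by linarith)]; ring
    linarith
  have hsq : √L * √L = L := Real.mul_self_sqrt (by linarith)
  have h1 : 10 * √L ≤ K := by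
    refine le_trans ?_ hK
    rw [mul_div_assoc', le_div_iff₀ hy]
    nlinarith
  have hK0 : (0 : ℝ) < K := by linarith
  have h2 : 1 + Real.log L / 2 ≤ Real.log K := by
    have h3 : Real.exp 1 * √L ≤ K := by nlinarith [Real.exp_one_lt_d9]
    have h4 := Real.log_le_log (by positivity) h3
    rw [Real.log_mul (by positivity) (by positivity), Real.log_exp, Real.log_sqrt (by linarith)] at h4
    exact h4
  have h5 : (K : ℝ) ^ K / K.factorial ≤ Real.exp K := Real.pow_div_factorial_le_exp _ hK0.le K
  have h6 : (K : ℝ) ^ K = Real.exp (K * Real.log K) := by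
    rw [Real.exp_nat_mul, Real.exp_log hK0]
  have hf : (0 : ℝ) < K.factorial := by exact_mod_cast K.factorial_pos
  rw [div_le_iff₀ hf, h6] at h5
  have h7 : Real.exp (K * Real.log K - K) ≤ K.factorial := by
    rw [Real.exp_sub, div_le_iff₀ (Real.exp_pos _)]; linarith
  refine le_trans (Real.exp_le_exp.2 ?_) h7
  have h8 : 20 * L ≤ K * Real.log L := by
    rw [mul_div_assoc', div_le_iff₀ hy] at hK; exact hK
  nlinarith

end Estimates

/-! ### Words as fixed sequences of `K` slots -/

section Slots

/-- The position of the `i`-th event of a walk with the given gaps, if it is below `M`. -/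
def slotAt (M : ℕ) : List ℕ → ℕ → ℕ → Option ℕ
  | [], _, _ => none
  | d :: _, j, 0 => if j + d < M then some (j + d) else none
  | d :: l, j, i + 1 => if j + d < M then slotAt M l (j + d + 1) i else none

theorem slotAt_lt {M : ℕ} {l : List ℕ} {j i t : ℕ} (h : slotAt M l j i = some t) : t < M := by
  induction l generalizing j i with
  | nil => simp [slotAt] at h
  | cons d l ih =>
    cases i with
    | zero => simp only [slotAt] at h; split_ifs at h; simp at h; omega
    | succ i => simp only [slotAt] at h; split_ifs at h; exact ih h

theorem timeProd_one {R : Type*} [Monoid R] {X : ℕ → R} {a n : ℕ}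
    (h : ∀ j, a ≤ j → j < a + n → X j = 1) : timeProd X a n = 1 := by
  induction n with
  | zero => rfl
  | succ n ih => rw [timeProd, h _ (by omega) (by omega), ih fun j h1 h2 => h j h1 (by omega), one_mul]

/-- Words of different lengths must run through the same sequence of `K` operations to be applied in
superposition; a slot that the walk does not reach acts as the identity. -/
theorem timeProd_slotAt {R : Type*} [Monoid R] (X : ℕ → R) (M : ℕ) (l : List ℕ) (j : ℕ) :
    timeProd (fun i => (slotAt M l j i).elim 1 X) 0 l.length = wordProd X M l j := by
  induction l generalizing j with
  | nil => rfl
  | cons d l ih =>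
    rw [List.length_cons, timeProd_succ', wordProd]
    have := timeProd_shift (fun i => (slotAt M (d :: l) j i).elim 1 X) 0 1 l.length
    rw [add_zero] at this
    rw [zero_add, ← this]
    by_cases h : j + d < M
    · simp only [h, if_true]
      rw [← ih]
      simp only [add_comm 1, slotAt, h, if_true, Option.elim_some]
    · simp only [h, if_false, add_comm 1, slotAt, Option.elim_none, mul_one]
      exact timeProd_one fun _ _ _ => rfl

theorem sum_slotAt (M : ℕ) (l : List ℕ) (j : ℕ) :
    ∑ i ∈ Finset.range l.length, (if (slotAt M l j i).isSome then (1 : ℝ) else 0) =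
      wordCount M l j := by
  induction l generalizing j with
  | nil => rfl
  | cons d l ih =>
    rw [List.length_cons, Finset.sum_range_succ', wordCount]
    by_cases h : j + d < M
    · simp only [h, if_true]
      rw [← ih]
      simp only [slotAt, h, if_true, Option.isSome_some]
    · simp [h, slotAt]

end Slots

/-! ### Calculus of operators with a query count -/

section Realizable

variable {X I : Type*} [Fintype I] [DecidableEq I]

/-- Families of operators that are products of `x`-independent unitaries and `q` queries. -/
inductive Realizable (F : X → I → Bool) : ℕ → (X → Matrix I I ℂ) → Prop
  | unit (u : Matrix I I ℂ) (hu : u.conjTranspose * u = 1) : Realizable F 0 fun _ => u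
  | step (u : Matrix I I ℂ) (hu : u.conjTranspose * u = 1) {q : ℕ} {A : X → Matrix I I ℂ}
      (hA : Realizable F q A) : Realizable F (q + 1) fun x => u * discreteQuery (F x) * A x

variable {F : X → I → Bool} {q q' : ℕ} {A B : X → Matrix I I ℂ}

theorem mul_unitary {u v : Matrix I I ℂ} (hu : u.conjTranspose * u = 1)
    (hv : v.conjTranspose * v = 1) : (u * v).conjTranspose * (u * v) = 1 := by
  rw [Matrix.conjTranspose_mul, mul_assoc, ← mul_assoc _ u v, hu, one_mul, hv]

theorem conjTranspose_unitary {u : Matrix I I ℂ} (hu : u.conjTranspose * u = 1) :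
    u.conjTranspose.conjTranspose * u.conjTranspose = 1 := by
  rw [Matrix.conjTranspose_conjTranspose]; exact mul_eq_one_comm.1 hu

theorem Realizable.unit_mul (h : Realizable F q A) {u : Matrix I I ℂ}
    (hu : u.conjTranspose * u = 1) : Realizable F q fun x => u * A x := by
  cases h with
  | unit v hv => exact .unit _ (mul_unitary hu hv)
  | step v hv hA =>
    have := Realizable.step _ (mul_unitary hu hv) hA
    simpa only [mul_assoc] using this

theorem Realizable.mul (hA : Realizable F q A) (hB : Realizable F q' B) :
    Realizable F (q + q') fun x => A x * B x := by
  induction hA with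
  | unit u hu => rw [zero_add]; exact hB.unit_mul hu
  | step u hu _ ih =>
    have := Realizable.step u hu ih
    rw [add_right_comm]
    simpa only [mul_assoc] using this

theorem Realizable.query : Realizable F 1 fun x => discreteQuery (F x) := by
  have := Realizable.step (F := F) 1 (by simp) (.unit 1 (by simp))
  simpa using this

theorem Realizable.conjTranspose (hA : Realizable F q A) :
    Realizable F q fun x => (A x).conjTranspose := by
  induction hA with
  | unit u hu => exact .unit _ (conjTranspose_unitary hu)
  | step u hu _ ih =>
    have := (ih.mul (Realizable.query (F := F))).mul (.unit _ (conjTranspose_unitary hu))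
    simpa only [Matrix.conjTranspose_mul, conjTranspose_discreteQuery, mul_assoc] using this

theorem Realizable.unitary (hA : Realizable F q A) (x : X) :
    (A x).conjTranspose * A x = 1 := by
  induction hA with
  | unit u hu => exact hu
  | step u hu _ ih =>
    exact mul_unitary (mul_unitary hu (by
      rw [conjTranspose_discreteQuery, discreteQuery_mul_self])) ih

theorem Realizable.timeProd {A : ℕ → X → Matrix I I ℂ} (n a : ℕ)
    (h : ∀ i, a ≤ i → i < a + n → Realizable F q (A i)) :
    Realizable F (n * q) fun x => timeProd (fun i => A i x) a n := by
  induction n with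
  | zero => rw [zero_mul]; exact .unit 1 (by simp)
  | succ n ih =>
    rw [show (n + 1) * q = q + n * q by ring]
    exact (h (a + n) (by omega) (by omega)).mul (ih fun i h1 h2 => h i h1 (by omega))

/-- Amplification uses the operator twice and its adjoint once; the reflections make no query. -/
theorem Realizable.amplify {Pr : Matrix I I ℂ}
    (hR : (1 - (2 : ℂ) • Pr).conjTranspose * (1 - (2 : ℂ) • Pr) = 1) (hA : Realizable F q A) :
    Realizable F (3 * q) fun x => amplify (A x) Pr := by
  have h1 : (-(1 : Matrix I I ℂ)).conjTranspose * -1 = 1 := by simp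
  have := (((hA.mul (.unit _ hR)).mul hA.conjTranspose).mul (.unit _ hR)).mul hA
  rw [show 3 * q = q + 0 + q + 0 + q by ring]
  have := this.unit_mul h1
  simpa only [QuerySim.amplify, neg_mul, one_mul] using this

theorem Realizable.reindex {I' : Type*} [Fintype I'] [DecidableEq I'] (e : I ≃ I')
    (hA : Realizable F q A) :
    Realizable (fun x s => F x (e.symm s)) q fun x => Matrix.reindex e e (A x) := by
  have key : ∀ u : Matrix I I ℂ, u.conjTranspose * u = 1 →
      (Matrix.reindex e e u).conjTranspose * Matrix.reindex e e u = 1 := by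
    intro u hu
    rw [Matrix.conjTranspose_reindex, Matrix.reindex_apply, Matrix.reindex_apply,
      Matrix.submatrix_mul_equiv, hu, Matrix.submatrix_one_equiv]
  induction hA with
  | unit u hu => exact .unit _ (key u hu)
  | step u hu _ ih =>
    have := Realizable.step _ (key u hu) ih
    convert! this using 2 with x
    have hq : discreteQuery (fun s => F x (e.symm s)) =
        (discreteQuery (F x)).submatrix e.symm e.symm := by
      rw [discreteQuery, discreteQuery, Matrix.submatrix_diagonal_equiv]; rfl
    simp only [Matrix.reindex_apply, hq, Matrix.submatrix_mul_equiv]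

theorem Realizable.exists_algorithm (hA : Realizable F q A) :
    ∃ D : DiscreteAlgorithm I, D.queries = q ∧ ∀ x, D.eval (F x) = A x := by
  induction hA with
  | unit u hu =>
    exact ⟨⟨⟨u, Matrix.mem_unitaryGroup_iff'.2 hu⟩, []⟩, rfl, fun x => rfl⟩
  | step u hu _ ih =>
    obtain ⟨D, h1, h2⟩ := ih
    refine ⟨⟨D.init, D.steps ++ [⟨u, Matrix.mem_unitaryGroup_iff'.2 hu⟩]⟩, ?_, fun x => ?_⟩
    · rw [← h1]; simp [DiscreteAlgorithm.queries]
    · simp only [← h2 x]; simp [DiscreteAlgorithm.eval]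

end Realizable

/-! ### Controlled operators and state preparation on a tensor factor -/

section Blocks

variable {β R : Type*} [Fintype β] [DecidableEq β] [Fintype R] [DecidableEq R]

/-- The isometry `|s⟩ ↦ |s⟩|r⟩`. -/
def baseCol (β : Type*) [DecidableEq β] {R : Type*} [DecidableEq R] (r : R) :
    Matrix (β × R) β ℂ := fun s t => if s = (t, r) then 1 else 0

theorem mul_baseCol_apply {γ : Type*} (N : Matrix γ (β × R) ℂ) (r : R) (s : γ) (t : β) :
    (N * baseCol β r) s t = N s (t, r) := by
  simp [Matrix.mul_apply, baseCol]

theorem baseCol_mul_apply {γ : Type*} (N : Matrix β γ ℂ) (r : R) (s : β × R) (t : γ) :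
    (baseCol β r * N) s t = if s.2 = r then N s.1 t else 0 := by
  rw [Matrix.mul_apply]
  by_cases h : s.2 = r
  · rw [Finset.sum_eq_single s.1]
    · simp [baseCol, ← h]
    · intro b _ hb; simp [baseCol, Prod.ext_iff, hb.symm]
    · simp
  · simp [baseCol, Prod.ext_iff, h]

theorem conjTranspose_baseCol_mul (r : R) : (baseCol β r).conjTranspose * baseCol β r = 1 := by
  ext s t
  rw [mul_baseCol_apply]
  by_cases h : s = t <;> simp [baseCol, h, eq_comm, Matrix.one_apply]

theorem blockDiagonal_mul_baseCol (B : R → Matrix β β ℂ) (r : R) :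
    Matrix.blockDiagonal B * baseCol β r = baseCol β r * B r := by
  ext s t
  rw [mul_baseCol_apply, baseCol_mul_apply, Matrix.blockDiagonal_apply]
  by_cases h : s.2 = r <;> simp [h]

theorem blockDiagonal_unitary {B : R → Matrix β β ℂ} (h : ∀ r, (B r).conjTranspose * B r = 1) :
    (Matrix.blockDiagonal B).conjTranspose * Matrix.blockDiagonal B = 1 := by
  rw [Matrix.blockDiagonal_conjTranspose, ← Matrix.blockDiagonal_mul]
  simp [h]; exact Matrix.blockDiagonal_one

/-- The operator `p` acting on the second factor. -/
def actRight (β : Type*) [DecidableEq β] (p : Matrix R R ℂ) : Matrix (β × R) (β × R) ℂ :=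
  Matrix.kroneckerMap (· * ·) (1 : Matrix β β ℂ) p

theorem actRight_unitary {p : Matrix R R ℂ} (h : p.conjTranspose * p = 1) :
    (actRight β p).conjTranspose * actRight β p = 1 := by
  rw [actRight, Matrix.conjTranspose_kronecker, ← Matrix.mul_kronecker_mul, h]
  simp

theorem actRight_mul_baseCol (p : Matrix R R ℂ) (r : R) :
    actRight β p * baseCol β r = ∑ r', p r' r • baseCol β r' := by
  ext s t
  rw [mul_baseCol_apply, Matrix.sum_apply]
  simp only [actRight, Matrix.kroneckerMap_apply, Matrix.smul_apply, baseCol, Prod.ext_iff,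
    smul_eq_mul, mul_ite, mul_one, mul_zero]
  rw [Finset.sum_eq_single s.2]
  · by_cases h : s.1 = t <;> simp [h, Matrix.one_apply]
  · intro b _ hb; simp [hb.symm]
  · simp

/-- The projection onto `r` in the second factor. -/
def projRight (β : Type*) [DecidableEq β] {R : Type*} [DecidableEq R] (r : R) :
    Matrix (β × R) (β × R) ℂ := Matrix.diagonal fun s => if s.2 = r then 1 else 0

theorem projRight_mul_baseCol (r r' : R) :
    projRight β r * baseCol β r' = if r' = r then baseCol β r' else 0 := by
  ext s t
  rw [mul_baseCol_apply, projRight, Matrix.diagonal_apply]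
  by_cases h : r' = r
  · by_cases h2 : s = (t, r')
    · simp [h2, h, baseCol]
    · subst h; simp [h2, baseCol]
  · by_cases h2 : s = (t, r')
    · simp [h2, h]
    · simp [h2, h]

theorem norm_diagonal_ite_le {I : Type*} [Fintype I] [DecidableEq I] (φ : I → Prop)
    [DecidablePred φ] : ‖(Matrix.diagonal fun s => if φ s then (1 : ℂ) else 0)‖ ≤ 1 := by
  rw [Matrix.l2_opNorm_diagonal]
  exact (pi_norm_le_iff_of_nonneg zero_le_one).2 fun s => by by_cases h : φ s <;> simp [h]

theorem reflection_unitary {I : Type*} [Fintype I] [DecidableEq I] (φ : I → Prop)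
    [DecidablePred φ] :
    (1 - (2 : ℂ) • (Matrix.diagonal fun s : I => if φ s then (1 : ℂ) else 0)).conjTranspose *
      (1 - (2 : ℂ) • (Matrix.diagonal fun s => if φ s then (1 : ℂ) else 0)) = 1 := by
  have : (1 - (2 : ℂ) • (Matrix.diagonal fun s : I => if φ s then (1 : ℂ) else 0)) =
      Matrix.diagonal fun s => if φ s then -1 else 1 := by
    rw [← Matrix.diagonal_one, ← Matrix.diagonal_smul, Matrix.diagonal_sub]
    congr 1; ext s; by_cases h : φ s <;> simp [h]; norm_num
  rw [this, Matrix.diagonal_conjTranspose, Matrix.diagonal_mul_diagonal, ← Matrix.diagonal_one]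
  congr 1; ext s; by_cases h : φ s <;> simp [h]

/-- A unit vector extends to an orthonormal basis; this is state preparation when only queries are
counted. -/
theorem exists_unitary_column {a : R → ℂ} (r : R) (ha : ∑ i, ‖a i‖ ^ 2 = 1) :
    ∃ p : Matrix R R ℂ, p.conjTranspose * p = 1 ∧ ∀ i, p i r = a i := by
  let v : R → EuclideanSpace ℂ R := fun _ => WithLp.toLp 2 a
  have hv : Orthonormal ℂ (({r} : Set R).domRestrict v) := by
    refine ⟨fun i => ?_, fun i j hij => (hij (Subsingleton.elim i j)).elim⟩
    rw [Set.domRestrict_apply, EuclideanSpace.norm_eq]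
    simp [v, ha]
  obtain ⟨b, hb⟩ := hv.exists_orthonormalBasis_extension_of_card_eq (by simp)
  refine ⟨(EuclideanSpace.basisFun R ℂ).toBasis.toMatrix b,
    Matrix.mem_unitaryGroup_iff'.1
      ((EuclideanSpace.basisFun R ℂ).toMatrix_orthonormalBasis_mem_unitary b), fun i => ?_⟩
  rw [Module.Basis.toMatrix_apply, hb r rfl]
  simp [v]

end Blocks

/-! ### Segments in the query model -/

section SegmentAlgorithm

variable {X β : Type*} [Fintype β] [DecidableEq β]

/-- The last value `M` carries the whole tail and means that there is no further event. -/
theorem isGeometric_fin {M : ℕ} {p q : ℝ} (hp : 0 ≤ p) (hq : 0 ≤ q) (hpq : p + q = 1) :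
    IsGeometric (fun i : Fin (M + 1) => if (i : ℕ) < M then p * q ^ (i : ℕ) else q ^ M)
      (fun i => (i : ℕ)) M p q where
  nonneg i := by split_ifs <;> positivity
  sum_eq := by
    rw [Fin.sum_univ_castSucc]
    have hp' : p = 1 - q := by linarith
    simp only [Fin.val_castSucc, Fin.is_lt, if_true, Fin.val_last, lt_irrefl, if_false]
    rw [Fin.sum_univ_eq_sum_range (fun i => p * q ^ i), ← Finset.mul_sum, hp', mul_neg_geom_sum]
    ring
  geom i hi := by
    rw [Finset.sum_eq_single (⟨i, by omega⟩ : Fin (M + 1))]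
    · simp [hi]
    · intro b hb hb'
      exact (hb' (Fin.ext (Finset.mem_filter.1 hb).2)).elim
    · simp

/-- The permutation matrix of `sw`. -/
def permMat {I : Type*} [DecidableEq I] (sw : Equiv.Perm I) : Matrix I I ℂ :=
  fun s t => if s = sw t then 1 else 0

theorem conjTranspose_permMat_mul {I : Type*} [Fintype I] [DecidableEq I] (sw : Equiv.Perm I)
    (d : I → ℂ) : (permMat sw).conjTranspose * Matrix.diagonal d * permMat sw =
      Matrix.diagonal (d ∘ sw) := by
  ext s t
  rw [Matrix.mul_apply]
  simp only [Matrix.mul_diagonal, Matrix.conjTranspose_apply, permMat]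
  rw [Finset.sum_eq_single (sw t)]
  · by_cases h : s = t
    · simp [h]
    · simp [h, Ne.symm h]
  · intro b _ hb; simp [hb]
  · simp

/-- The basis change of a query slot: the interaction picture at an event, and a permutation that
neutralizes the query otherwise. -/
noncomputable def slotBasis (U : ℕ → Matrix β β ℂ) (sw : Equiv.Perm (β × Bool)) :
    Option ℕ → Matrix (β × Bool) (β × Bool) ℂ
  | some t => Matrix.blockDiagonal fun _ => U t
  | none => permMat sw

theorem slotBasis_unitary {U : ℕ → Matrix β β ℂ} (hU : ∀ j, (U j).conjTranspose * U j = 1)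
    (sw : Equiv.Perm (β × Bool)) (t : Option ℕ) :
    (slotBasis U sw t).conjTranspose * slotBasis U sw t = 1 := by
  cases t with
  | some t => exact blockDiagonal_unitary fun _ => hU t
  | none =>
    have := conjTranspose_permMat_mul sw fun _ => 1
    rw [Matrix.diagonal_one, mul_one] at this
    exact this.trans Matrix.diagonal_one

/-- The phase of a query slot. -/
noncomputable def slotPhase (t : Option ℕ) : ℂ := if t.isSome then Complex.I else 1

theorem star_slotPhase_mul (t : Option ℕ) : star (slotPhase t) * slotPhase t = 1 := by
  cases t <;> simp [slotPhase]

theorem smul_unitary {I : Type*} [Fintype I] [DecidableEq I] {z : ℂ} (hz : star z * z = 1)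
    {u : Matrix I I ℂ} (hu : u.conjTranspose * u = 1) : (z • u).conjTranspose * (z • u) = 1 := by
  rw [Matrix.conjTranspose_smul, smul_mul_smul_comm, hz, hu, one_smul]

theorem discreteQuery_fst {R : Type*} [Fintype R] [DecidableEq R] (f : β → Bool) :
    discreteQuery (fun s : β × R => f s.1) = Matrix.blockDiagonal fun _ => discreteQuery f := by
  simp only [discreteQuery, Matrix.blockDiagonal_diagonal]

/-- Every slot spends its query. At an event the query is conjugated by `U t` and gets the factor
`i`; otherwise the permutation first moves the clean bit into the place that the query reads, where
the query does nothing. -/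
theorem slot_mul_baseCol {f : β → Bool} {U : ℕ → Matrix β β ℂ} {sw : Equiv.Perm (β × Bool)}
    (hsw : ∀ s, f (sw (s, false)).1 = false) (t : Option ℕ) :
    (slotPhase t • ((slotBasis U sw t).conjTranspose * discreteQuery (fun s : β × Bool => f s.1) *
      slotBasis U sw t)) * baseCol β false =
      baseCol β false * t.elim 1 fun j => eventOp f (U j) := by
  cases t with
  | some t =>
    simp only [slotBasis, slotPhase, Option.isSome_some, if_true, Option.elim_some, eventOp,
      discreteQuery_fst, Matrix.blockDiagonal_conjTranspose, ← Matrix.blockDiagonal_mul,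
      Matrix.smul_mul, Matrix.mul_smul, blockDiagonal_mul_baseCol]
  | none =>
    simp only [slotBasis, slotPhase, Option.isSome_none, Option.elim_none, Matrix.mul_one]
    rw [discreteQuery, conjTranspose_permMat_mul]
    ext s t
    rw [mul_baseCol_apply, Matrix.smul_apply, Matrix.diagonal_apply, baseCol]
    by_cases h : s = (t, false)
    · simp [h, hsw]
    · simp [h]

/-- Sequences of `K` gaps, and a sign. -/
abbrev GapWord (K M : ℕ) := (Fin K → Fin (M + 1)) × Bool

/-- When only queries count, the register of gaps may be prepared by any unitary and the driving
evolutions are applied exactly, controlled by the register. `K` slots, used three times by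
amplification, give `3 * K` queries. -/
theorem exists_realizable_segment {f : X → β → Bool} {sw : Equiv.Perm (β × Bool)}
    (hsw : ∀ x s, f x (sw (s, false)).1 = false) {U : ℕ → Matrix β β ℂ}
    (hU : ∀ j, (U j).conjTranspose * U j = 1) {α : ℝ} {M : ℕ} (h : IsSegment α M) (K : ℕ)
    (o : GapWord K M) :
    ∃ A : X → Matrix ((β × Bool) × GapWord K M) ((β × Bool) × GapWord K M) ℂ,
      Realizable (fun x s => f x s.1.1) (3 * K) A ∧
      ∀ x, ‖A x * (baseCol (β × Bool) o * baseCol β false) -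
        (baseCol (β × Bool) o * baseCol β false) * segmentProd (f x) U α 0 M‖ ≤
          16 / K.factorial := by
  have hp := h.eventProb_pos.le
  have hq : 0 ≤ 1 - eventProb α := by linarith [h.eventProb_lt_one]
  have hw := isGeometric_fin (M := M) hp hq (by ring)
  set w : Fin (M + 1) → ℝ := fun i =>
    if (i : ℕ) < M then eventProb α * (1 - eventProb α) ^ (i : ℕ) else (1 - eventProb α) ^ M
  obtain ⟨p, hpu, hpo⟩ := exists_unitary_column
    (a := fun x : GapWord K M => (√(wordWeight w x) : ℂ)) o (by
      rw [← sum_wordWeight hw K]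
      refine Finset.sum_congr rfl fun x _ => ?_
      rw [Complex.norm_real, Real.norm_of_nonneg (Real.sqrt_nonneg _),
        Real.sq_sqrt (wordWeight_nonneg hw.nonneg x)])
  let tt : GapWord K M → ℕ → Option ℕ := fun x i =>
    slotAt M (List.ofFn fun k => (x.1 k : ℕ)) 0 i
  let P := actRight (β × Bool) p
  let Ph : Matrix ((β × Bool) × GapWord K M) ((β × Bool) × GapWord K M) ℂ :=
    Matrix.blockDiagonal fun x => halfPhase α M x.2 • (1 : Matrix (β × Bool) (β × Bool) ℂ)
  let B : ℕ → Matrix ((β × Bool) × GapWord K M) ((β × Bool) × GapWord K M) ℂ := fun i =>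
    Matrix.blockDiagonal fun x => slotBasis U sw (tt x i)
  let C : ℕ → Matrix ((β × Bool) × GapWord K M) ((β × Bool) × GapWord K M) ℂ := fun i =>
    Matrix.blockDiagonal fun x => slotPhase (tt x i) • (slotBasis U sw (tt x i)).conjTranspose
  let F : X → (β × Bool) × GapWord K M → Bool := fun x s => f x s.1.1
  let Sel : X → Matrix ((β × Bool) × GapWord K M) ((β × Bool) × GapWord K M) ℂ := fun x =>
    Ph * timeProd (fun i => C i * discreteQuery (F x) * B i) 0 K
  have hP : P.conjTranspose * P = 1 := actRight_unitary hpu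
  have hPh : Ph.conjTranspose * Ph = 1 := blockDiagonal_unitary fun x => smul_unitary (by
    rw [Complex.star_def, mul_comm, Complex.mul_conj, Complex.normSq_eq_norm_sq, norm_halfPhase]
    simp) (by simp)
  have hB : ∀ i, (B i).conjTranspose * B i = 1 := fun i =>
    blockDiagonal_unitary fun x => slotBasis_unitary hU sw _
  have hC : ∀ i, (C i).conjTranspose * C i = 1 := fun i =>
    blockDiagonal_unitary fun x => smul_unitary (star_slotPhase_mul _)
      (conjTranspose_unitary (slotBasis_unitary hU sw _))
  have rSel : Realizable F K Sel := by
    have := (Realizable.timeProd (F := F) (q := 1) (A := fun i x =>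
      C i * discreteQuery (F x) * B i) K 0 fun i _ _ =>
        (Realizable.step (F := F) (C i) (hC i) (.unit (B i) (hB i)))).unit_mul hPh
    rwa [mul_one] at this
  have rW : Realizable F K fun x => P.conjTranspose * Sel x * P := by
    have := (rSel.unit_mul (conjTranspose_unitary hP)).mul (.unit P hP)
    exact this
  have rR := rW.amplify (Pr := projRight (β × Bool) o) (reflection_unitary _)
  refine ⟨_, rR, fun x => ?_⟩
  have hSJ : ∀ g : GapWord K M, Sel x * (baseCol (β × Bool) g * baseCol β false) =
      (baseCol (β × Bool) g * baseCol β false) *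
        wordOp (fun i : Fin (M + 1) => (i : ℕ)) (f x) U α M g := by
    intro g
    have hslot : ∀ i, (C i * discreteQuery (F x) * B i) *
        (baseCol (β × Bool) g * baseCol β false) =
        (baseCol (β × Bool) g * baseCol β false) *
          (tt g i).elim 1 fun j => eventOp (f x) (U j) := by
      intro i
      have e : C i * discreteQuery (F x) * B i = Matrix.blockDiagonal fun y =>
          slotPhase (tt y i) • ((slotBasis U sw (tt y i)).conjTranspose *
            discreteQuery (fun s : β × Bool => f x s.1) * slotBasis U sw (tt y i)) := by
        simp only [C, B, F]
        rw [discreteQuery_fst (fun s : β × Bool => f x s.1), ← Matrix.blockDiagonal_mul,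
          ← Matrix.blockDiagonal_mul]
        simp only [Matrix.smul_mul]
      rw [e, ← Matrix.mul_assoc, blockDiagonal_mul_baseCol, Matrix.mul_assoc,
        slot_mul_baseCol (hsw x), Matrix.mul_assoc]
    have htp : ∀ n, timeProd (fun i => C i * discreteQuery (F x) * B i) 0 n *
        (baseCol (β × Bool) g * baseCol β false) = (baseCol (β × Bool) g * baseCol β false) *
          timeProd (fun i => (tt g i).elim 1 fun j => eventOp (f x) (U j)) 0 n := by
      intro n
      induction n with
      | zero => simp [timeProd]
      | succ n ih =>
        rw [timeProd, timeProd, Matrix.mul_assoc, ih, ← Matrix.mul_assoc, hslot, Matrix.mul_assoc]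
    have hlen := timeProd_slotAt (fun j => eventOp (f x) (U j)) M
      (List.ofFn fun k => (g.1 k : ℕ)) 0
    rw [List.length_ofFn] at hlen
    simp only [Sel]
    rw [Matrix.mul_assoc, htp, hlen, ← Matrix.mul_assoc, ← Matrix.mul_assoc]
    simp only [Ph]
    rw [blockDiagonal_mul_baseCol, wordOp]
    simp only [Matrix.mul_smul, Matrix.smul_mul, Matrix.mul_one]
  have hz : ∀ g : GapWord K M, Sel x * (baseCol (β × Bool) g * baseCol β false) -
      (baseCol (β × Bool) g * baseCol β false) *
        wordOp (fun i : Fin (M + 1) => (i : ℕ)) (f x) U α M g = 0 := fun g => by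
    rw [hSJ, sub_self]
  have hz' : ∀ g : GapWord K M, (Sel x).conjTranspose * (baseCol (β × Bool) g * baseCol β false) -
      (baseCol (β × Bool) g * baseCol β false) *
        (wordOp (fun i : Fin (M + 1) => (i : ℕ)) (f x) U α M g).conjTranspose = 0 := fun g => by
    have hw1 := mul_eq_one_comm.1 (wordOp_unitary (gap := fun i : Fin (M + 1) => (i : ℕ)) (f x) α
      (fun j (_ : j < M) => hU j) g)
    have : (Sel x).conjTranspose * (baseCol (β × Bool) g * baseCol β false) =
        (baseCol (β × Bool) g * baseCol β false) *
          (wordOp (fun i : Fin (M + 1) => (i : ℕ)) (f x) U α M g).conjTranspose := by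
      have e := Matrix.mul_one ((Sel x).conjTranspose * (baseCol (β × Bool) g * baseCol β false))
      rw [← hw1, ← Matrix.mul_assoc, Matrix.mul_assoc (Sel x).conjTranspose, ← hSJ,
        ← Matrix.mul_assoc (Sel x).conjTranspose, rSel.unitary, Matrix.one_mul] at e
      exact e.symm
    rw [this, sub_self]
  -- The selected operators are the words exactly, hence `δ = 0` and only the truncation error
  -- remains.
  have := norm_amplify_segment_sub_le h hw (f x) (fun j _ => hU j) (P := P) (Sel := Sel x)
    (Pr := projRight (β × Bool) o) (J := baseCol (β × Bool) o * baseCol β false)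
    (Jg := fun g => baseCol (β × Bool) g * baseCol β false) (δ := 0) hP (rSel.unitary x)
    (norm_diagonal_ite_le _) (by
      rw [Matrix.conjTranspose_mul, Matrix.mul_assoc, ← Matrix.mul_assoc (baseCol (β × Bool) o).conjTranspose,
        conjTranspose_baseCol_mul, Matrix.one_mul, conjTranspose_baseCol_mul]) le_rfl
    (by rw [← Matrix.mul_assoc, projRight_mul_baseCol, if_pos rfl])
    (by
      rw [← Matrix.mul_assoc, actRight_mul_baseCol, Matrix.sum_mul]
      simp only [hpo, Matrix.smul_mul])
    (by
      intro g
      have : P.conjTranspose = actRight (β × Bool) p.conjTranspose := by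
        simp only [P, actRight]
        rw [Matrix.conjTranspose_kronecker, Matrix.conjTranspose_one]
      rw [this, Matrix.mul_assoc, ← Matrix.mul_assoc (actRight _ _), actRight_mul_baseCol,
        ← Matrix.mul_assoc, Matrix.mul_sum]
      simp only [Matrix.mul_smul, projRight_mul_baseCol]
      rw [Finset.sum_eq_single o]
      · simp [Matrix.conjTranspose_apply, hpo]
      · intro b _ hb; simp [hb]
      · simp)
    (fun g => by rw [hz]; simp) (fun g => by rw [hz]; simp) (fun g => by rw [hz']; simp)
  simpa using this

theorem segmentProd_shift (f : β → Bool) (U : ℕ → Matrix β β ℂ) (α : ℝ) (a M : ℕ) :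
    segmentProd f U α a M = segmentProd f (fun j => U (a + j)) α 0 M :=
  (timeProd_shift (fun j => (U j).conjTranspose * fractionalQuery f α * U j) 0 a M).symm

theorem segmentProd_add (f : β → Bool) (U : ℕ → Matrix β β ℂ) (α : ℝ) (a m n : ℕ) :
    segmentProd f U α a (m + n) = segmentProd f U α (a + m) n * segmentProd f U α a m :=
  timeProd_add _ _ _ _

/-- Errors of consecutive simulations add up. -/
theorem norm_mul_mul_sub_le {I : Type*} [Fintype I] [DecidableEq I] {A B : Matrix I I ℂ}
    {J : Matrix I β ℂ} {V W : Matrix β β ℂ} {a b : ℝ} (hA : ‖A‖ ≤ 1) (hW : ‖W‖ ≤ 1)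
    (h₁ : ‖A * J - J * V‖ ≤ a) (h₂ : ‖B * J - J * W‖ ≤ b) :
    ‖A * B * J - J * (V * W)‖ ≤ a + b := by
  have e : A * B * J - J * (V * W) = A * (B * J - J * W) + (A * J - J * V) * W := by
    rw [Matrix.mul_sub, Matrix.sub_mul]; simp only [Matrix.mul_assoc]; abel
  rw [e]
  have h3 := norm_mul_le_of_le hA h₂
  have h4 := norm_mul_le_of_le h₁ hW
  refine (norm_add_le _ _).trans ?_
  linarith

/-- Each segment returns the ancilla to its initial state up to its error, so one ancilla serves all
segments and the errors add. -/
theorem exists_realizable_segments {f : X → β → Bool} {sw : Equiv.Perm (β × Bool)}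
    (hsw : ∀ x s, f x (sw (s, false)).1 = false) {U : ℕ → Matrix β β ℂ}
    (hU : ∀ j, (U j).conjTranspose * U j = 1) {α : ℝ} {M : ℕ} (h : IsSegment α M) (K : ℕ)
    (o : GapWord K M) (S : ℕ) :
    ∃ A : X → Matrix ((β × Bool) × GapWord K M) ((β × Bool) × GapWord K M) ℂ,
      Realizable (fun x s => f x s.1.1) (S * (3 * K)) A ∧
      ∀ x, ‖A x * (baseCol (β × Bool) o * baseCol β false) -
        (baseCol (β × Bool) o * baseCol β false) * segmentProd (f x) U α 0 (S * M)‖ ≤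
          S * (16 / K.factorial) := by
  induction S with
  | zero =>
    refine ⟨fun _ => 1, by rw [zero_mul]; exact .unit 1 (by simp), fun x => ?_⟩
    simp [segmentProd, timeProd]
  | succ S ih =>
    obtain ⟨A, hA, hA'⟩ := ih
    obtain ⟨B, hB, hB'⟩ := exists_realizable_segment hsw (U := fun j => U (S * M + j))
      (fun j => hU _) h K o
    refine ⟨fun x => B x * A x, ?_, fun x => ?_⟩
    · have := hB.mul hA
      rwa [show 3 * K + S * (3 * K) = (S + 1) * (3 * K) by ring] at this
    · have h1 := hB' x
      rw [← segmentProd_shift] at h1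
      rw [Nat.succ_mul, segmentProd_add, zero_add]
      refine (norm_mul_mul_sub_le (norm_le_one_of_conjTranspose_mul_self (hB.unitary x))
        (norm_le_one_of_conjTranspose_mul_self (segmentProd_unitary (f x) fun j _ _ => hU j))
        h1 (hA' x)).trans (le_of_eq ?_)
      push_cast; ring

end SegmentAlgorithm

/-! ### Passage to the register model -/

section Simulation

variable {N : ℕ} {W : Type*} [Fintype W] [DecidableEq W]

/-- Exchange of the target bit with an additional bit. -/
def swapBit (N : ℕ) (W : Type*) : Equiv.Perm ((Fin N × Bool × W) × Bool) where
  toFun s := ((s.1.1, s.2, s.1.2.2), s.1.2.1)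
  invFun s := ((s.1.1, s.2, s.1.2.2), s.1.2.1)
  left_inv _ := rfl
  right_inv _ := rfl

theorem exists_equiv_fin_succ {R : Type*} [Fintype R] [DecidableEq R] (r : R) :
    ∃ (d : ℕ) (e : R ≃ Fin (d + 1)), e r = 0 := by
  obtain ⟨d, hd⟩ : ∃ d, Fintype.card R = d + 1 :=
    Nat.exists_eq_succ_of_ne_zero (Fintype.card_pos_iff.2 ⟨r⟩).ne'
  refine ⟨d, (Fintype.equivFinOfCardEq hd).trans
    (Equiv.swap (Fintype.equivFinOfCardEq hd r) 0), ?_⟩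
  simp

/-- The basis of system and ancilla, in the order of the register model. -/
def registerEquiv {G : Type*} {d : ℕ} (e : Bool × G ≃ Fin (d + 1)) :
    ((Fin N × Bool × W) × Bool) × G ≃ Fin N × Bool × (W × Fin (d + 1)) where
  toFun s := (s.1.1.1, s.1.1.2.1, (s.1.1.2.2, e (s.1.2, s.2)))
  invFun s := (((s.1, s.2.1, s.2.2.1), (e.symm s.2.2.2).1), (e.symm s.2.2.2).2)
  left_inv s := by simp
  right_inv s := by simp

theorem norm_submatrix_equiv_le {I I' S : Type*} [Fintype I] [DecidableEq I] [Fintype I']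
    [DecidableEq I'] [Fintype S] [DecidableEq S] (e : I' ≃ I) (A : Matrix I S ℂ) :
    ‖A.submatrix e id‖ ≤ ‖A‖ := by
  have h1 : A.submatrix e id = (1 : Matrix I I ℂ).submatrix e id * A := by
    ext i j; simp [Matrix.mul_apply, Matrix.one_apply]
  have h2 : ((1 : Matrix I I ℂ).submatrix e id).conjTranspose *
      (1 : Matrix I I ℂ).submatrix e id = 1 := by
    rw [Matrix.conjTranspose_submatrix, Matrix.submatrix_mul_equiv]; simp
  rw [h1]
  have := norm_mul_le_of_le (norm_le_one_of_conjTranspose_mul_self h2) (le_refl ‖A‖)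
  linarith

/-- What remains is to append the final unitary, which needs no query, and to merge the extra bit
and the gap register into one ancilla whose state 0 is the initial one. -/
theorem discretelySimulable_segments {U : ℕ → Matrix (Fin N × Bool × W) (Fin N × Bool × W) ℂ}
    (hU : ∀ j, (U j).conjTranspose * U j = 1) {Uf : Matrix (Fin N × Bool × W) (Fin N × Bool × W) ℂ}
    (hUf : Uf.conjTranspose * Uf = 1) {α : ℝ} {M : ℕ} (h : IsSegment α M) (K S : ℕ)
    {V : (Fin N → Bool) → Matrix (Fin N × Bool × W) (Fin N × Bool × W) ℂ} {ε q : ℝ}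
    (hq : (S * (3 * K) : ℝ) ≤ q)
    (hV : ∀ x, S * (16 / (K.factorial : ℝ)) +
      ‖V x - Uf * segmentProd (registerBit x) U α 0 (S * M)‖ ≤ ε) :
    DiscretelySimulable V ε q := by
  let o : GapWord K M := (fun _ => 0, false)
  obtain ⟨A, hA, hA'⟩ := exists_realizable_segments (f := fun x => registerBit (N := N) (W := W) x)
    (sw := swapBit N W) (fun x s => by simp [registerBit, swapBit]) hU h K o S
  obtain ⟨d, e, he⟩ := exists_equiv_fin_succ ((false, o) : Bool × GapWord K M)
  let E := registerEquiv (N := N) (W := W) e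
  let L : Matrix (((Fin N × Bool × W) × Bool) × GapWord K M)
      (((Fin N × Bool × W) × Bool) × GapWord K M) ℂ :=
    Matrix.blockDiagonal fun _ => Matrix.blockDiagonal fun _ => Uf
  have hL : L.conjTranspose * L = 1 :=
    blockDiagonal_unitary fun _ => blockDiagonal_unitary fun _ => hUf
  have hB := (hA.unit_mul hL).reindex E
  obtain ⟨D, hD, hD'⟩ := hB.exists_algorithm
  refine ⟨d, D, ?_, fun x => ?_⟩
  · rw [hD]; push_cast; exact hq
  · have hF : (fun s => registerBit x ((E.symm s).1.1)) =
        (registerBit x : Fin N × Bool × (W × Fin (d + 1)) → Bool) := by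
      funext s; simp [E, registerEquiv, registerBit]
    have hDx := hD' x
    simp only [hF] at hDx
    rw [hDx]
    set J := baseCol ((Fin N × Bool × W) × Bool) o * baseCol (Fin N × Bool × W) false with hJ
    have hanc : addAncilla N W d = J.submatrix E.symm id := by
      ext s t
      rw [hJ, Matrix.submatrix_apply, mul_baseCol_apply, baseCol, addAncilla]
      have : (E.symm s = ((id t, false), o)) ↔ s = (t.1, t.2.1, (t.2.2, 0)) := by
        rw [Equiv.symm_apply_eq]
        simp [E, registerEquiv, he]
      simp only [this]
    have hLJ : L * J = J * Uf := by
      simp only [L]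
      rw [hJ, ← Matrix.mul_assoc, blockDiagonal_mul_baseCol, Matrix.mul_assoc,
        blockDiagonal_mul_baseCol, Matrix.mul_assoc]
    have heq : Matrix.reindex E E (L * A x) * addAncilla N W d - addAncilla N W d * V x =
        (L * A x * J - J * V x).submatrix E.symm id := by
      rw [hanc, Matrix.reindex_apply, Matrix.submatrix_mul_equiv]
      rfl
    rw [heq]
    refine (norm_submatrix_equiv_le _ _).trans ?_
    have hJn : ‖J‖ ≤ 1 := by
      have := norm_mul_le_of_le
        (norm_le_one_of_conjTranspose_mul_self (conjTranspose_baseCol_mul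
          (β := (Fin N × Bool × W) × Bool) o))
        (norm_le_one_of_conjTranspose_mul_self (conjTranspose_baseCol_mul
          (β := Fin N × Bool × W) false))
      simpa using this
    have h1 := norm_mul_mul_sub_le (norm_le_one_of_conjTranspose_mul_self hL)
      (norm_le_one_of_conjTranspose_mul_self (segmentProd_unitary (registerBit x) (α := α) (a := 0)
        (M := S * M) fun j _ _ => hU j)) (by rw [hLJ, sub_self, norm_zero]) (hA' x)
    have h2 := norm_mul_le_of_le hJn
      (le_refl ‖V x - Uf * segmentProd (registerBit x) U α 0 (S * M)‖)
    have h3 : L * A x * J - J * V x = (L * A x * J - J * (Uf * segmentProd (registerBit x) U α 0 (S * M)))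
        - J * (V x - Uf * segmentProd (registerBit x) U α 0 (S * M)) := by
      rw [Matrix.mul_sub]; abel
    rw [h3]
    refine (norm_sub_le _ _).trans ?_
    have := hV x
    linarith

end Simulation

/-! ### Choice of the truncation order and of the segments -/

section Parameters

/-- `K` is the ceiling of 20 times the ratio, which is at most 21 times the ratio since the ratio is
at least 1. Then `K! ≥ (T/ε)^10`; one power turns `ε` into `T`, and the other nine exceed 1000
because `T/ε > e > 2.7`. -/
theorem exists_truncation {T ε : ℝ} (hT : 1 ≤ T) (hε : 0 < ε) (h : Real.exp 1 < T / ε) :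
    1 ≤ logRatio T ε ∧ ∃ K : ℕ, 1 ≤ K ∧ (K : ℝ) ≤ 21 * logRatio T ε ∧
      1000 * T / K.factorial ≤ ε := by
  have hx : 0 < T / ε := by positivity
  have hL : 1 < Real.log (T / ε) := by rwa [Real.lt_log_iff_exp_lt hx]
  have hy : 0 < Real.log (Real.log (T / ε)) := Real.log_pos hL
  have h1 : 1 ≤ logRatio T ε := by
    rw [logRatio, le_div_iff₀ hy]
    have := Real.log_le_sub_one_of_pos (show 0 < Real.log (T / ε) by linarith)
    linarith
  refine ⟨h1, ⌈20 * logRatio T ε⌉₊, ?_, ?_, ?_⟩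
  · rw [Nat.one_le_ceil_iff]; linarith
  · have := (Nat.ceil_lt_add_one (show 0 ≤ 20 * logRatio T ε by linarith)).le
    linarith
  · have h2 := exp_le_factorial hL (Nat.le_ceil (20 * logRatio T ε))
    set K := ⌈20 * logRatio T ε⌉₊
    have hf : (0 : ℝ) < K.factorial := by exact_mod_cast K.factorial_pos
    rw [div_le_iff₀ hf]
    refine le_trans ?_ (mul_le_mul_of_nonneg_left h2 hε.le)
    have h3 : Real.exp (10 * Real.log (T / ε)) = (T / ε) ^ 10 := by
      rw [show (10 : ℝ) * Real.log (T / ε) = ((10 : ℕ) : ℝ) * Real.log (T / ε) by norm_num,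
        Real.exp_nat_mul, Real.exp_log hx]
    rw [h3]
    have h4 : ε * (T / ε) ^ 10 = T * (T / ε) ^ 9 := by field_simp
    rw [h4]
    have h5 : (2.7 : ℝ) ≤ T / ε := by
      have := Real.exp_one_gt_d9; linarith
    have h6 : (2.7 : ℝ) ^ 9 ≤ (T / ε) ^ 9 := pow_le_pow_left₀ (by norm_num) h5 9
    have h7 : (1000 : ℝ) ≤ (T / ε) ^ 9 := le_trans (by norm_num) h6
    nlinarith

/-- With at least `4T` segments the total angle of a segment is at most `π/8 < 1/2`. -/
theorem isSegment_div {T : ℝ} (hT : 0 < T) {S M : ℕ} (hS : 4 * T ≤ S) (hM : 0 < M) :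
    IsSegment (T / (S * M : ℕ)) M where
  pos := by
    have : (0 : ℝ) < S := by linarith
    have : (0 : ℝ) < M := by exact_mod_cast hM
    push_cast; positivity
  pos' := hM
  le := by
    have h1 : (0 : ℝ) < S := by linarith
    have h2 : (0 : ℝ) < M := by exact_mod_cast hM
    have : M * stepAngle (T / (S * M : ℕ)) = Real.pi / 2 * (T / S) := by
      rw [stepAngle]; push_cast; field_simp
    rw [this]
    have h3 : T / S ≤ 1 / 4 := by rw [div_le_iff₀ h1]; linarith
    have h4 : 0 < T / S := by positivity
    nlinarith [Real.pi_le_four, Real.pi_pos]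

end Parameters

/-! ### Query complexity of fractional and continuous algorithms -/

section FractionalContinuous

variable {N : ℕ} {W : Type*} [Fintype W] [DecidableEq W]

/-- The number of queries does not depend on the number `M` of steps in a segment, so `M` is taken
so large that the discretization error is at most `ε/2`. At most `5T` segments, with `3 * K` queries
each and `K` at most 21 times the ratio, give the factor 315. -/
theorem discretelySimulable_of_approx {T ε : ℝ} (hT : 1 ≤ T) (hε : 0 < ε)
    (h : Real.exp 1 < T / ε)
    {V : (Fin N → Bool) → Matrix (Fin N × Bool × W) (Fin N × Bool × W) ℂ} {c : ℝ}
    (hV : ∀ n : ℕ, 0 < n → ∃ (U : ℕ → Matrix (Fin N × Bool × W) (Fin N × Bool × W) ℂ)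
      (Uf : Matrix (Fin N × Bool × W) (Fin N × Bool × W) ℂ),
      (∀ j, (U j).conjTranspose * U j = 1) ∧ Uf.conjTranspose * Uf = 1 ∧
      ∀ x, ‖V x - Uf * segmentProd (registerBit x) U (T / n) 0 n‖ ≤ c / n) :
    DiscretelySimulable V ε (315 * (T * logRatio T ε)) := by
  obtain ⟨h1, K, -, hK, hKf⟩ := exists_truncation hT hε h
  let S := ⌈4 * T⌉₊
  have hS : 4 * T ≤ S := Nat.le_ceil _
  have hS' : (S : ℝ) ≤ 5 * T := by
    have := (Nat.ceil_lt_add_one (show 0 ≤ 4 * T by linarith)).le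
    simp only [S]; linarith
  have hS0 : (1 : ℝ) ≤ S := by linarith
  obtain ⟨M, hM⟩ := exists_nat_gt (max (2 * c / ε) 0)
  have hM0 : (0 : ℝ) < M := (le_max_right _ _).trans_lt hM
  have hMc : 2 * c / ε < M := (le_max_left _ _).trans_lt hM
  have hM' : 0 < M := by exact_mod_cast hM0
  have hSM : 0 < S * M := Nat.mul_pos (by exact_mod_cast (by linarith : (0 : ℝ) < S)) hM'
  obtain ⟨U, Uf, hU, hUf, hA⟩ := hV (S * M) hSM
  refine discretelySimulable_segments hU hUf (isSegment_div (by linarith) hS hM') K S ?_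
    fun x => ?_
  · have := mul_le_mul hS' hK (Nat.cast_nonneg _) (by linarith)
    nlinarith
  · have hf : (0 : ℝ) < K.factorial := by exact_mod_cast K.factorial_pos
    have e1 : S * (16 / (K.factorial : ℝ)) ≤ ε / 2 := by
      have : S * (16 / (K.factorial : ℝ)) ≤ (5 * T) * (16 / (K.factorial : ℝ)) := by gcongr
      have e : (5 * T) * (16 / (K.factorial : ℝ)) = 80 / 1000 * (1000 * T / K.factorial) := by ring
      linarith
    have e2 : c / (S * M : ℕ) ≤ ε / 2 := by
      rw [div_le_iff₀ (by exact_mod_cast hSM)]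
      rw [div_lt_iff₀ hε] at hMc
      push_cast
      nlinarith [mul_le_mul_of_nonneg_right hS0 (mul_pos hM0 hε).le]
    linarith [hA x]

theorem fractionalQuery_unitary {β : Type*} [Fintype β] [DecidableEq β] (f : β → Bool) (α : ℝ) :
    (fractionalQuery f α).conjTranspose * fractionalQuery f α = 1 := by
  rw [fractionalQuery_eq_projRotation]
  exact conjTranspose_projRotation_mul (queryProj_mul_self f) (queryProj_isHermitian f) α

theorem norm_queryPhase_sub_le (a b : ℝ) : ‖queryPhase a - queryPhase b‖ ≤ Real.pi * |a - b| := by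
  have h1 : queryPhase a - queryPhase b = queryPhase b * (queryPhase (a - b) - 1) := by
    rw [mul_sub, ← queryPhase_add, mul_one]; congr 2; ring
  rw [h1, norm_mul, norm_queryPhase, one_mul]
  have h2 : queryPhase (a - b) = Complex.exp (Complex.I * ((-(Real.pi * (a - b)) : ℝ) : ℂ)) := by
    rw [queryPhase]; push_cast; ring_nf
  rw [h2]
  refine (Real.norm_exp_I_mul_ofReal_sub_one_le).trans ?_
  rw [norm_neg, norm_mul, Real.norm_of_nonneg Real.pi_pos.le, Real.norm_eq_abs]

theorem norm_fractionalQuery_sub_le {β : Type*} [Fintype β] [DecidableEq β] (f : β → Bool)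
    (a b : ℝ) : ‖fractionalQuery f a - fractionalQuery f b‖ ≤ Real.pi * |a - b| := by
  have : fractionalQuery f a - fractionalQuery f b = (queryPhase a - queryPhase b) • queryProj f := by
    rw [fractionalQuery_eq, fractionalQuery_eq, add_sub_add_left_eq_sub, ← sub_smul]
    congr 1; ring
  rw [this, norm_smul]
  exact (mul_le_of_le_one_right (norm_nonneg _) (norm_queryProj_le f)).trans
    (norm_queryPhase_sub_le a b)

theorem fractionalQuery_mul {β : Type*} [Fintype β] [DecidableEq β] (f : β → Bool) (a b : ℝ) :
    fractionalQuery f a * fractionalQuery f b = fractionalQuery f (a + b) := by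
  rw [fractionalQuery, fractionalQuery, fractionalQuery, Matrix.diagonal_mul_diagonal]
  congr 1; ext s
  rw [← Complex.exp_add]; push_cast; ring_nf

theorem fractionalQuery_zero {β : Type*} [Fintype β] [DecidableEq β] (f : β → Bool) :
    fractionalQuery f 0 = 1 := by
  rw [fractionalQuery_eq]; simp [queryPhase]

theorem segmentProd_const {β : Type*} [Fintype β] [DecidableEq β] (f : β → Bool)
    {U : ℕ → Matrix β β ℂ} {u : Matrix β β ℂ} (hu : u.conjTranspose * u = 1) (δ : ℝ) (a n : ℕ)
    (hU : ∀ j, a ≤ j → j < a + n → U j = u) :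
    segmentProd f U δ a n = u.conjTranspose * fractionalQuery f (n * δ) * u := by
  induction n with
  | zero => simp [segmentProd, timeProd, fractionalQuery_zero, hu]
  | succ n ih =>
    have ih := ih fun j h1 h2 => hU j h1 (by omega)
    rw [segmentProd, timeProd]
    rw [segmentProd] at ih
    rw [ih, hU _ (by omega) (by omega)]
    have hu' := mul_eq_one_comm.1 hu
    have : u.conjTranspose * fractionalQuery f δ * u *
        (u.conjTranspose * fractionalQuery f (n * δ) * u) = u.conjTranspose *
        (fractionalQuery f δ * (u * u.conjTranspose) * fractionalQuery f (n * δ)) * u := by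
      noncomm_ring
    rw [this, hu', mul_one, fractionalQuery_mul]
    congr 3; push_cast; ring

/-- The operator of a list of fractional queries and unitaries. -/
theorem exists_uniform_steps {X β : Type*} [Fintype β] [DecidableEq β] (f : X → β → Bool) {δ : ℝ}
    (hδ : 0 < δ) (u₀ : Matrix.unitaryGroup β ℂ) (l : List (ℝ × Matrix.unitaryGroup β ℂ))
    (hl : ∀ p ∈ l, 0 < p.1) :
    ∃ (n : ℕ) (U : ℕ → Matrix β β ℂ) (Uf : Matrix β β ℂ),
      (∀ j, (U j).conjTranspose * U j = 1) ∧ Uf.conjTranspose * Uf = 1 ∧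
      n * δ ≤ (l.map Prod.fst).sum ∧ (l.map Prod.fst).sum ≤ (n + l.length : ℕ) * δ ∧
      ∀ x, ‖l.foldl (fun M p => (p.2 : Matrix β β ℂ) * fractionalQuery (f x) p.1 * M)
        (u₀ : Matrix β β ℂ) - Uf * segmentProd (f x) U δ 0 n‖ ≤ l.length * (Real.pi * δ) := by
  induction l using List.reverseRecOn with
  | nil =>
    refine ⟨0, fun _ => 1, u₀, by simp, Matrix.mem_unitaryGroup_iff'.1 u₀.2, by simp, by simp,
      fun x => by simp [segmentProd, timeProd]⟩
  | append_singleton l p ih =>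
    obtain ⟨n, U, Uf, hU, hUf, h1, h2, h3⟩ := ih fun p hp => hl p (by simp [hp])
    have hp := hl p (by simp)
    have hpu : (p.2 : Matrix β β ℂ).conjTranspose * (p.2 : Matrix β β ℂ) = 1 :=
      Matrix.mem_unitaryGroup_iff'.1 p.2.2
    -- The exponent is rounded down to a multiple of `δ`, at a cost of at most `πδ`. The `k` new
    -- steps are conjugated by `Uf`, the product of the unitaries accumulated so far.
    let k := ⌊p.1 / δ⌋₊
    have hk1 : k * δ ≤ p.1 := by
      rw [← le_div_iff₀ hδ]; exact Nat.floor_le (by positivity)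
    have hk2 : p.1 ≤ (k + 1) * δ := by
      rw [← div_le_iff₀ hδ]; exact (Nat.lt_floor_add_one _).le
    refine ⟨n + k, fun j => if j < n then U j else Uf, p.2 * Uf, ?_, mul_unitary hpu hUf, ?_, ?_,
      fun x => ?_⟩
    · intro j; dsimp only; split_ifs
      exacts [hU j, hUf]
    · simp only [List.map_append, List.map_cons, List.map_nil, List.sum_append, List.sum_cons,
        List.sum_nil]
      push_cast; linarith
    · simp only [List.map_append, List.map_cons, List.map_nil, List.sum_append, List.sum_cons,
        List.sum_nil, List.length_append, List.length_cons, List.length_nil]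
      push_cast at h2 ⊢; linarith
    · have hUf' := mul_eq_one_comm.1 hUf
      have e1 : segmentProd (f x) (fun j => if j < n then U j else Uf) δ 0 n =
          segmentProd (f x) U δ 0 n := by
        refine timeProd_congr fun j _ hj => ?_
        simp only [if_pos (show j < n by omega)]
      have e2 := segmentProd_const (f x) (U := fun j => if j < n then U j else Uf) hUf δ (0 + n) k
        fun j hj _ => if_neg (by omega)
      rw [segmentProd_add, e1, e2, List.foldl_append, List.foldl_cons, List.foldl_nil]
      set E := l.foldl (fun M p => (p.2 : Matrix β β ℂ) * fractionalQuery (f x) p.1 * M)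
        (u₀ : Matrix β β ℂ)
      set Z := segmentProd (f x) U δ 0 n
      have e3 : (p.2 : Matrix β β ℂ) * fractionalQuery (f x) p.1 * E - p.2 * Uf *
          (Uf.conjTranspose * fractionalQuery (f x) (k * δ) * Uf * Z) =
          p.2 * fractionalQuery (f x) p.1 * (E - Uf * Z) + p.2 * (fractionalQuery (f x) p.1 -
            fractionalQuery (f x) (k * δ)) * (Uf * Z) := by
        have : (p.2 : Matrix β β ℂ) * Uf *
          (Uf.conjTranspose * fractionalQuery (f x) (k * δ) * Uf * Z) =
          p.2 * (Uf * Uf.conjTranspose) * fractionalQuery (f x) (k * δ) * Uf * Z := by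
            noncomm_ring
        rw [this, hUf']; noncomm_ring
      rw [e3]
      have n1 := norm_mul_le_of_le (norm_mul_le_of_le
        (norm_le_one_of_conjTranspose_mul_self hpu)
        (norm_le_one_of_conjTranspose_mul_self (fractionalQuery_unitary (f x) p.1))) (h3 x)
      have n2 : ‖fractionalQuery (f x) p.1 - fractionalQuery (f x) (k * δ)‖ ≤ Real.pi * δ := by
        refine (norm_fractionalQuery_sub_le _ _ _).trans ?_
        have : |p.1 - k * δ| ≤ δ := by rw [abs_le]; constructor <;> linarith
        gcongr
      have n3 := norm_mul_le_of_le (norm_mul_le_of_le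
        (norm_le_one_of_conjTranspose_mul_self hpu) n2)
        (norm_mul_le_of_le (norm_le_one_of_conjTranspose_mul_self hUf)
          (norm_le_one_of_conjTranspose_mul_self (segmentProd_unitary (f x) (α := δ) (a := 0)
            (M := n) fun j _ _ => hU j)))
      refine (norm_add_le _ _).trans ((add_le_add n1 n3).trans (le_of_eq ?_))
      simp only [List.length_append, List.length_cons, List.length_nil]
      push_cast; ring

/-- Rounding down yields `n ≤ m` steps and misses at most one step for each fractional query. The
product is padded to `m` steps with trivial conjugation; rounding and padding cost the same, whence
the factor 2 in `c`. -/
theorem fractional_simulable (A : FractionalAlgorithm (Fin N × Bool × W)) {T ε : ℝ} (hT : 1 ≤ T)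
    (hε : 0 < ε) (h : Real.exp 1 < T / ε) (hA : A.cost = T) :
    DiscretelySimulable (fun x => A.eval (registerBit x)) ε (315 * (T * logRatio T ε)) := by
  refine discretelySimulable_of_approx hT hε h (c := 2 * A.steps.length * Real.pi * T)
    fun m hm => ?_
  have hm' : (0 : ℝ) < m := by exact_mod_cast hm
  have hδ : 0 < T / m := by positivity
  obtain ⟨n, U, Uf, hU, hUf, h1, h2, h3⟩ := exists_uniform_steps
    (fun x => registerBit (N := N) (W := W) x) hδ A.init A.steps A.pos
  have hcost : (A.steps.map Prod.fst).sum = T := hA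
  rw [hcost] at h1 h2
  have hmT : T = m * (T / m) := by field_simp
  have hn : n ≤ m := by
    have : (n : ℝ) * (T / m) ≤ m * (T / m) := by linarith
    exact_mod_cast le_of_mul_le_mul_right this hδ
  have hn' : m ≤ n + A.steps.length := by
    have : (m : ℝ) * (T / m) ≤ (n + A.steps.length : ℕ) * (T / m) := by linarith
    exact_mod_cast le_of_mul_le_mul_right this hδ
  refine ⟨fun j => if j < n then U j else 1, Uf, ?_, hUf, fun x => ?_⟩
  · intro j; dsimp only; split_ifs
    exacts [hU j, by simp]
  · have e1 : segmentProd (registerBit x) (fun j => if j < n then U j else 1) (T / m) 0 n =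
        segmentProd (registerBit x) U (T / m) 0 n := by
      refine timeProd_congr fun j _ hj => ?_
      simp only [if_pos (show j < n by omega)]
    have e2 := segmentProd_const (registerBit x) (U := fun j => if j < n then U j else 1) (u := 1)
      (by simp) (T / m) (0 + n) (m - n) fun j hj _ => if_neg (by omega)
    rw [Matrix.conjTranspose_one, Matrix.one_mul, Matrix.mul_one] at e2
    have e3 := segmentProd_add (registerBit x) (fun j => if j < n then U j else 1) (T / m) 0 n (m - n)
    rw [Nat.add_sub_cancel' hn, e1, e2] at e3
    rw [e3]
    set Z := segmentProd (registerBit x) U (T / m) 0 n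
    set F := fractionalQuery (registerBit (W := W) x) ((m - n : ℕ) * (T / m))
    have n1 : ‖(1 : Matrix (Fin N × Bool × W) (Fin N × Bool × W) ℂ) - F‖ ≤
        A.steps.length * (Real.pi * (T / m)) := by
      rw [← fractionalQuery_zero (registerBit x)]
      refine (norm_fractionalQuery_sub_le _ _ _).trans ?_
      rw [zero_sub, abs_neg, abs_of_nonneg (by positivity)]
      have : ((m - n : ℕ) : ℝ) ≤ A.steps.length := by exact_mod_cast (by omega)
      calc Real.pi * (((m - n : ℕ) : ℝ) * (T / m)) ≤ Real.pi * (A.steps.length * (T / m)) := by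
            gcongr
        _ = _ := by ring
    have n2 := norm_mul_le_of_le (norm_mul_le_of_le
      (norm_le_one_of_conjTranspose_mul_self hUf) n1)
      (norm_le_one_of_conjTranspose_mul_self (segmentProd_unitary (registerBit x) (α := T / m)
        (a := 0) (M := n) fun j _ _ => hU j))
    have e4 : A.eval (registerBit x) - Uf * (F * Z) =
        (A.eval (registerBit x) - Uf * Z) + Uf * (1 - F) * Z := by noncomm_ring
    rw [e4]
    refine (norm_add_le _ _).trans ((add_le_add (h3 x) n2).trans (le_of_eq ?_))
    ring

/-- On an input for which the query Hamiltonian vanishes, the given evolution is that of the driving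
alone. -/
theorem exists_driving_solution {β : Type*} [Fintype β] [DecidableEq β] {f : β → Bool}
    (hf : ∀ s, f s = false) {T : ℝ} (hT : 0 ≤ T) {HD : ℝ → Matrix β β ℂ} {V : Matrix β β ℂ}
    (hV : ContinuousImplements f T HD V) : ∃ U, IsSolution HD 0 T U ∧ U 0 = 1 := by
  obtain ⟨U, hU, h0, -⟩ := IsEvolution.exists_isSolution hT hV
  refine ⟨U, ?_, h0⟩
  have : queryHamiltonian f = 0 := by
    rw [queryHamiltonian_eq, queryProj]; simp [hf]
  simpa [this] using hU

theorem continuous_simulable {T ε : ℝ} (hT : 1 ≤ T) (hε : 0 < ε) (h : Real.exp 1 < T / ε)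
    {HD : ℝ → Matrix (Fin N × Bool × W) (Fin N × Bool × W) ℂ}
    {V : (Fin N → Bool) → Matrix (Fin N × Bool × W) (Fin N × Bool × W) ℂ} (hD : IsDriving T HD)
    (hV : ∀ x, ContinuousImplements (registerBit x) T HD (V x)) :
    DiscretelySimulable V ε (315 * (T * logRatio T ε)) := by
  have hT0 : 0 ≤ T := by linarith
  obtain ⟨U, hU, hU0⟩ := exists_driving_solution (f := registerBit fun _ => false)
    (fun s => by simp [registerBit]) hT0 (hV _)
  have hu : ∀ t ∈ Set.Icc 0 T, (U t).conjTranspose * U t = 1 := fun t ht =>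
    hU.conjTranspose_mul_self hD.1 hD.2 hU0 ht
  refine discretelySimulable_of_approx hT hε h (c := 2 * Real.pi * T * ∫ t in (0 : ℝ)..T, ‖HD t‖)
    -- The value 1 beyond the last step only serves to make all `U j` unitary.
    fun m hm => ⟨fun j => if j < m then U (j * (T / m)) else 1, U T, ?_, hu T ⟨hT0, le_rfl⟩,
      fun x => ?_⟩
  · intro j; dsimp only; split_ifs with hj
    · refine hu _ ⟨by positivity, ?_⟩
      have hm' : (0 : ℝ) < m := by exact_mod_cast hm
      have : (j : ℝ) ≤ m := by exact_mod_cast hj.le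
      rw [mul_div_assoc', div_le_iff₀ hm']; nlinarith
    · simp
  · have h1 := norm_continuous_sub_timeProd_le hT0 hD hU hU0 (hV x) hm
    have e1 : segmentProd (registerBit x) (fun j => if j < m then U (j * (T / m)) else 1) (T / m) 0 m
        = timeProd (fun j : ℕ => (U (j * (T / m))).conjTranspose *
      fractionalQuery (registerBit x) (T / m) * U (j * (T / m))) 0 m :=
      timeProd_congr fun j _ hj => by simp only [if_pos (show j < m by omega)]
    rw [e1]
    refine h1.trans (le_of_eq ?_)
    ring

end FractionalContinuous

/-! ### Operators acting on one factor under the control of the other -/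

section Local

variable {B L O : Type*} [Fintype B] [DecidableEq B] [Fintype L] [DecidableEq L] [Fintype O]
  [DecidableEq O]

/-- The operator that acts on the factor `L` by `M o`, controlled by the basis state `o` of the
factor `O`. -/
def locally (e : B ≃ L × O) (M : O → Matrix L L ℂ) : Matrix B B ℂ :=
  (Matrix.blockDiagonal M).submatrix e e

theorem locally_apply (e : B ≃ L × O) (M : O → Matrix L L ℂ) (s t : B) :
    locally e M s t = if (e s).2 = (e t).2 then M (e s).2 (e s).1 (e t).1 else 0 := by
  rw [locally, Matrix.submatrix_apply, Matrix.blockDiagonal_apply]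

theorem locally_mul (e : B ≃ L × O) (M N : O → Matrix L L ℂ) :
    locally e M * locally e N = locally e fun o => M o * N o := by
  rw [locally, locally, locally, Matrix.submatrix_mul_equiv, ← Matrix.blockDiagonal_mul]

theorem conjTranspose_locally (e : B ≃ L × O) (M : O → Matrix L L ℂ) :
    (locally e M).conjTranspose = locally e fun o => (M o).conjTranspose := by
  rw [locally, locally, Matrix.conjTranspose_submatrix, Matrix.blockDiagonal_conjTranspose]

theorem locally_diagonal (e : B ≃ L × O) (d : O → L → ℂ) :
    locally e (fun o => Matrix.diagonal (d o)) = Matrix.diagonal fun s => d (e s).2 (e s).1 := by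
  rw [locally, Matrix.blockDiagonal_diagonal, Matrix.submatrix_diagonal_equiv]
  rfl

theorem locally_one (e : B ≃ L × O) : locally e (fun _ => (1 : Matrix L L ℂ)) = 1 := by
  have := locally_diagonal e fun _ _ => (1 : ℂ)
  simpa using this

theorem locally_unitary (e : B ≃ L × O) {M : O → Matrix L L ℂ}
    (h : ∀ o, (M o).conjTranspose * M o = 1) :
    (locally e M).conjTranspose * locally e M = 1 := by
  rw [conjTranspose_locally, locally_mul]
  simp only [h, locally_one]

/-- The inclusion of the block `o`. -/
def blockCol (e : B ≃ L × O) (o : O) : Matrix B L ℂ := fun s u => if e s = (u, o) then 1 else 0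

theorem blockCol_mul_apply {C : Type*} (e : B ≃ L × O) (o : O) (A : Matrix L C ℂ) (s : B) (t : C) :
    (blockCol e o * A) s t = if (e s).2 = o then A (e s).1 t else 0 := by
  rw [Matrix.mul_apply, Finset.sum_eq_single (e s).1]
  · simp only [blockCol, Prod.ext_iff]; simp
  · intro b _ hb; simp [blockCol, Prod.ext_iff, Ne.symm hb]
  · simp

theorem locally_mul_blockCol (e : B ≃ L × O) (M : O → Matrix L L ℂ) (o : O) :
    locally e M * blockCol e o = blockCol e o * M o := by
  ext s t
  rw [blockCol_mul_apply, Matrix.mul_apply, Finset.sum_eq_single (e.symm (t, o))]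
  · rw [locally_apply]
    simp only [blockCol, Equiv.apply_symm_apply, if_true, mul_one]
    split_ifs with h
    · rw [h]
    · rfl
  · intro b _ hb
    rw [blockCol, if_neg, mul_zero]
    rwa [← Equiv.eq_symm_apply]
  · simp

theorem conjTranspose_blockCol_mul (e : B ≃ L × O) (o : O) :
    (blockCol e o).conjTranspose * blockCol e o = 1 := by
  ext s t
  rw [Matrix.mul_apply, Finset.sum_eq_single (e.symm (s, o))]
  · simp [blockCol, Matrix.conjTranspose_apply, Matrix.one_apply]
  · intro b _ hb
    rw [Matrix.conjTranspose_apply, blockCol, if_neg, star_zero, zero_mul]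
    rwa [← Equiv.eq_symm_apply]
  · simp

end Local

/-! ### Permutation matrices -/

section Permutations

variable {I : Type*} [Fintype I] [DecidableEq I]

theorem permMat_mul (σ τ : Equiv.Perm I) : permMat σ * permMat τ = permMat (σ * τ) := by
  ext s t
  rw [Matrix.mul_apply, Finset.sum_eq_single (τ t)]
  · by_cases h : s = σ (τ t) <;> simp [permMat, h]
  · intro b _ hb; simp [permMat, hb]
  · simp

theorem permMat_one : permMat (1 : Equiv.Perm I) = 1 := by
  ext s t; by_cases h : s = t <;> simp [permMat, Matrix.one_apply, h]

theorem permMat_unitary (σ : Equiv.Perm I) : (permMat σ).conjTranspose * permMat σ = 1 := by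
  have := conjTranspose_permMat_mul σ fun _ => 1
  rw [Matrix.diagonal_one, mul_one] at this
  exact this.trans Matrix.diagonal_one

theorem permMat_mul_apply {C : Type*} (σ : Equiv.Perm I) (A : Matrix I C ℂ) (s : I) (t : C) :
    (permMat σ * A) s t = A (σ.symm s) t := by
  rw [Matrix.mul_apply, Finset.sum_eq_single (σ.symm s)]
  · simp [permMat]
  · intro b _ hb
    rw [permMat, if_neg, zero_mul]
    rwa [← Equiv.symm_apply_eq, eq_comm]
  · simp

end Permutations

/-! ### Circuits and their costs -/

section Wires

variable {Q : Type*} [Fintype Q] [DecidableEq Q]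

/-- The basis states of one wire and of the others. -/
def wireEquiv (c : Q) : (Q → Bool) ≃ Bool × ({k // k ≠ c} → Bool) where
  toFun s := (s c, fun k => s k)
  invFun p k := if h : k = c then p.1 else p.2 ⟨k, h⟩
  left_inv s := by ext k; by_cases h : k = c <;> simp [h]
  right_inv p := by
    refine Prod.ext (by simp) (funext fun k => ?_)
    simp [k.2]

/-- The basis states of two wires and of the others. -/
def pairEquiv {a b : Q} (hab : a ≠ b) :
    (Q → Bool) ≃ (Bool × Bool) × ({k // k ≠ a ∧ k ≠ b} → Bool) where
  toFun s := ((s a, s b), fun k => s k)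
  invFun p k := if h : k ≠ a ∧ k ≠ b then p.2 ⟨k, h⟩ else if k = a then p.1.1 else p.1.2
  left_inv s := by
    ext k
    by_cases h : k = a
    · simp [h]
    · by_cases h' : k = b <;> simp [h, h', hab.symm]
  right_inv p := by
    refine Prod.ext (by simp [hab.symm]) (funext fun k => ?_)
    simp [k.2.1, k.2.2]

/-- The wires outside the range of `ι`. -/
@[ext]
structure OffWire {W : Type*} (ι : W ↪ Q) where
  wire : Q
  notMem : wire ∉ Set.range ι

noncomputable instance {W : Type*} (ι : W ↪ Q) : Fintype (OffWire ι) :=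
  Fintype.ofInjective OffWire.wire fun _ _ h => OffWire.ext h

instance {W : Type*} (ι : W ↪ Q) : DecidableEq (OffWire ι) := fun a b =>
  decidable_of_iff (a.wire = b.wire) OffWire.ext_iff.symm

open scoped Classical in
/-- The basis states of a set of wires and of the others. -/
noncomputable def embEquiv {W : Type*} (ι : W ↪ Q) :
    (Q → Bool) ≃ (W → Bool) × (OffWire ι → Bool) where
  toFun s := (fun i => s (ι i), fun k => s k.wire)
  invFun p k := if h : k ∈ Set.range ι then p.1 h.choose else p.2 ⟨k, h⟩
  left_inv s := by
    ext k
    by_cases h : k ∈ Set.range ι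
    · have := h.choose_spec
      simp only [h, dif_pos, this]
    · simp only [h, dif_neg, not_false_eq_true]
  right_inv p := by
    refine Prod.ext (funext fun i => ?_) (funext fun k => ?_)
    · have h : ι i ∈ Set.range ι := ⟨i, rfl⟩
      simp only [h, dif_pos]
      exact congrArg p.1 (ι.injective h.choose_spec)
    · simp only [k.notMem, dif_neg, not_false_eq_true]

theorem toMatrix_eq_locally (G : TwoQubitGate Q) :
    G.toMatrix = locally (pairEquiv G.ne)
      fun _ => (G.gate : Matrix (Bool × Bool) (Bool × Bool) ℂ) := by
  ext s t
  rw [locally_apply, TwoQubitGate.toMatrix]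
  have : (∀ k, k ≠ G.fst → k ≠ G.snd → s k = t k) ↔
      ((pairEquiv G.ne) s).2 = ((pairEquiv G.ne) t).2 :=
    ⟨fun h => funext fun k => h k k.2.1 k.2.2, fun h k h1 h2 => congrFun h ⟨k, h1, h2⟩⟩
  simp only [this]
  rfl

variable {n : ℕ}

theorem evalCircuit_foldl (x : (Fin n → Bool) → Bool) (K : List (Gate Q n))
    (A : Matrix (Q → Bool) (Q → Bool) ℂ) :
    K.foldl (fun M G => G.toMatrix x * M) A = evalCircuit x K * A := by
  induction K generalizing A with
  | nil => simp [evalCircuit]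
  | cons G K ih =>
    rw [evalCircuit, List.foldl_cons, List.foldl_cons, ih, ih (G.toMatrix x * 1), mul_one, mul_assoc]

theorem evalCircuit_append (x : (Fin n → Bool) → Bool) (K L : List (Gate Q n)) :
    evalCircuit x (K ++ L) = evalCircuit x L * evalCircuit x K := by
  rw [evalCircuit, List.foldl_append, evalCircuit_foldl]
  rfl

theorem evalCircuit_cons (x : (Fin n → Bool) → Bool) (G : Gate Q n) (K : List (Gate Q n)) :
    evalCircuit x (G :: K) = evalCircuit x K * G.toMatrix x := by
  rw [evalCircuit, List.foldl_cons, evalCircuit_foldl, mul_one]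

/-- The family of operators `M x` is performed by a circuit with at most `q` queries and at most `g`
two-qubit gates. -/
def HasCircuit (n q g : ℕ) (M : ((Fin n → Bool) → Bool) → Matrix (Q → Bool) (Q → Bool) ℂ) : Prop :=
  ∃ K : List (Gate Q n), queryCount K ≤ q ∧ gateCount K ≤ g ∧ ∀ x, evalCircuit x K = M x

namespace HasCircuit

variable {q q' g g' : ℕ} {M N : ((Fin n → Bool) → Bool) → Matrix (Q → Bool) (Q → Bool) ℂ}

theorem mono (h : HasCircuit n q g M) (hq : q ≤ q') (hg : g ≤ g') : HasCircuit n q' g' M := by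
  obtain ⟨K, h1, h2, h3⟩ := h
  exact ⟨K, h1.trans hq, h2.trans hg, h3⟩

theorem congr (h : HasCircuit n q g M) (e : ∀ x, M x = N x) : HasCircuit n q g N := by
  obtain ⟨K, h1, h2, h3⟩ := h
  exact ⟨K, h1, h2, fun x => (h3 x).trans (e x)⟩

theorem one : HasCircuit (Q := Q) n 0 0 fun _ => 1 :=
  ⟨[], le_rfl, le_rfl, fun _ => rfl⟩

theorem mul (hM : HasCircuit n q g M) (hN : HasCircuit n q' g' N) :
    HasCircuit n (q + q') (g + g') fun x => M x * N x := by
  obtain ⟨K, h1, h2, h3⟩ := hM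
  obtain ⟨L, h1', h2', h3'⟩ := hN
  refine ⟨L ++ K, ?_, ?_, fun x => by rw [evalCircuit_append, h3, h3']⟩
  · rw [queryCount, List.countP_append]
    rw [queryCount] at h1 h1'; omega
  · rw [gateCount, List.countP_append]
    rw [gateCount] at h2 h2'; omega

theorem gate (G : TwoQubitGate Q) : HasCircuit n 0 1 fun _ => G.toMatrix :=
  ⟨[.twoQubit G], by simp [queryCount, Gate.isQuery], by simp [gateCount, Gate.isQuery],
    fun x => by simp [evalCircuit, Gate.toMatrix]⟩

theorem query (e : Fin n ⊕ Unit ↪ Q) :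
    HasCircuit n 1 0 fun x => discreteQuery (wireBit e x) :=
  ⟨[.query e], by simp [queryCount, Gate.isQuery], by simp [gateCount, Gate.isQuery],
    fun x => by simp [evalCircuit, Gate.toMatrix]⟩

theorem unitary (h : HasCircuit n q g M) (x : (Fin n → Bool) → Bool) :
    (M x).conjTranspose * M x = 1 := by
  obtain ⟨K, -, -, h3⟩ := h
  rw [← h3]
  clear h3
  induction K with
  | nil => simp [evalCircuit]
  | cons G K ih =>
    rw [evalCircuit_cons]
    refine mul_unitary ih ?_
    cases G with
    | twoQubit G =>
      rw [Gate.toMatrix, toMatrix_eq_locally]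
      exact locally_unitary _ fun _ => Matrix.mem_unitaryGroup_iff'.1 G.gate.2
    | query e => rw [Gate.toMatrix, conjTranspose_discreteQuery, discreteQuery_mul_self]

theorem conjTranspose (h : HasCircuit n q g M) :
    HasCircuit n q g fun x => (M x).conjTranspose := by
  obtain ⟨K, h1, h2, h3⟩ := h
  suffices ∃ L : List (Gate Q n), queryCount L = queryCount K ∧ gateCount L = gateCount K ∧
      ∀ x, evalCircuit x L = (evalCircuit x K).conjTranspose by
    obtain ⟨L, e1, e2, e3⟩ := this
    exact ⟨L, e1.trans_le h1, e2.trans_le h2, fun x => by rw [e3, h3]⟩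
  clear h1 h2 h3
  induction K with
  | nil => exact ⟨[], rfl, rfl, fun x => by simp [evalCircuit]⟩
  | cons G K ih =>
    obtain ⟨L, e1, e2, e3⟩ := ih
    obtain ⟨G', hG, hG'⟩ : ∃ G' : Gate Q n, G'.isQuery = G.isQuery ∧
        ∀ x, G'.toMatrix x = (G.toMatrix x).conjTranspose := by
      cases G with
      | twoQubit G =>
        refine ⟨.twoQubit ⟨G.fst, G.snd, G.ne, G.gate⁻¹⟩, rfl, fun x => ?_⟩
        rw [Gate.toMatrix, Gate.toMatrix, toMatrix_eq_locally, toMatrix_eq_locally,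
          conjTranspose_locally]
        rfl
      | query e => exact ⟨.query e, rfl, fun x => by
          rw [Gate.toMatrix, conjTranspose_discreteQuery]⟩
    refine ⟨L ++ [G'], ?_, ?_, fun x => ?_⟩
    · simp only [queryCount, List.countP_append, List.countP_cons, List.countP_nil, hG, zero_add] at e1 ⊢
      rw [e1]
    · simp only [gateCount, List.countP_append, List.countP_cons, List.countP_nil, hG, zero_add] at e2 ⊢
      rw [e2]
    · rw [evalCircuit_append, evalCircuit_cons, e3, evalCircuit_cons, hG',
        Matrix.conjTranspose_mul]
      simp [evalCircuit]

theorem timeProd {A : ℕ → ((Fin n → Bool) → Bool) → Matrix (Q → Bool) (Q → Bool) ℂ} (m a : ℕ)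
    (h : ∀ i, a ≤ i → i < a + m → HasCircuit n q g (A i)) :
    HasCircuit n (m * q) (m * g) fun x => timeProd (fun i => A i x) a m := by
  induction m with
  | zero => simpa [QuerySim.timeProd] using HasCircuit.one
  | succ m ih =>
    have := (h (a + m) (by omega) (by omega)).mul (ih fun i h1 h2 => h i h1 (by omega))
    refine this.mono ?_ ?_ <;> rw [Nat.succ_mul, add_comm]

theorem amplify {φ : (Q → Bool) → Bool} (hW : HasCircuit n q g M)
    (hR : HasCircuit n 0 g' fun _ =>
      1 - (2 : ℂ) • Matrix.diagonal fun s : Q → Bool => if φ s then (1 : ℂ) else 0)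
    (hneg : HasCircuit (Q := Q) n 0 1 fun _ => -1) :
    HasCircuit n (3 * q) (3 * g + 2 * g' + 1) fun x =>
      amplify (M x) (Matrix.diagonal fun s : Q → Bool => if φ s then (1 : ℂ) else 0) := by
  have := hneg.mul ((((hW.mul hR).mul hW.conjTranspose).mul hR).mul hW)
  simp only [neg_mul, one_mul] at this
  exact this.mono (by omega) (by omega)

theorem submatrix_embedding {W : Type*} [Fintype W] [DecidableEq W] (ι : W ↪ Q)
    (D : List (TwoQubitGate W)) :
    HasCircuit n 0 D.length fun _ => locally (embEquiv ι) fun _ => evalGates D := by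
  induction D using List.reverseRecOn with
  | nil =>
    exact HasCircuit.one.congr fun x => (locally_one _).symm
  | append_singleton D G ih =>
    have hG := (HasCircuit.gate (n := n)
      (⟨ι G.fst, ι G.snd, fun h => G.ne (ι.injective h), G.gate⟩ : TwoQubitGate Q)).mul ih
    have e : (⟨ι G.fst, ι G.snd, fun h => G.ne (ι.injective h), G.gate⟩ : TwoQubitGate Q).toMatrix =
        locally (embEquiv ι) fun _ => G.toMatrix := by
      ext s t
      rw [locally_apply]
      simp only [TwoQubitGate.toMatrix]
      by_cases h : ((embEquiv ι) s).2 = ((embEquiv ι) t).2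
      · rw [if_pos h]
        have : (∀ k, k ≠ ι G.fst → k ≠ ι G.snd → s k = t k) ↔
            ∀ k, k ≠ G.fst → k ≠ G.snd → ((embEquiv ι) s).1 k = ((embEquiv ι) t).1 k := by
          constructor
          · intro h1 k h2 h3
            exact h1 (ι k) (fun h => h2 (ι.injective h)) fun h => h3 (ι.injective h)
          · intro h1 k h2 h3
            by_cases hk : k ∈ Set.range ι
            · obtain ⟨k, rfl⟩ := hk
              exact h1 k (fun h => h2 (congrArg ι h)) fun h => h3 (congrArg ι h)
            · exact congrFun h ⟨k, hk⟩
        simp only [this]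
        rfl
      · rw [if_neg h, if_neg]
        intro h1
        refine h (funext fun k => h1 k.wire ?_ ?_)
        · intro hk; exact k.notMem ⟨_, hk.symm⟩
        · intro hk; exact k.notMem ⟨_, hk.symm⟩
    rw [e] at hG
    simp only [locally_mul] at hG
    have e2 : evalGates (D ++ [G]) = G.toMatrix * evalGates D := by
      rw [evalGates, List.foldl_append]; rfl
    rw [e2]
    exact hG.mono (by omega) (by simp [add_comm])

end HasCircuit

end Wires

/-! ### Classical reversible gates from two-qubit gates -/

section Flips

variable {Q : Type*} [Fintype Q] [DecidableEq Q] {n g g' : ℕ}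

open HasCircuit

theorem HasCircuit.diagonal_pair {a b : Q} (hab : a ≠ b) {z : Bool → Bool → ℂ}
    (hz : ∀ i j, star (z i j) * z i j = 1) :
    HasCircuit n 0 1 fun _ => Matrix.diagonal fun s : Q → Bool => z (s a) (s b) := by
  have hu : (Matrix.diagonal fun p : Bool × Bool => z p.1 p.2) ∈
      Matrix.unitaryGroup (Bool × Bool) ℂ := by
    rw [Matrix.mem_unitaryGroup_iff', Matrix.star_eq_conjTranspose, Matrix.diagonal_conjTranspose,
      Matrix.diagonal_mul_diagonal, ← Matrix.diagonal_one]
    congr 1; funext p; exact hz _ _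
  have := HasCircuit.gate (n := n) (⟨a, b, hab, ⟨_, hu⟩⟩ : TwoQubitGate Q)
  rw [toMatrix_eq_locally] at this
  simp only [locally_diagonal] at this
  exact this

theorem HasCircuit.diagonal_single [Nontrivial Q] (a : Q) {z : Bool → ℂ}
    (hz : ∀ i, star (z i) * z i = 1) :
    HasCircuit n 0 1 fun _ => Matrix.diagonal fun s : Q → Bool => z (s a) := by
  obtain ⟨b, hb⟩ := exists_ne a
  exact HasCircuit.diagonal_pair hb.symm (z := fun i _ => z i) fun i _ => hz i

theorem HasCircuit.neg_one [Nontrivial Q] : HasCircuit (Q := Q) n 0 1 fun _ => -1 := by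
  obtain ⟨a, -, -⟩ := exists_pair_ne Q
  have := HasCircuit.diagonal_single (n := n) a (z := fun _ => -1) (by simp)
  refine this.congr fun x => ?_
  rw [← Matrix.diagonal_one, Matrix.diagonal_neg]

/-- A unitary on one wire. -/
theorem HasCircuit.oneQubit [Nontrivial Q] (a : Q) {u : Matrix Bool Bool ℂ}
    (hu : u.conjTranspose * u = 1) : HasCircuit n 0 1 fun _ => locally (wireEquiv a) fun _ => u := by
  obtain ⟨b, hb⟩ := exists_ne a
  have hu' : Matrix.blockDiagonal (fun _ : Bool => u) ∈ Matrix.unitaryGroup (Bool × Bool) ℂ := by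
    rw [Matrix.mem_unitaryGroup_iff']
    exact blockDiagonal_unitary fun _ => hu
  have := HasCircuit.gate (n := n) (⟨a, b, hb.symm, ⟨_, hu'⟩⟩ : TwoQubitGate Q)
  refine this.congr fun x => ?_
  ext s t
  rw [locally_apply]
  simp only [TwoQubitGate.toMatrix, Matrix.blockDiagonal_apply]
  by_cases h : ((wireEquiv a) s).2 = ((wireEquiv a) t).2
  · have h' : ∀ k, k ≠ a → s k = t k := fun k hk => congrFun h ⟨k, hk⟩
    rw [if_pos h, if_pos fun k hk _ => h' k hk, if_pos (h' b hb)]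
    rfl
  · rw [if_neg h]
    by_cases h1 : ∀ k, k ≠ a → k ≠ b → s k = t k
    · rw [if_pos h1, if_neg]
      intro h2
      refine h (funext fun k => ?_)
      by_cases hk : (k : Q) = b
      · show s k = t k
        rw [hk, h2]
      · exact h1 k k.2 hk
    · rw [if_neg h1]

/-- The permutation that flips the wire `c` if `φ` holds; `φ` is evaluated with `c` set to zero. -/
def flipPerm (c : Q) (φ : (Q → Bool) → Bool) : Equiv.Perm (Q → Bool) :=
  Function.Involutive.toPerm
    (fun s => Function.update s c (s c ^^ φ (Function.update s c false))) fun s => by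
      simp

theorem flipPerm_apply (c : Q) (φ : (Q → Bool) → Bool) (s : Q → Bool) :
    flipPerm c φ s = Function.update s c (s c ^^ φ (Function.update s c false)) := rfl

/-- The control function never sees the wire that it flips, so successive flips add their controls
modulo 2. Any control written as a sum of known ones is thereby available. -/
theorem flipPerm_mul (c : Q) (φ ψ : (Q → Bool) → Bool) :
    flipPerm c φ * flipPerm c ψ = flipPerm c fun s => φ s ^^ ψ s := by
  ext s k
  rw [Equiv.Perm.mul_apply]
  simp only [flipPerm_apply, Function.update_idem, Function.update_self]
  congr 1
  rw [Bool.xor_assoc, Bool.xor_comm (ψ _)]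

/-- The flip of the wire `c` controlled by `φ` has a circuit of at most `g` gates. -/
def HasFlip (n g : ℕ) (c : Q) (φ : (Q → Bool) → Bool) : Prop :=
  HasCircuit n 0 g fun _ => permMat (flipPerm c φ)

theorem HasFlip.mono {c : Q} {φ : (Q → Bool) → Bool} (h : HasFlip n g c φ) (hg : g ≤ g') :
    HasFlip n g' c φ := HasCircuit.mono h le_rfl hg

theorem HasFlip.xor {c : Q} {φ ψ : (Q → Bool) → Bool} (h : HasFlip n g c φ)
    (h' : HasFlip n g' c ψ) : HasFlip n (g + g') c fun s => φ s ^^ ψ s := by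
  have := HasCircuit.mul h h'
  simp only [permMat_mul, flipPerm_mul] at this
  exact this

/-- The Hadamard gate. -/
noncomputable def hadamard : Matrix Bool Bool ℂ :=
  fun a b => (√2 : ℂ)⁻¹ * if a && b then -1 else 1

theorem sqrt_two_inv_mul_self : ((√2 : ℝ) : ℂ)⁻¹ * ((√2 : ℝ) : ℂ)⁻¹ = 1 / 2 := by
  rw [← mul_inv, ← Complex.ofReal_mul, Real.mul_self_sqrt (by norm_num)]
  norm_num

theorem hadamard_mul_diagonal_mul (v : Bool) :
    hadamard * Matrix.diagonal (fun a : Bool => if a && v then (-1 : ℂ) else 1) * hadamard =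
      Matrix.of fun a b => if a = (b ^^ v) then 1 else 0 := by
  have h := sqrt_two_inv_mul_self
  set r := ((√2 : ℝ) : ℂ)⁻¹ with hr
  ext a b
  rw [Matrix.mul_apply]
  simp only [Matrix.mul_diagonal, hadamard, Fintype.sum_bool, ← hr, Matrix.of_apply]
  cases a <;> cases b <;> cases v <;> simp <;> linear_combination (2 : ℂ) * h

theorem conjTranspose_hadamard : hadamard.conjTranspose = hadamard := by
  ext a b
  rw [Matrix.conjTranspose_apply, hadamard, hadamard]
  cases a <;> cases b <;> simp

theorem hadamard_unitary : hadamard.conjTranspose * hadamard = 1 := by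
  have := hadamard_mul_diagonal_mul false
  simp only [Bool.and_false, Bool.xor_false] at this
  rw [conjTranspose_hadamard]
  have e : (Matrix.diagonal fun _ : Bool => if false = true then (-1 : ℂ) else 1) = 1 := by simp
  rw [e, mul_one] at this
  rw [this]
  ext a b; simp [Matrix.one_apply]

/-- Hadamard gates on the target turn a controlled sign into a controlled flip, at the cost of two
more gates. -/
theorem HasFlip.of_diagonal [Nontrivial Q] {c : Q} {φ : (Q → Bool) → Bool}
    (h : HasCircuit n 0 g fun _ => Matrix.diagonal fun s : Q → Bool =>
      if s c && φ (Function.update s c false) then (-1 : ℂ) else 1) : HasFlip n (g + 2) c φ := by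
  have hH := HasCircuit.oneQubit (n := n) c hadamard_unitary
  have key := (hH.mul h).mul hH
  have hφ : ∀ s, φ (Function.update s c false) =
      φ ((wireEquiv c).symm (false, ((wireEquiv c) s).2)) := by
    intro s
    congr 1
    rw [Equiv.eq_symm_apply]
    refine Prod.ext (by simp [wireEquiv]) (funext fun k => ?_)
    simp [wireEquiv, Function.update_of_ne k.2]
  have e : (Matrix.diagonal fun s : Q → Bool =>
      if s c && φ (Function.update s c false) then (-1 : ℂ) else 1) =
      locally (wireEquiv c) fun o => Matrix.diagonal fun a : Bool =>
        if a && φ ((wireEquiv c).symm (false, o)) then (-1 : ℂ) else 1 := by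
    rw [locally_diagonal]
    congr 1; funext s
    rw [hφ]; rfl
  simp only [e, locally_mul, hadamard_mul_diagonal_mul] at key
  refine (key.mono le_rfl (show 1 + g + 1 ≤ g + 2 by omega)).congr fun x => ?_
  ext s t
  rw [locally_apply, permMat, flipPerm_apply, hφ]
  have : (s = Function.update t c (t c ^^ φ ((wireEquiv c).symm (false, ((wireEquiv c) t).2)))) ↔
      ((wireEquiv c) s).2 = ((wireEquiv c) t).2 ∧
        s c = (t c ^^ φ ((wireEquiv c).symm (false, ((wireEquiv c) t).2))) := by
    constructor
    · intro h
      constructor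
      · rw [h]; funext k; simp [wireEquiv, Function.update_of_ne k.2]
      · conv_lhs => rw [h]
        rw [Function.update_self]
    · rintro ⟨h1, h2⟩
      funext k
      by_cases hk : k = c
      · subst hk; rw [Function.update_self]; exact h2
      · rw [Function.update_of_ne hk]; exact congrFun h1 ⟨k, hk⟩
  by_cases h : ((wireEquiv c) s).2 = ((wireEquiv c) t).2
  · rw [if_pos h]
    simp only [this, h, true_and]
    rfl
  · simp only [this, h, false_and, if_false]

theorem HasFlip.not [Nontrivial Q] (c : Q) : HasFlip n 3 c fun _ => true := by
  refine HasFlip.of_diagonal (g := 1) ?_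
  simp only [Bool.and_true]
  exact HasCircuit.diagonal_single c (z := fun i => if i then -1 else 1) (by simp)

theorem HasFlip.cnot [Nontrivial Q] {a c : Q} (h : a ≠ c) : HasFlip n 3 c fun s => s a := by
  refine HasFlip.of_diagonal (g := 1) ?_
  simp only [Function.update_of_ne h]
  exact HasCircuit.diagonal_pair h.symm (z := fun i j => if i && j then -1 else 1)
    (by intro i j; cases i <;> cases j <;> simp)

theorem HasCircuit.conj_diagonal {σ : Equiv.Perm (Q → Bool)} {d : (Q → Bool) → ℂ}
    (hσ : HasCircuit n 0 g fun _ => permMat σ)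
    (hd : HasCircuit n 0 g' fun _ => Matrix.diagonal d) :
    HasCircuit n 0 (2 * g + g') fun _ => Matrix.diagonal (d ∘ σ) := by
  have := (hσ.conjTranspose.mul hd).mul hσ
  simp only [conjTranspose_permMat_mul] at this
  exact this.mono (by omega) (by omega)

/-- From `2ab = a + b - (a ⊕ b)`, the sign `(-1)^{abc}` is `i^{ac} i^{bc} (-i)^{(a ⊕ b)c}`. The
third phase is a two-wire phase conjugated by a controlled flip, which gives `1 + 1 + 7` gates
before the two Hadamards. -/
theorem HasFlip.toffoli [Nontrivial Q] {a b c : Q} (hab : a ≠ b) (hac : a ≠ c) (hbc : b ≠ c) :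
    HasFlip n 11 c fun s => s a && s b := by
  refine HasFlip.of_diagonal (g := 9) ?_
  simp only [Function.update_of_ne hac, Function.update_of_ne hbc]
  have hz : ∀ ω : ℂ, star ω * ω = 1 → ∀ i j : Bool,
      star (if i && j then ω else 1) * (if i && j then ω else 1) = 1 := by
    intro ω h i j; cases i <;> cases j <;> simp
    simpa using h
  have h1 := HasCircuit.diagonal_pair (n := n) hac (z := fun i j => if i && j then Complex.I else 1)
    (hz _ (by norm_num [Complex.conj_I]))
  have h2 := HasCircuit.diagonal_pair (n := n) hbc (z := fun i j => if i && j then Complex.I else 1)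
    (hz _ (by norm_num [Complex.conj_I]))
  have h3 := HasCircuit.conj_diagonal (HasFlip.cnot (n := n) hab)
    (HasCircuit.diagonal_pair (n := n) hbc (z := fun i j => if i && j then -Complex.I else 1)
      (hz _ (by norm_num [Complex.conj_I])))
  have key := (h1.mul h2).mul h3
  simp only [Matrix.diagonal_mul_diagonal] at key
  refine (key.mono le_rfl (by norm_num)).congr fun x => ?_
  congr 1; funext s
  simp only [Function.comp_apply, flipPerm_apply, Function.update_self, Function.update_of_ne hab,
    Function.update_of_ne hbc.symm]
  cases s a <;> cases s b <;> cases s c <;> simp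

end Flips

/-! ### Operators that do not disturb a wire -/

section Preserves

variable {Q : Type*} [Fintype Q] [DecidableEq Q] {k : Q} {M N : Matrix (Q → Bool) (Q → Bool) ℂ}

/-- The operator `M` is diagonal in the basis of the wire `k`. -/
def Preserves (k : Q) (M : Matrix (Q → Bool) (Q → Bool) ℂ) : Prop :=
  ∀ s t, s k ≠ t k → M s t = 0

theorem Preserves.mul (hM : Preserves k M) (hN : Preserves k N) : Preserves k (M * N) := by
  intro s t h
  rw [Matrix.mul_apply]
  refine Finset.sum_eq_zero fun r _ => ?_
  by_cases h1 : s k = r k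
  · rw [hN r t (h1 ▸ h), mul_zero]
  · rw [hM s r h1, zero_mul]

theorem Preserves.conjTranspose (hM : Preserves k M) : Preserves k M.conjTranspose := by
  intro s t h
  rw [Matrix.conjTranspose_apply, hM t s h.symm, star_zero]

theorem Preserves.diagonal (k : Q) (d : (Q → Bool) → ℂ) : Preserves k (Matrix.diagonal d) :=
  fun s t h => Matrix.diagonal_apply_ne _ fun e => h (by rw [e])

theorem Preserves.permMat {σ : Equiv.Perm (Q → Bool)} (h : ∀ s, σ s k = s k) :
    Preserves k (permMat σ) := by
  intro s t hs
  rw [QuerySim.permMat, if_neg]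
  rintro rfl
  exact hs (h t)

theorem Preserves.locally {W : Type*} [Fintype W] [DecidableEq W] {ι : W ↪ Q}
    (hk : k ∉ Set.range ι)
    (M : (OffWire ι → Bool) → Matrix (W → Bool) (W → Bool) ℂ) :
    Preserves k (locally (embEquiv ι) M) := by
  intro s t h
  rw [locally_apply, if_neg]
  intro e
  exact h (congrFun e ⟨k, hk⟩)

theorem Preserves.timeProd {X : ℕ → Matrix (Q → Bool) (Q → Bool) ℂ} (a m : ℕ)
    (h : ∀ i, a ≤ i → i < a + m → Preserves k (X i)) : Preserves k (timeProd X a m) := by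
  induction m with
  | zero =>
    rw [QuerySim.timeProd, ← Matrix.diagonal_one]
    exact Preserves.diagonal _ _
  | succ m ih => exact (h _ (by omega) (by omega)).mul (ih fun i h1 h2 => h i h1 (by omega))

end Preserves

/-! ### Reversible computation and the reflection -/

section Compute

variable {Q : Type*} [Fintype Q] [DecidableEq Q] {n : ℕ}

/-- Reversible computation of the wires `z i`, in the order given by `rank`: the wire `z i` receives
the value `φ i`, which may depend on the wires computed before and on the wires not computed. -/
theorem exists_compute {ι α : Type*} [DecidableEq ι] [LinearOrder α] (z : ι ↪ Q) (rank : ι → α)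
    (φ : ι → (Q → Bool) → Bool) (g : ℕ) (F : Finset ι) (hφ : ∀ i ∈ F, HasFlip n g (z i) (φ i))
    (hdep : ∀ i ∈ F, ∀ s s' : Q → Bool,
      (∀ k, (∀ j ∈ F, z j = k → rank j < rank i) → s k = s' k) → φ i s = φ i s') :
    ∃ σ : Equiv.Perm (Q → Bool), HasCircuit n 0 (F.card * g) (fun _ => permMat σ) ∧
      (∀ s k, (∀ i ∈ F, z i ≠ k) → σ s k = s k) ∧
      ∀ s full : Q → Bool, (∀ k, (∀ i ∈ F, z i ≠ k) → full k = s k) →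
        (∀ i ∈ F, s (z i) = false) → (∀ i ∈ F, full (z i) = φ i full) → σ s = full := by
  -- The wire of highest rank is computed last, when everything that it depends on is already in
  -- place.
  induction F using Finset.induction_on_max_value (f := rank) with
  | empty =>
    refine ⟨1, ?_, fun _ _ _ => rfl, fun s full h _ _ => ?_⟩
    · rw [permMat_one, Finset.card_empty, zero_mul]; exact .one
    · funext k; exact (h k (by simp)).symm
  | insert a F ha hmax ih =>
    obtain ⟨σ, h1, h2, h3⟩ := ih (fun i hi => hφ i (Finset.mem_insert_of_mem hi))
      fun i hi s s' h => hdep i (Finset.mem_insert_of_mem hi) s s' fun k hk =>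
        h k fun j hj => hk j (Finset.mem_insert_of_mem hj)
    refine ⟨flipPerm (z a) (φ a) * σ, ?_, fun s k hk => ?_, fun s full hfull hs hcons => ?_⟩
    · have := HasCircuit.mul (hφ a (Finset.mem_insert_self _ _)) h1
      simp only [permMat_mul] at this
      refine this.mono le_rfl ?_
      rw [Finset.card_insert_of_notMem ha, Nat.succ_mul, add_comm]
    · rw [Equiv.Perm.mul_apply, flipPerm_apply,
        Function.update_of_ne (hk a (Finset.mem_insert_self _ _)).symm,
        h2 s k fun i hi => hk i (Finset.mem_insert_of_mem hi)]
    · have hza : ∀ i ∈ F, z i ≠ z a := fun i hi h => ha (z.injective h ▸ hi)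
      -- Before the last flip the state is the final one with the last wire still cleared, which no
      -- earlier wire notices.
      have hσ : σ s = Function.update full (z a) false := by
        refine h3 s _ (fun k hk => ?_) (fun i hi => hs i (Finset.mem_insert_of_mem hi))
          fun i hi => ?_
        · by_cases hka : k = z a
          · rw [hka, Function.update_self, hs a (Finset.mem_insert_self _ _)]
          · rw [Function.update_of_ne hka]
            refine hfull k fun i hi => ?_
            rcases Finset.mem_insert.1 hi with rfl | hi
            exacts [fun h => hka h.symm, hk i hi]
        · rw [Function.update_of_ne (hza i hi), hcons i (Finset.mem_insert_of_mem hi)]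
          refine hdep i (Finset.mem_insert_of_mem hi) _ _ fun k hk => ?_
          have hka : k ≠ z a := fun h =>
            absurd (hk a (Finset.mem_insert_self _ _) h.symm) (not_lt.2 (hmax i hi))
          rw [Function.update_of_ne hka]
      rw [Equiv.Perm.mul_apply, hσ, flipPerm_apply, Function.update_idem, Function.update_idem,
        Function.update_self, Bool.false_xor]
      have : φ a (Function.update full (z a) false) = φ a full :=
        hdep a (Finset.mem_insert_self _ _) _ _ fun k hk => by
          have hka : k ≠ z a := fun h =>
            absurd (hk a (Finset.mem_insert_self _ _) h.symm) (lt_irrefl _)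
          rw [Function.update_of_ne hka]
      rw [this, ← hcons a (Finset.mem_insert_self _ _), Function.update_eq_self]

theorem HasFlip.not_and [Nontrivial Q] {a b c : Q} (hab : a ≠ b) (hac : a ≠ c) (hbc : b ≠ c) :
    HasFlip n 14 c fun s => s a && !s b := by
  have := (HasFlip.toffoli (n := n) hab hac hbc).xor (HasFlip.cnot hac)
  have e : (fun s : Q → Bool => (s a && s b) ^^ s a) = fun s => s a && !s b := by
    funext s; cases s a <;> cases s b <;> rfl
  rwa [e] at this

theorem HasFlip.not_wire [Nontrivial Q] {b c : Q} (hbc : b ≠ c) :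
    HasFlip n 6 c fun s => !s b := by
  have := (HasFlip.cnot (n := n) hbc).xor (HasFlip.not c)
  have e : (fun s : Q → Bool => s b ^^ true) = fun s => !s b := by
    funext s; cases s b <;> rfl
  rwa [e] at this

/-- The reflection about the zero state of the wires `reg`, with clean wires `ch`. -/
theorem exists_reflection [Nontrivial Q] {G : Type*} [Fintype G] [DecidableEq G] [Nonempty G]
    (reg ch : G ↪ Q) (hd : ∀ i j, reg i ≠ ch j) :
    ∃ φ : (Q → Bool) → Bool,
      HasCircuit n 0 (Fintype.card G * 28 + 1) (fun _ =>
        1 - (2 : ℂ) • Matrix.diagonal fun s : Q → Bool => if φ s then (1 : ℂ) else 0) ∧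
      ∀ s : Q → Bool, (∀ i, s (ch i) = false) → φ s = decide (∀ i, s (reg i) = false) := by
  obtain ⟨m, hm⟩ : ∃ m, Fintype.card G = m + 1 :=
    Nat.exists_eq_succ_of_ne_zero Fintype.card_ne_zero
  let e : G ≃ Fin (m + 1) := Fintype.equivFinOfCardEq hm
  let prev : G → G := fun i => e.symm ⟨(e i : ℕ) - 1, by omega⟩
  have hprev : ∀ i, (e (prev i) : ℕ) = (e i : ℕ) - 1 := fun i => by simp [prev]
  -- The chain wire `i` records whether all register wires up to `i` are zero. A sign on the last
  -- chain wire, between computing and uncomputing the chain, is the reflection: twice 14 gates for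
  -- each wire and one more. The result is the intended one only if the chain starts clean.
  let φ : G → (Q → Bool) → Bool := fun i s =>
    if (e i : ℕ) = 0 then !s (reg i) else s (ch (prev i)) && !s (reg i)
  have hne : ∀ i, (e i : ℕ) ≠ 0 → prev i ≠ i := by
    intro i hi h
    have := hprev i
    rw [h] at this; omega
  obtain ⟨σ, h1, -, h3⟩ := exists_compute (n := n) ch (fun i => (e i : ℕ)) φ 14 Finset.univ
    (by
      intro i _
      by_cases hi : (e i : ℕ) = 0
      · simp only [φ, hi, if_true]
        exact (HasFlip.not_wire (hd i i)).mono (by norm_num)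
      · simp only [φ, hi, if_false]
        exact HasFlip.not_and (hd i _).symm (fun h => hne i hi (ch.injective h)) (hd i i))
    (by
      intro i _ s s' h
      have hr : s (reg i) = s' (reg i) := h _ fun j _ hj => absurd hj.symm (hd i j)
      simp only [φ, hr]
      split_ifs with hi
      · rfl
      · rw [h (ch (prev i)) fun j _ hj => by
          rw [ch.injective hj, hprev]; omega])
  refine ⟨fun s => σ s (ch (e.symm (Fin.last m))), ?_, fun s hs => ?_⟩
  · have := HasCircuit.conj_diagonal h1 (HasCircuit.diagonal_single (n := n)
      (ch (e.symm (Fin.last m))) (z := fun i => if i then -1 else 1) (by simp))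
    refine (this.mono le_rfl ?_).congr fun x => ?_
    · rw [Finset.card_univ]; omega
    · ext s t
      by_cases h : s = t
      · subst h
        simp only [Matrix.diagonal_apply_eq, Matrix.sub_apply, Matrix.one_apply_eq,
          Matrix.smul_apply, Function.comp_apply]
        split_ifs <;> norm_num
      · simp [h]
  · have hσ := h3 s (Function.extend ch
      (fun i => decide (∀ j, (e j : ℕ) ≤ e i → s (reg j) = false)) s)
      (fun k hk => Function.extend_apply' _ _ _ fun ⟨i, hi⟩ => hk i (Finset.mem_univ _) hi)
      (fun i _ => hs i) (by
        intro i _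
        have hreg : ∀ j, Function.extend ch
            (fun i => decide (∀ j, (e j : ℕ) ≤ e i → s (reg j) = false)) s (reg j) = s (reg j) :=
          fun j => Function.extend_apply' _ _ _ fun ⟨i, hi⟩ => hd j i hi.symm
        simp only [φ, hreg, ch.injective.extend_apply]
        split_ifs with hi
        · rw [Bool.eq_iff_iff]
          simp only [hi, decide_eq_true_eq, Bool.not_eq_true']
          constructor
          · intro h; exact h i (by omega)
          · intro h j hj
            have : j = i := e.injective (Fin.ext (by omega))
            rw [this, h]
        · rw [Bool.eq_iff_iff]
          simp only [decide_eq_true_eq, Bool.not_eq_true', Bool.and_eq_true, hprev]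
          constructor
          · intro h; exact ⟨fun j hj => h j (by omega), h i le_rfl⟩
          · rintro ⟨h, h'⟩ j hj
            rcases eq_or_ne j i with rfl | hji
            · exact h'
            · refine h j ?_
              have : (e j : ℕ) ≠ e i := fun h => hji (e.injective (Fin.ext h))
              omega)
    simp only [hσ, ch.injective.extend_apply]
    congr 1
    rw [Equiv.apply_symm_apply]
    simp only [Fin.val_last, eq_iff_iff]
    exact ⟨fun h j => h j (by omega), fun h j _ => h j⟩

end Compute

/-! ### Isometries given by basis vectors -/

section Columns

variable {I C : Type*} [Fintype I] [DecidableEq I] [Fintype C] [DecidableEq C]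

/-- The matrix with the basis vectors `b t` as columns. -/
def colMat (b : C → I) : Matrix I C ℂ := fun s t => if s = b t then 1 else 0

theorem mul_colMat_apply {I' : Type*} (A : Matrix I' I ℂ) (b : C → I) (s : I') (t : C) :
    (A * colMat b) s t = A s (b t) := by
  rw [Matrix.mul_apply, Finset.sum_eq_single (b t)]
  · simp [colMat]
  · intro r _ hr; simp [colMat, hr]
  · simp

theorem permMat_mul_colMat (σ : Equiv.Perm I) (b : C → I) :
    permMat σ * colMat b = colMat fun t => σ (b t) := by
  ext s t
  rw [mul_colMat_apply]; rfl

theorem diagonal_mul_colMat {d : I → ℂ} {b : C → I} {d' : C → ℂ} (h : ∀ t, d (b t) = d' t) :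
    Matrix.diagonal d * colMat b = colMat b * Matrix.diagonal d' := by
  ext s t
  rw [mul_colMat_apply, Matrix.mul_diagonal, Matrix.diagonal_apply, colMat]
  split_ifs with hs
  · rw [hs, h, one_mul]
  · rw [zero_mul]

theorem conjTranspose_colMat_mul {b : C → I} (hb : Function.Injective b) :
    (colMat b).conjTranspose * colMat b = 1 := by
  ext s t
  rw [mul_colMat_apply, Matrix.conjTranspose_apply, colMat, Matrix.one_apply]
  by_cases h : s = t
  · simp [h]
  · rw [if_neg fun e => h (hb e).symm, if_neg h, star_zero]

end Columns

/-! ### Product preparations and projections onto the zero word -/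

section Prepare

variable {Q G : Type*} [Fintype Q] [DecidableEq Q] [Fintype G] [DecidableEq G] {n : ℕ}

/-- The product of the operators `u i` on the wires `reg i`, `i ∈ F`. -/
noncomputable def wireProd (reg : G ↪ Q) (u : G → Matrix Bool Bool ℂ) (F : Finset G) :
    Matrix (Q → Bool) (Q → Bool) ℂ :=
  fun s t => if ∀ k, (∀ i ∈ F, reg i ≠ k) → s k = t k then
    ∏ i ∈ F, u i (s (reg i)) (t (reg i)) else 0

theorem hasCircuit_wireProd [Nontrivial Q] (reg : G ↪ Q) {u : G → Matrix Bool Bool ℂ}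
    (hu : ∀ i, (u i).conjTranspose * u i = 1) (F : Finset G) :
    HasCircuit n 0 F.card fun _ => wireProd reg u F := by
  induction F using Finset.induction_on with
  | empty =>
    refine HasCircuit.one.congr fun _ => ?_
    ext s t
    rw [wireProd, Matrix.one_apply]
    simp [funext_iff]
  | insert a F ha ih =>
    have := (HasCircuit.oneQubit (n := n) (reg a) (hu a)).mul ih
    refine (this.mono le_rfl (by rw [Finset.card_insert_of_notMem ha, add_comm])).congr fun _ => ?_
    have hne : ∀ i ∈ F, reg i ≠ reg a := fun i hi h => ha (reg.injective h ▸ hi)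
    ext s t
    have hup : ((wireEquiv (reg a)) s).2 =
        ((wireEquiv (reg a)) (Function.update s (reg a) (t (reg a)))).2 := by
      funext k
      exact (Function.update_of_ne k.2 _ _).symm
    rw [Matrix.mul_apply, Finset.sum_eq_single (Function.update s (reg a) (t (reg a)))]
    · rw [locally_apply, if_pos hup, wireProd, wireProd, Finset.prod_insert ha]
      have hiff : (∀ k, (∀ i ∈ F, reg i ≠ k) →
          Function.update s (reg a) (t (reg a)) k = t k) ↔
          ∀ k, (∀ i ∈ insert a F, reg i ≠ k) → s k = t k := by
        constructor
        · intro h k hk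
          have := h k fun i hi => hk i (Finset.mem_insert_of_mem hi)
          rwa [Function.update_of_ne (hk a (Finset.mem_insert_self _ _)).symm] at this
        · intro h k hk
          by_cases hka : k = reg a
          · rw [hka, Function.update_self]
          · rw [Function.update_of_ne hka]
            refine h k fun i hi => ?_
            rcases Finset.mem_insert.1 hi with rfl | hi
            exacts [fun h => hka h.symm, hk i hi]
      simp only [hiff]
      have e1 : ((wireEquiv (reg a)) (Function.update s (reg a) (t (reg a)))).1 = t (reg a) :=
        Function.update_self _ _ _
      have e2 : ∏ i ∈ F, u i (Function.update s (reg a) (t (reg a)) (reg i)) (t (reg i)) =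
          ∏ i ∈ F, u i (s (reg i)) (t (reg i)) :=
        Finset.prod_congr rfl fun i hi => by rw [Function.update_of_ne (hne i hi)]
      rw [e1, e2]
      split_ifs
      · rfl
      · rw [mul_zero]
    · intro r _ hr
      rw [locally_apply, wireProd]
      split_ifs with h1 h2
      · exfalso
        refine hr (funext fun k => ?_)
        by_cases hka : k = reg a
        · rw [hka, Function.update_self]
          exact h2 _ hne
        · rw [Function.update_of_ne hka]
          exact (congrFun h1 ⟨k, hka⟩).symm
      · rw [mul_zero]
      · rw [zero_mul]
      · rw [zero_mul]
    · simp

/-- Addition of the bits `x` on the wires `reg`. -/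
noncomputable def xorPerm (reg : G ↪ Q) (x : G → Bool) : Equiv.Perm (Q → Bool) :=
  Function.Involutive.toPerm (fun s k => s k ^^ Function.extend reg x (fun _ => false) k)
    fun s => by funext k; simp

theorem xorPerm_reg (reg : G ↪ Q) (x : G → Bool) (s : Q → Bool) (i : G) :
    xorPerm reg x s (reg i) = (s (reg i) ^^ x i) :=
  congrArg (s (reg i) ^^ ·) (reg.injective.extend_apply _ _ _)

theorem xorPerm_of_ne (reg : G ↪ Q) (x : G → Bool) (s : Q → Bool) {k : Q} (hk : ∀ i, reg i ≠ k) :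
    xorPerm reg x s k = s k := by
  have : Function.extend reg x (fun _ => false) k = false :=
    Function.extend_apply' _ _ _ fun ⟨i, hi⟩ => hk i hi
  exact (congrArg (s k ^^ ·) this).trans (Bool.xor_false _)

theorem symm_xorPerm (reg : G ↪ Q) (x : G → Bool) : (xorPerm reg x).symm = xorPerm reg x := rfl

theorem eq_xorPerm_iff (reg : G ↪ Q) {x : G → Bool} {s r : Q → Bool}
    (hs : ∀ i, s (reg i) = false) :
    r = xorPerm reg x s ↔ (∀ i, r (reg i) = x i) ∧ ∀ k, (∀ i, reg i ≠ k) → r k = s k := by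
  constructor
  · rintro rfl
    exact ⟨fun i => by rw [xorPerm_reg, hs, Bool.false_xor], fun k hk => xorPerm_of_ne reg x s hk⟩
  · rintro ⟨h1, h2⟩
    funext k
    by_cases hk : ∃ i, reg i = k
    · obtain ⟨i, rfl⟩ := hk
      rw [h1, xorPerm_reg, hs, Bool.false_xor]
    · push Not at hk
      rw [h2 k hk, xorPerm_of_ne reg x s hk]

theorem wireProd_mul_colMat {C : Type*} [Fintype C] [DecidableEq C] (reg : G ↪ Q)
    (u : G → Matrix Bool Bool ℂ) {b : C → Q → Bool} (hb : ∀ t i, b t (reg i) = false) :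
    wireProd reg u Finset.univ * colMat b =
      ∑ x : G → Bool, (∏ i, u i (x i) false) • colMat fun t => xorPerm reg x (b t) := by
  ext s t
  rw [mul_colMat_apply, Matrix.sum_apply, Finset.sum_eq_single fun i => s (reg i)]
  · rw [wireProd, Matrix.smul_apply, colMat, smul_eq_mul]
    simp only [eq_xorPerm_iff reg (hb t), hb]
    simp
  · intro x _ hx
    rw [Matrix.smul_apply, colMat, if_neg, smul_zero]
    rw [eq_xorPerm_iff reg (hb t)]
    rintro ⟨h, -⟩
    exact hx (funext fun i => (h i).symm)
  · simp

/-- If the register holds the word `x`, undoing the preparation and projecting onto the zero word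
leaves the single conjugated amplitude of `x`. The support condition also keeps the chain wires
clean, the only situation in which `φ` is known. -/
theorem diagonal_mul_wireProd_mul {C : Type*} (reg ch : G ↪ Q) (hd : ∀ i j, reg i ≠ ch j)
    (u : G → Matrix Bool Bool ℂ) {φ : (Q → Bool) → Bool}
    (hφ : ∀ s : Q → Bool, (∀ i, s (ch i) = false) → φ s = decide (∀ i, s (reg i) = false))
    (x : G → Bool) {N : Matrix (Q → Bool) C ℂ}
    (hN : ∀ s t, N s t ≠ 0 → (∀ i, s (reg i) = x i) ∧ ∀ i, s (ch i) = false) :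
    (Matrix.diagonal fun s : Q → Bool => if φ s then (1 : ℂ) else 0) *
        (wireProd reg u Finset.univ).conjTranspose * N =
      (∏ i, star (u i (x i) false)) •
        ((Matrix.diagonal fun s : Q → Bool => if ∀ i, s (reg i) = false then (1 : ℂ) else 0) *
          (permMat (xorPerm reg x) * N)) := by
  ext s t
  rw [Matrix.mul_assoc, Matrix.diagonal_mul, Matrix.smul_apply, Matrix.diagonal_mul,
    permMat_mul_apply, symm_xorPerm, smul_eq_mul, Matrix.mul_apply]
  by_cases hs : ∀ i, s (reg i) = false
  · rw [if_pos hs, one_mul, Finset.sum_eq_single (xorPerm reg x s)]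
    · by_cases hz : N (xorPerm reg x s) t = 0
      · rw [hz]; simp
      · have hc : ∀ i, s (ch i) = false := fun i => by
          rw [← xorPerm_of_ne reg x s fun j => hd j i]; exact (hN _ _ hz).2 i
        rw [hφ s hc, decide_eq_true hs, if_pos rfl, one_mul, Matrix.conjTranspose_apply, wireProd,
          if_pos, star_prod]
        · congr 1
          refine Finset.prod_congr rfl fun i _ => ?_
          rw [xorPerm_reg, hs, Bool.false_xor]
        · intro k hk
          exact xorPerm_of_ne reg x s fun i => hk i (Finset.mem_univ _)
    · intro r _ hr
      by_cases hz : N r t = 0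
      · rw [hz, mul_zero]
      · rw [Matrix.conjTranspose_apply, wireProd, if_neg, star_zero, zero_mul]
        intro h
        exact hr ((eq_xorPerm_iff reg hs).2 ⟨(hN _ _ hz).1, fun k hk => h k fun i _ => hk i⟩)
    · simp
  · rw [if_neg hs, zero_mul, mul_zero]
    by_cases hc : φ s = true
    · rw [if_pos hc, one_mul]
      refine Finset.sum_eq_zero fun r _ => ?_
      by_cases hz : N r t = 0
      · rw [hz, mul_zero]
      · rw [Matrix.conjTranspose_apply, wireProd, if_neg, star_zero, zero_mul]
        intro h
        have := hφ s fun i => by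
          rw [← h (ch i) fun j _ => hd j i]; exact (hN _ _ hz).2 i
        rw [this, decide_eq_true_eq] at hc
        exact hs hc
    · rw [if_neg hc, zero_mul]

/-- A real unitary with prescribed first column. -/
noncomputable def rotation (c s : ℝ) : Matrix Bool Bool ℂ :=
  Matrix.of fun a b => if b then (if a then (c : ℂ) else -s) else (if a then (s : ℂ) else c)

theorem rotation_unitary {c s : ℝ} (h : c ^ 2 + s ^ 2 = 1) :
    (rotation c s).conjTranspose * rotation c s = 1 := by
  have h' : (c : ℂ) ^ 2 + (s : ℂ) ^ 2 = 1 := by exact_mod_cast h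
  ext a b
  rw [Matrix.mul_apply]
  simp only [Matrix.conjTranspose_apply, rotation, Matrix.of_apply, Fintype.sum_bool]
  cases a <;> cases b <;> simp <;> first | linear_combination h' | ring

end Prepare

/-! ### Geometric variables have independent binary digits -/

section BinaryGaps

/-- The exponent is the sum of its binary digits times powers of 2, so `q ^ i` factors over the
digits. -/
theorem prod_testBit_pow (q : ℝ) (i l : ℕ) :
    ∏ b ∈ Finset.range l, (if i.testBit b then q ^ 2 ^ b else 1) = q ^ (i % 2 ^ l) := by
  induction l with
  | zero => simp [Nat.mod_one]
  | succ l ih =>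
    rw [Finset.prod_range_succ, ih, Nat.mod_pow_succ, pow_add, Nat.testBit_eq_decide_div_mod_eq]
    rcases Nat.mod_two_eq_zero_or_one (i / 2 ^ l) with h | h <;> simp [h]

/-- Repeated difference of squares; this normalizes the product of the digit weights. -/
theorem prod_one_add_pow {q : ℝ} (l : ℕ) :
    (1 - q) * ∏ b ∈ Finset.range l, (1 + q ^ 2 ^ b) = 1 - q ^ 2 ^ l := by
  induction l with
  | zero => simp
  | succ l ih =>
    rw [Finset.prod_range_succ, ← mul_assoc, ih, pow_succ, pow_mul]; ring

/-- The gap encoded by a binary number of `l` bits and a stop bit. -/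
def binaryGap (l : ℕ) (γ : Fin (2 ^ l) × Bool) : ℕ := if γ.2 then 2 ^ l else γ.1

/-- The probability of the value `v` of the `b`-th bit of a geometric random variable. -/
noncomputable def bitWeight (q : ℝ) (b : ℕ) (v : Bool) : ℝ :=
  (if v then q ^ 2 ^ b else 1) / (1 + q ^ 2 ^ b)

/-- The probability that a geometric random variable is at least `2 ^ l`, and the complementary
one. -/
noncomputable def stopWeight (q : ℝ) (l : ℕ) (v : Bool) : ℝ :=
  if v then q ^ 2 ^ l else 1 - q ^ 2 ^ l

/-- The weight of a binary gap. -/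
noncomputable def gapWeight (q : ℝ) (l : ℕ) (γ : Fin (2 ^ l) × Bool) : ℝ :=
  stopWeight q l γ.2 * ∏ b : Fin l, bitWeight q b ((γ.1 : ℕ).testBit b)

theorem bitWeight_nonneg {q : ℝ} (hq : 0 ≤ q) (b : ℕ) (v : Bool) : 0 ≤ bitWeight q b v := by
  rw [bitWeight]; cases v <;> simp <;> positivity

theorem stopWeight_nonneg {q : ℝ} (hq : 0 ≤ q) (hq' : q ≤ 1) (l : ℕ) (v : Bool) :
    0 ≤ stopWeight q l v := by
  have : q ^ 2 ^ l ≤ 1 := pow_le_one₀ hq hq'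
  rw [stopWeight]; cases v <;> simp <;> first | linarith | positivity

theorem bitWeight_add {q : ℝ} (hq : 0 ≤ q) (b : ℕ) :
    bitWeight q b false + bitWeight q b true = 1 := by
  have : 0 < 1 + q ^ 2 ^ b := by positivity
  simp only [bitWeight]
  rw [← add_div]; simp [this.ne']

theorem stopWeight_add (q : ℝ) (l : ℕ) : stopWeight q l false + stopWeight q l true = 1 := by
  simp [stopWeight]

theorem prod_bitWeight {q : ℝ} (hq : 0 ≤ q) (hq' : q < 1) (l : ℕ) (i : Fin (2 ^ l)) :
    ∏ b : Fin l, bitWeight q b ((i : ℕ).testBit b) =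
      (1 - q) * q ^ (i : ℕ) / (1 - q ^ 2 ^ l) := by
  rw [Fin.prod_univ_eq_prod_range (fun b => bitWeight q b ((i : ℕ).testBit b)) l]
  simp only [bitWeight]
  rw [Finset.prod_div_distrib, prod_testBit_pow, Nat.mod_eq_of_lt i.2, ← prod_one_add_pow]
  have h1 : 0 < ∏ b ∈ Finset.range l, (1 + q ^ 2 ^ b) :=
    Finset.prod_pos fun b _ => by positivity
  have h2 : 0 < 1 - q := by linarith
  field_simp

/-- The `l` independent digits produce a geometric variable conditioned to lie below `2 ^ l`. The
stop bit, independent of them, is unset with probability `1 - q ^ 2 ^ l`, and multiplying by this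
undoes the conditioning. -/
theorem isGeometric_gapWeight {p : ℝ} (hp : 0 < p) (hp' : p ≤ 1) (l : ℕ) :
    IsGeometric (gapWeight (1 - p) l) (binaryGap l) (2 ^ l) p (1 - p) := by
  have hq : 0 ≤ 1 - p := by linarith
  have hq' : 1 - p < 1 := by linarith
  have hlt : (1 - p) ^ 2 ^ l < 1 := pow_lt_one₀ hq hq' (by positivity)
  have hne : 1 - (1 - p) ^ 2 ^ l ≠ 0 := by linarith
  have hgeom : ∑ i : Fin (2 ^ l), (1 - (1 - p)) * (1 - p) ^ (i : ℕ) / (1 - (1 - p) ^ 2 ^ l) = 1 := by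
    rw [← Finset.sum_div, ← Finset.mul_sum,
      Fin.sum_univ_eq_sum_range (fun i => (1 - p) ^ i) (2 ^ l), mul_neg_geom_sum, div_self hne]
  refine ⟨fun γ => ?_, ?_, fun i hi => ?_⟩
  · exact mul_nonneg (stopWeight_nonneg hq hq'.le _ _)
      (Finset.prod_nonneg fun b _ => bitWeight_nonneg hq _ _)
  · rw [Fintype.sum_prod_type_right]
    simp only [gapWeight, prod_bitWeight hq hq', ← Finset.mul_sum, hgeom, mul_one,
      Fintype.sum_bool]
    rw [add_comm]; exact stopWeight_add _ _
  · rw [Finset.sum_eq_single ((⟨i, hi⟩, false) : Fin (2 ^ l) × Bool)]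
    · rw [gapWeight, prod_bitWeight hq hq']
      simp only [stopWeight]
      simp only [Bool.false_eq_true, if_false]
      field_simp; ring
    · rintro ⟨j, v⟩ hj hne
      exfalso
      rw [Finset.mem_filter] at hj
      have hj := hj.2
      cases v
      · simp only [binaryGap, Bool.false_eq_true, if_false] at hj
        exact hne (Prod.ext (Fin.ext hj) rfl)
      · simp only [binaryGap, if_true] at hj
        omega
    · intro h
      exact absurd (Finset.mem_filter.2 ⟨Finset.mem_univ _, by simp [binaryGap]⟩) h

end BinaryGaps

/-! ### Positions by addition with carries -/

section Positions

theorem slotAt_succ (M : ℕ) (L : List ℕ) (j i : ℕ) (hi : i + 1 < L.length) :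
    slotAt M L j (i + 1) = (slotAt M L j i).bind fun t =>
      if t + 1 + L[i + 1] < M then some (t + 1 + L[i + 1]) else none := by
  induction L generalizing j i with
  | nil => simp at hi
  | cons d L ih =>
    cases i with
    | zero =>
      obtain _ | ⟨d', L⟩ := L
      · simp at hi
      · by_cases h : j + d < M <;> simp [slotAt, h]
    | succ i =>
      have := ih (j + d + 1) i (by simpa using hi)
      by_cases h : j + d < M
      · simp only [slotAt, h, if_true]
        rw [this]; rfl
      · simp [slotAt, h]

variable {l : ℕ}

/-- The position reached by a walk before the gap `i`, as a binary number. -/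
def walkPos (γ : ℕ → BitVec l) : ℕ → BitVec l
  | 0 => 0
  -- After an event at `t` the walk resumes at `t + 1`. The extra 1, absent at the first gap, enters
  -- the adder as carry-in; `walkPos γ (i + 1)` is then the position of event `i`.
  | i + 1 => walkPos γ i + γ i + BitVec.setWidth l (BitVec.ofBool (decide (0 < i)))

/-- The carry bits of the additions of a walk. -/
def walkCarry (γ : ℕ → BitVec l) (i b : ℕ) : Bool :=
  BitVec.carry b (walkPos γ i) (γ i) (decide (0 < i))

/-- Whether a walk has not stopped before the gap `i`. -/
def walkAlive (γ : ℕ → BitVec l) (halt : ℕ → Bool) : ℕ → Bool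
  | 0 => true
  | i + 1 => (walkAlive γ halt i && !halt i) && !walkCarry γ i l

theorem toNat_add_add_of_carry {x y : BitVec l} {c : Bool} :
    (BitVec.carry l x y c = false ↔ x.toNat + y.toNat + c.toNat < 2 ^ l) ∧
    (x.toNat + y.toNat + c.toNat < 2 ^ l →
      (x + y + BitVec.setWidth l (BitVec.ofBool c)).toNat = x.toNat + y.toNat + c.toNat) := by
  have hx := x.isLt
  have hy := y.isLt
  constructor
  · rw [BitVec.carry, decide_eq_false_iff_not, Nat.mod_eq_of_lt hx, Nat.mod_eq_of_lt hy]
    omega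
  · intro h
    rw [BitVec.toNat_add, BitVec.toNat_add, BitVec.toNat_setWidth, BitVec.toNat_ofBool]
    have hc : c.toNat < 2 ^ l := by omega
    rw [Nat.mod_eq_of_lt hc, Nat.mod_eq_of_lt (show x.toNat + y.toNat < 2 ^ l by omega),
      Nat.mod_eq_of_lt h]

/-- A walk ends either by a stop bit or by leaving the segment, and the segment has length `2 ^ l`,
so leaving it is exactly an overflow of the adder. Later positions wrap around and are meaningless,
but the flag is off from then on. -/
theorem slotAt_eq_walkPos {L : List ℕ} {γ : ℕ → BitVec l} {halt : ℕ → Bool}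
    (hL : ∀ i (h : i < L.length), L[i] = if halt i then 2 ^ l else (γ i).toNat) (i : ℕ)
    (hi : i < L.length) :
    slotAt (2 ^ l) L 0 i =
      if walkAlive γ halt (i + 1) then some (walkPos γ (i + 1)).toNat else none := by
  induction i with
  | zero =>
    obtain _ | ⟨d, L⟩ := L
    · simp at hi
    have h0 := hL 0 (by simp)
    simp only [List.getElem_cons_zero] at h0
    have hc := toNat_add_add_of_carry (x := walkPos γ 0) (y := γ 0) (c := decide (0 < 0))
    simp only [slotAt, walkAlive, walkCarry, walkPos, zero_add] at hc ⊢
    cases hs : halt 0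
    · simp only [hs, Bool.false_eq_true, if_false] at h0
      have hlt : (γ 0).toNat < 2 ^ l := (γ 0).isLt
      simp [h0, hlt] at hc ⊢
      simp [hc]
    · simp [hs] at h0
      simp [h0]
  | succ i ih =>
    rw [slotAt_succ _ _ _ _ hi, ih (by omega), hL _ hi]
    have hc := toNat_add_add_of_carry (x := walkPos γ (i + 1)) (y := γ (i + 1))
      (c := decide (0 < i + 1))
    rw [show walkAlive γ halt (i + 1 + 1) = ((walkAlive γ halt (i + 1) && !halt (i + 1)) &&
      !walkCarry γ (i + 1) l) from rfl, show walkPos γ (i + 1 + 1) = walkPos γ (i + 1) + γ (i + 1) +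
      BitVec.setWidth l (BitVec.ofBool (decide (0 < i + 1))) from rfl, walkCarry]
    have e : decide (0 < i + 1) = true := by simp
    rw [e] at hc ⊢
    rw [Bool.toNat_true] at hc
    cases ha : walkAlive γ halt (i + 1)
    · simp
    · cases hs : halt (i + 1)
      · simp only [if_true, Option.bind_some, Bool.false_eq_true, if_false, Bool.not_false,
          Bool.and_true, Bool.true_and]
        by_cases h : (walkPos γ (i + 1)).toNat + (γ (i + 1)).toNat + 1 < 2 ^ l
        · rw [hc.2 h, hc.1.2 h, if_pos (by omega)]
          simp; omega
        · have : BitVec.carry l (walkPos γ (i + 1)) (γ (i + 1)) true = true := by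
            rw [← Bool.not_eq_false]; exact fun h' => h (hc.1.1 h')
          rw [this, if_neg (by omega)]; simp
      · simp

end Positions

/-! ### The registers of a segment and the adder circuit -/

section SlotWires

/-- The qubits that hold a word: a sign and, for every gap, its bits and a stop bit. -/
abbrev RegIdx (K l : ℕ) := Option (Fin K × Option (Fin l))

/-- The qubits computed from a word: positions, carries, and two flags for each gap that tell whether
the walk continues. -/
inductive CompWire (K l : ℕ) where
  | tau (i : Fin K) (b : Fin l)
  | car (i : Fin K) (b : Fin (l + 1))
  | live (i : Fin K)
  | val (i : Fin K)
  deriving DecidableEq, Fintype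

/-- The ancilla qubits of the simulation of a segment. -/
inductive SlotWire (K l : ℕ) (E : Type) where
  | ext (e : E)
  | reg (g : RegIdx K l)
  | chain (g : RegIdx K l)
  | comp (z : CompWire K l)
  | qbit
  deriving DecidableEq, Fintype

variable {n w K l : ℕ} {E : Type} [Fintype E] [DecidableEq E]

instance : Nontrivial (SysWire n w ⊕ SlotWire K l E) :=
  ⟨⟨.inl (.inl (.inr ())), .inr .qbit, by simp⟩⟩

theorem card_compWire_le (K l : ℕ) : Fintype.card (CompWire K l) ≤ K * (2 * l + 3) := by
  have := Fintype.card_le_of_surjective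
    (Sum.elim (fun p : Fin K × Fin l => CompWire.tau p.1 p.2)
      (Sum.elim (fun p : Fin K × Fin (l + 1) => CompWire.car p.1 p.2)
        (Sum.elim CompWire.live CompWire.val))) (by
      rintro (⟨i, b⟩ | ⟨i, b⟩ | i | i)
      exacts [⟨.inl (i, b), rfl⟩, ⟨.inr (.inl (i, b)), rfl⟩, ⟨.inr (.inr (.inl i)), rfl⟩,
        ⟨.inr (.inr (.inr i)), rfl⟩])
  simp only [Fintype.card_sum, Fintype.card_prod, Fintype.card_fin] at this
  nlinarith

variable (n w K l E) in
/-- The wires of a word. -/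
def regW : RegIdx K l ↪ SysWire n w ⊕ SlotWire K l E :=
  ⟨fun g => .inr (.reg g), fun g h e => by simpa using e⟩

variable (n w K l E) in
/-- The clean wires used by the reflection. -/
def chainW : RegIdx K l ↪ SysWire n w ⊕ SlotWire K l E :=
  ⟨fun g => .inr (.chain g), fun g h e => by simpa using e⟩

variable (n w K l E) in
/-- The computed wires. -/
def compW : CompWire K l ↪ SysWire n w ⊕ SlotWire K l E :=
  ⟨fun g => .inr (.comp g), fun g h e => by simpa using e⟩

theorem regW_apply (g : RegIdx K l) : regW n w K l E g = .inr (.reg g) := rfl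

theorem chainW_apply (g : RegIdx K l) : chainW n w K l E g = .inr (.chain g) := rfl

theorem compW_apply (z : CompWire K l) : compW n w K l E z = .inr (.comp z) := rfl

/-- The value at the preceding slot, or `d` at the first slot. -/
def prevVal (d : Bool) (i : Fin K) (v : Fin K → Bool) : Bool :=
  if (i : ℕ) = 0 then d else v ⟨i - 1, by omega⟩

/-- The function computed on a wire. -/
def compFun : CompWire K l → (SysWire n w ⊕ SlotWire K l E → Bool) → Bool
  -- A ripple-carry adder: a position bit is the sum of two bits and a carry, a carry is the
  -- majority of the three bits below it, and the lowest carry is the constant carry-in.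
  | .tau i b, s => prevVal false i (fun j => s (compW n w K l E (.tau j b))) ^^
      (s (regW n w K l E (some (i, some b))) ^^ s (compW n w K l E (.car i b.castSucc)))
  | .car i b, s => Fin.cases (decide (0 < (i : ℕ))) (fun b =>
      Bool.atLeastTwo (prevVal false i (fun j => s (compW n w K l E (.tau j b))))
        (s (regW n w K l E (some (i, some b)))) (s (compW n w K l E (.car i b.castSucc)))) b
  | .live i, s => prevVal true i (fun j => s (compW n w K l E (.val j))) &&
      !s (regW n w K l E (some (i, none)))
  | .val i, s => s (compW n w K l E (.live i)) && !s (compW n w K l E (.car i (Fin.last l)))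

/-- The order in which the wires are computed. -/
def compRank : CompWire K l → ℕ ×ₗ ℕ
  | .tau i b => toLex (i, 2 * b + 1)
  | .car i b => toLex (i, 2 * b)
  | .live i => toLex (i, 2 * l + 2)
  | .val i => toLex (i, 2 * l + 3)

theorem prevVal_congr {d : Bool} {i : Fin K} {v v' : Fin K → Bool}
    (h : ∀ j : Fin K, (j : ℕ) < i → v j = v' j) : prevVal d i v = prevVal d i v' := by
  rw [prevVal, prevVal]
  split_ifs with hi
  · rfl
  · exact h _ (by simp only; omega)

/-- Within a slot, carry and sum bits alternate from the lowest digit upwards and the two flags come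
last; every other reference is to the preceding slot or to the register. -/
theorem compFun_congr (z : CompWire K l) {s s' : SysWire n w ⊕ SlotWire K l E → Bool}
    (h : ∀ k, (∀ j ∈ Finset.univ, compW n w K l E j = k → compRank j < compRank z) →
      s k = s' k) : compFun z s = compFun z s' := by
  have hr : ∀ g, s (regW n w K l E g) = s' (regW n w K l E g) := fun g =>
    h _ fun j _ hj => by simp [compW_apply, regW_apply] at hj
  have hc : ∀ j, compRank j < compRank z →
      s (compW n w K l E j) = s' (compW n w K l E j) := fun j hj =>
    h _ fun j' _ hj' => by rwa [(compW n w K l E).injective hj']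
  cases z with
  | tau i b =>
    simp only [compFun, hr]
    rw [hc (.car i b.castSucc) (by simp [compRank, Prod.Lex.toLex_lt_toLex]),
      prevVal_congr fun j hj => hc (.tau j b) (by simp [compRank, Prod.Lex.toLex_lt_toLex, hj])]
  | car i b =>
    cases b using Fin.cases with
    | zero => rfl
    | succ b =>
      simp only [compFun, Fin.cases_succ, hr]
      rw [hc (.car i b.castSucc) (by simp [compRank, Prod.Lex.toLex_lt_toLex]),
        prevVal_congr fun j hj => hc (.tau j b) (by simp [compRank, Prod.Lex.toLex_lt_toLex, hj])]
  | live i =>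
    simp only [compFun, hr]
    rw [prevVal_congr fun j hj => hc (.val j) (by simp [compRank, Prod.Lex.toLex_lt_toLex, hj])]
  | val i =>
    simp only [compFun]
    rw [hc (.live i) (by simp [compRank, Prod.Lex.toLex_lt_toLex]),
      hc (.car i (Fin.last l)) (by simp [compRank, Prod.Lex.toLex_lt_toLex])]

/-- The majority is `ab ⊕ ac ⊕ bc`, hence three Toffoli gates. -/
theorem HasFlip.atLeastTwo {Q : Type*} [Fintype Q] [DecidableEq Q] [Nontrivial Q] {a b c t : Q}
    (hab : a ≠ b) (hac : a ≠ c) (hbc : b ≠ c) (ha : a ≠ t) (hb : b ≠ t) (hc : c ≠ t) :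
    HasFlip n 33 t fun s => Bool.atLeastTwo (s a) (s b) (s c) := by
  have := ((HasFlip.toffoli (n := n) hab ha hb).xor (HasFlip.toffoli hac ha hc)).xor
    (HasFlip.toffoli hbc hb hc)
  have e : (fun s : Q → Bool => (s a && s b) ^^ (s a && s c) ^^ (s b && s c)) =
      fun s => Bool.atLeastTwo (s a) (s b) (s c) := by
    funext s; cases s a <;> cases s b <;> cases s c <;> rfl
  rwa [e] at this

theorem hasFlip_compFun (z : CompWire K l) : HasFlip n 33 (compW n w K l E z) (compFun z) := by
  cases z with
  | tau i b =>
    have h1 := (HasFlip.cnot (n := n) (a := regW n w K l E (some (i, some b)))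
      (c := compW n w K l E (.tau i b)) (by simp [regW_apply, compW_apply])).xor
      (HasFlip.cnot (n := n) (a := compW n w K l E (.car i b.castSucc)) (by simp [compW_apply]))
    by_cases hi : (i : ℕ) = 0
    · have e : compFun (n := n) (w := w) (E := E) (.tau i b) = fun s =>
          s (regW n w K l E (some (i, some b))) ^^ s (compW n w K l E (.car i b.castSucc)) := by
        funext s; simp [compFun, prevVal, hi]
      rw [e]; exact h1.mono (by norm_num)
    · have e : compFun (n := n) (w := w) (E := E) (.tau i b) = fun s =>
          s (compW n w K l E (.tau ⟨i - 1, by omega⟩ b)) ^^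
          (s (regW n w K l E (some (i, some b))) ^^ s (compW n w K l E (.car i b.castSucc))) := by
        funext s; simp [compFun, prevVal, hi]
      rw [e]
      refine HasFlip.mono (HasFlip.xor (HasFlip.cnot ?_) h1) (by norm_num)
      simp [compW_apply, Fin.ext_iff]; omega
  | car i b =>
    cases b using Fin.cases with
    | zero =>
      by_cases hi : (i : ℕ) = 0
      -- The carry-in of the first slot is zero, written here as two flips that cancel.
      · have e : compFun (n := n) (w := w) (E := E) (l := l) (.car i 0) = fun s => true ^^ true := by
          funext s; simp [compFun, hi]
        rw [e]
        exact HasFlip.mono (HasFlip.xor (HasFlip.not _) (HasFlip.not _)) (by norm_num)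
      · have e : compFun (n := n) (w := w) (E := E) (l := l) (.car i 0) = fun s => true := by
          funext s; simp [compFun]; omega
        rw [e]
        exact HasFlip.mono (HasFlip.not _) (by norm_num)
    | succ b =>
      by_cases hi : (i : ℕ) = 0
      · have e : compFun (n := n) (w := w) (E := E) (.car i b.succ) = fun s =>
            s (regW n w K l E (some (i, some b))) && s (compW n w K l E (.car i b.castSucc)) := by
          funext s; simp [compFun, prevVal, hi, Bool.atLeastTwo]
        rw [e]
        refine HasFlip.mono (HasFlip.toffoli ?_ ?_ ?_) (by norm_num) <;>
          simp [compW_apply, regW_apply, Fin.ext_iff]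
      · have e : compFun (n := n) (w := w) (E := E) (.car i b.succ) = fun s =>
            Bool.atLeastTwo (s (compW n w K l E (.tau ⟨i - 1, by omega⟩ b)))
            (s (regW n w K l E (some (i, some b)))) (s (compW n w K l E (.car i b.castSucc))) := by
          funext s; simp [compFun, prevVal, hi]
        rw [e]
        refine HasFlip.atLeastTwo ?_ ?_ ?_ ?_ ?_ ?_ <;>
          simp [compW_apply, regW_apply, Fin.ext_iff]
  | live i =>
    by_cases hi : (i : ℕ) = 0
    · have e : compFun (n := n) (w := w) (E := E) (l := l) (.live i) = fun s =>
          !s (regW n w K l E (some (i, none))) := by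
        funext s; simp [compFun, prevVal, hi]
      rw [e]
      exact HasFlip.mono (HasFlip.not_wire (by simp [compW_apply, regW_apply])) (by norm_num)
    · have e : compFun (n := n) (w := w) (E := E) (l := l) (.live i) = fun s =>
          s (compW n w K l E (.val ⟨i - 1, by omega⟩)) && !s (regW n w K l E (some (i, none))) := by
        funext s; simp [compFun, prevVal, hi]
      rw [e]
      refine HasFlip.mono (HasFlip.not_and ?_ ?_ ?_) (by norm_num) <;> simp [compW_apply, regW_apply]
  | val i =>
    refine HasFlip.mono (HasFlip.not_and (a := compW n w K l E (.live i))
      (b := compW n w K l E (.car i (Fin.last l))) ?_ ?_ ?_) (by norm_num) <;> simp [compW_apply]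

theorem exists_compute_word : ∃ σ : Equiv.Perm (SysWire n w ⊕ SlotWire K l E → Bool),
    HasCircuit n 0 (K * (2 * l + 3) * 33) (fun _ => permMat σ) ∧
    (∀ s k, (∀ i, compW n w K l E i ≠ k) → σ s k = s k) ∧
    ∀ s full : SysWire n w ⊕ SlotWire K l E → Bool,
      (∀ k, (∀ i, compW n w K l E i ≠ k) → full k = s k) →
      (∀ i, s (compW n w K l E i) = false) →
      (∀ i, full (compW n w K l E i) = compFun i full) → σ s = full := by
  obtain ⟨σ, h1, h2, h3⟩ := exists_compute (n := n) (compW n w K l E) compRank compFun 33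
    Finset.univ (fun z _ => hasFlip_compFun z) fun z _ s s' h => compFun_congr z h
  refine ⟨σ, h1.mono le_rfl (Nat.mul_le_mul_right _ ?_), fun s k hk => h2 s k fun i _ => hk i,
    fun s full hf hs hc => h3 s full (fun k hk => hf k fun i => hk i (Finset.mem_univ _))
      (fun i _ => hs i) fun i _ => hc i⟩
  rw [Finset.card_univ]; exact card_compWire_le K l

end SlotWires

/-! ### Words as bit strings and their amplitudes -/

section Words

variable {n w K l : ℕ} {E : Type} [Fintype E] [DecidableEq E]

/-- Words of `K` binary gaps, and a sign. -/
abbrev BinaryWord (K l : ℕ) := (Fin K → Fin (2 ^ l) × Bool) × Bool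

/-- The bits of a word. -/
def regBits (x : BinaryWord K l) : RegIdx K l → Bool
  | none => x.2
  | some (i, none) => (x.1 i).2
  | some (i, some b) => ((x.1 i).1 : ℕ).testBit b

/-- No bit string is wasted, so the superposition over all register states created by the rotations
is a sum over words. -/
theorem regBits_bijective : Function.Bijective (regBits (K := K) (l := l)) := by
  rw [Fintype.bijective_iff_injective_and_card]
  constructor
  · intro x y h
    refine Prod.ext (funext fun i => Prod.ext (Fin.ext (Nat.eq_of_testBit_eq fun b => ?_)) ?_) ?_
    · by_cases hb : b < l
      · exact congrFun h (some (i, some ⟨b, hb⟩))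
      · have hb' : 2 ^ l ≤ 2 ^ b := Nat.pow_le_pow_right (by norm_num) (not_lt.1 hb)
        rw [Nat.testBit_lt_two_pow ((x.1 i).1.2.trans_le hb'),
          Nat.testBit_lt_two_pow ((y.1 i).1.2.trans_le hb')]
    · exact congrFun h (some (i, none))
    · exact congrFun h none
  · simp only [Fintype.card_prod, Fintype.card_fun, Fintype.card_fin, Fintype.card_bool,
      Fintype.card_option]
    rw [← pow_succ, ← pow_mul, ← pow_succ]
    congr 1; ring

/-- The gaps of a word. -/
def wordGap (x : BinaryWord K l) (i : ℕ) : BitVec l :=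
  if h : i < K then BitVec.ofFin (x.1 ⟨i, h⟩).1 else 0

/-- The stop bits of a word. -/
def wordStop (x : BinaryWord K l) (i : ℕ) : Bool := if h : i < K then (x.1 ⟨i, h⟩).2 else false

/-- The values of the computed wires. -/
def compVal (x : BinaryWord K l) : CompWire K l → Bool
  | .tau i b => (walkPos (wordGap x) (i + 1)).getLsbD b
  | .car i b => walkCarry (wordGap x) i b
  | .live i => walkAlive (wordGap x) (wordStop x) i && !wordStop x i
  | .val i => walkAlive (wordGap x) (wordStop x) (i + 1)

/-- A state of the ancilla qubits. -/
def slotState (c : E → Bool) (r : RegIdx K l → Bool) (v : CompWire K l → Bool) :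
    SlotWire K l E → Bool
  | .ext e => c e
  | .reg g => r g
  | .chain _ => false
  | .comp z => v z
  | .qbit => false

/-- The intended values satisfy the equations of the adder, so the reversible computation must end
in them. -/
theorem compFun_compVal (x : BinaryWord K l) (c : E → Bool) (t : SysWire n w → Bool)
    (z : CompWire K l) :
    compFun z (Sum.elim t (slotState c (regBits x) (compVal x))) = compVal x z := by
  have hgap : ∀ (i : Fin K) (b : Fin l), (wordGap x i).getLsbD b = ((x.1 i).1 : ℕ).testBit b := by
    intro i b
    rw [wordGap, dif_pos i.2]; rfl
  have hpos : ∀ (i : Fin K) (b : Fin l), prevVal false i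
      (fun j => (walkPos (wordGap x) (j + 1)).getLsbD b) = (walkPos (wordGap x) i).getLsbD b := by
    intro i b
    rw [prevVal]
    split_ifs with hi
    · rw [hi]; simp [walkPos]
    · rw [Nat.sub_add_cancel (by omega)]
  cases z with
  | tau i b =>
    have := BitVec.getLsbD_add_add_bool b.2 (walkPos (wordGap x) i) (wordGap x i)
      (decide (0 < (i : ℕ)))
    simp only [compFun, compW_apply, regW_apply, Sum.elim_inr, slotState, compVal,
      regBits, hpos, ← hgap]
    exact this.symm
  | car i b =>
    cases b using Fin.cases with
    | zero => simp [compFun, compVal, walkCarry]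
    | succ b =>
      simp only [compFun, compW_apply, regW_apply, Sum.elim_inr, slotState, compVal,
        regBits, hpos, ← hgap, Fin.cases_succ]
      exact (BitVec.carry_succ _ _ _ _).symm
  | live i =>
    simp only [compFun, compW_apply, regW_apply, Sum.elim_inr, slotState, compVal,
      regBits]
    have h1 : wordStop x i = (x.1 i).2 := by rw [wordStop, dif_pos i.2]
    rw [h1]
    congr 1
    rw [prevVal]
    split_ifs with hi
    · rw [hi]; rfl
    · rw [Nat.sub_add_cancel (by omega)]
  | val i => rfl

theorem slotAt_word (x : BinaryWord K l) (i : ℕ) (hi : i < K) :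
    slotAt (2 ^ l) (List.ofFn fun k => binaryGap l (x.1 k)) 0 i =
      if walkAlive (wordGap x) (wordStop x) (i + 1) then
        some (walkPos (wordGap x) (i + 1)).toNat else none := by
  refine slotAt_eq_walkPos (fun j hj => ?_) i (by simpa using hi)
  rw [List.length_ofFn] at hj
  rw [List.getElem_ofFn, binaryGap, wordStop, wordGap, dif_pos hj, dif_pos hj]
  rfl

/-- The probability of the value `v` of a bit of a random word. -/
noncomputable def regWeight (q : ℝ) : RegIdx K l → Bool → ℝ
  | none, _ => 1 / 2
  | some (_, none), v => stopWeight q l v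
  | some (_, some b), v => bitWeight q b v

theorem prod_regWeight (q : ℝ) (x : BinaryWord K l) :
    ∏ g, regWeight q g (regBits x g) = wordWeight (gapWeight q l) x := by
  rw [Fintype.prod_option, Fintype.prod_prod_type, wordWeight]
  simp only [Fintype.prod_option, regWeight, regBits, gapWeight]
  ring

theorem regWeight_nonneg {q : ℝ} (hq : 0 ≤ q) (hq' : q ≤ 1) (g : RegIdx K l) (v : Bool) :
    0 ≤ regWeight q g v := by
  rcases g with _ | ⟨i, _ | b⟩
  · simp [regWeight]
  · exact stopWeight_nonneg hq hq' _ _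
  · exact bitWeight_nonneg hq _ _

theorem regWeight_add {q : ℝ} (hq : 0 ≤ q) (g : RegIdx K l) :
    regWeight q g false + regWeight q g true = 1 := by
  rcases g with _ | ⟨i, _ | b⟩
  · norm_num [regWeight]
  · exact stopWeight_add _ _
  · exact bitWeight_add hq _

/-- The preparation of the amplitudes of the bits of a word. -/
noncomputable def regRotation (q : ℝ) (g : RegIdx K l) : Matrix Bool Bool ℂ :=
  rotation √(regWeight q g false) √(regWeight q g true)

theorem regRotation_apply (q : ℝ) (g : RegIdx K l) (v : Bool) :
    regRotation q g v false = (√(regWeight q g v) : ℂ) := by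
  cases v <;> simp [regRotation, rotation]

theorem regRotation_unitary {q : ℝ} (hq : 0 ≤ q) (hq' : q ≤ 1) (g : RegIdx K l) :
    (regRotation q g).conjTranspose * regRotation q g = 1 := by
  refine rotation_unitary ?_
  rw [Real.sq_sqrt (regWeight_nonneg hq hq' _ _), Real.sq_sqrt (regWeight_nonneg hq hq' _ _),
    regWeight_add hq]

theorem prod_regRotation {q : ℝ} (hq : 0 ≤ q) (hq' : q ≤ 1) (x : BinaryWord K l) :
    ∏ g, regRotation q g (regBits x g) false = (√(wordWeight (gapWeight q l) x) : ℂ) := by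
  simp only [regRotation_apply]
  rw [← prod_regWeight, ← Complex.ofReal_prod]
  congr 1
  exact (Real.sqrt_prod _ fun g _ => regWeight_nonneg hq hq' _ _).symm

theorem xorPerm_slotState (x : BinaryWord K l) (c : E → Bool) (t : SysWire n w → Bool) :
    xorPerm (regW n w K l E) (regBits x)
      (Sum.elim t (slotState c (fun _ => false) fun _ => false)) =
      Sum.elim t (slotState c (regBits x) fun _ => false) := by
  symm
  rw [eq_xorPerm_iff _ fun i => rfl]
  refine ⟨fun i => rfl, fun k hk => ?_⟩
  rcases k with k | k
  · rfl
  · cases k with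
    | reg g => exact absurd rfl (hk g)
    | _ => rfl

end Words

/-! ### Running a circuit on a subset of the wires -/

section Embedding

variable {Q W : Type*} [Fintype Q] [DecidableEq Q] [Fintype W] [DecidableEq W]

theorem embEquiv_symm_apply (ι : W ↪ Q) (p : (W → Bool) × (OffWire ι → Bool)) (i : W) :
    (embEquiv ι).symm p (ι i) = p.1 i :=
  congrFun (congrArg Prod.fst ((embEquiv ι).apply_symm_apply p)) i

theorem embEquiv_symm_apply_of_notMem (ι : W ↪ Q)
    (p : (W → Bool) × (OffWire ι → Bool)) {k : Q} (hk : k ∉ Set.range ι) :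
    (embEquiv ι).symm p k = p.2 ⟨k, hk⟩ :=
  congrFun (congrArg Prod.snd ((embEquiv ι).apply_symm_apply p)) ⟨k, hk⟩

theorem diagonal_eq_locally {B L O : Type*} [Fintype B] [DecidableEq B] [Fintype L] [DecidableEq L]
    [Fintype O] [DecidableEq O] (e : B ≃ L × O) (d : B → ℂ) :
    Matrix.diagonal d = locally e fun o => Matrix.diagonal fun u => d (e.symm (u, o)) := by
  rw [locally_diagonal]
  simp

variable {S R Rd : Type*} [Fintype S] [DecidableEq S] [Fintype R] [DecidableEq R] [Fintype Rd]
  [DecidableEq Rd]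

theorem attach_eq_colMat (c : R → Bool) : attach S c = colMat fun t : S → Bool => Sum.elim t c := rfl

theorem conjTranspose_attach_mul (c : R → Bool) : (attach S c).conjTranspose * attach S c = 1 :=
  conjTranspose_colMat_mul fun _ _ h => funext fun k => congrFun h (.inl k)

/-- The inclusion of the system wires and the wires `κ`. -/
def sysEmb (S : Type*) (κ : Rd ↪ R) : S ⊕ Rd ↪ S ⊕ R := Function.Embedding.sumMap (.refl S) κ

theorem notMem_range_sysEmb {κ : Rd ↪ R} {k : R} (hk : ∀ j, κ j ≠ k) :
    (.inr k : S ⊕ R) ∉ Set.range (sysEmb S κ) := by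
  rintro ⟨j | j, hj⟩
  · simp [sysEmb] at hj
  · exact hk j (by simpa [sysEmb] using hj)

theorem attach_eq_blockCol_mul (κ : Rd ↪ R) (c : R → Bool) :
    attach S c = blockCol (embEquiv (sysEmb S κ)) (fun k => Sum.elim (fun _ => false) c k.wire) *
      attach S fun k => c (κ k) := by
  ext s t
  rw [blockCol_mul_apply, attach, attach]
  have : s = Sum.elim t c ↔
      ((embEquiv (sysEmb S κ)) s).2 = (fun k => Sum.elim (fun _ => false) c k.wire) ∧
      ((embEquiv (sysEmb S κ)) s).1 = Sum.elim t fun k => c (κ k) := by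
    constructor
    · rintro rfl
      refine ⟨funext fun k => ?_, funext fun k => ?_⟩
      · obtain ⟨k | k, hk⟩ := k
        · exact absurd ⟨.inl k, rfl⟩ hk
        · rfl
      · rcases k with k | k <;> rfl
    · rintro ⟨h1, h2⟩
      funext k
      rcases k with k | k
      · exact congrFun h2 (.inl k)
      · by_cases hk : (.inr k : S ⊕ R) ∈ Set.range (sysEmb S κ)
        · obtain ⟨j | j, hj⟩ := hk
          · simp [sysEmb] at hj
          · have h3 := congrFun h2 (.inr j)
            have hj' : κ j = k := by simpa [sysEmb] using hj
            subst hj'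
            exact h3
        · exact congrFun h1 ⟨_, hk⟩
  simp only [this]
  split_ifs <;> simp_all

/-- The other ancillas are in a fixed basis state, so a single block of the controlled operator
acts, and including them by an isometry does not increase the error. -/
theorem norm_locally_mul_attach_sub_le (κ : Rd ↪ R) (c : R → Bool)
    (M : (OffWire (sysEmb S κ) → Bool) → Matrix (S ⊕ Rd → Bool) (S ⊕ Rd → Bool) ℂ)
    (V : Matrix (S → Bool) (S → Bool) ℂ) :
    ‖locally (embEquiv (sysEmb S κ)) M * attach S c - attach S c * V‖ ≤
      ‖M (fun k => Sum.elim (fun _ => false) c k.wire) * attach S (fun k => c (κ k)) -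
        attach S (fun k => c (κ k)) * V‖ := by
  rw [attach_eq_blockCol_mul κ c, ← Matrix.mul_assoc, locally_mul_blockCol, Matrix.mul_assoc,
    Matrix.mul_assoc, ← Matrix.mul_sub]
  have := norm_mul_le_of_le (norm_le_one_of_conjTranspose_mul_self (conjTranspose_blockCol_mul
    (embEquiv (sysEmb S κ)) (fun k => Sum.elim (fun _ => false) c k.wire)))
    (le_refl ‖M (fun k => Sum.elim (fun _ => false) c k.wire) * attach S (fun k => c (κ k)) -
        attach S (fun k => c (κ k)) * V‖)
  simpa using this

/-- The conjugate of `B` by `A` simulates the conjugate of `q` by `V` if `A` simulates `V` and `B`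
simulates `q`. -/
theorem norm_conj_sub_le {I β : Type*} [Fintype I] [DecidableEq I] [Fintype β] [DecidableEq β]
    {A B : Matrix I I ℂ} {J : Matrix I β ℂ} {V q : Matrix β β ℂ} {δ : ℝ}
    (hA : A.conjTranspose * A = 1) (hV : V.conjTranspose * V = 1) (hB : ‖B‖ ≤ 1) (hq : ‖q‖ ≤ 1)
    (hBJ : B * J = J * q) (h : ‖A * J - J * V‖ ≤ δ) :
    ‖A.conjTranspose * B * A * J - J * (V.conjTranspose * q * V)‖ ≤ 2 * δ := by
  have hV' := mul_eq_one_comm.1 hV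
  have nA : ‖A.conjTranspose‖ ≤ 1 :=
    norm_le_one_of_conjTranspose_mul_self (conjTranspose_unitary hA)
  have nV : ‖V‖ ≤ 1 := norm_le_one_of_conjTranspose_mul_self hV
  have nV' : ‖V.conjTranspose‖ ≤ 1 :=
    norm_le_one_of_conjTranspose_mul_self (conjTranspose_unitary hV)
  -- One error comes from `A` and one from `A†`; hence the factor 2.
  have e : A.conjTranspose * B * A * J - J * (V.conjTranspose * q * V) =
      A.conjTranspose * B * (A * J - J * V) -
        A.conjTranspose * (A * J - J * V) * V.conjTranspose * q * V := by
    have e1 : A.conjTranspose * B * (A * J - J * V) =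
        A.conjTranspose * B * A * J - A.conjTranspose * J * q * V := by
      rw [Matrix.mul_sub, ← Matrix.mul_assoc, ← Matrix.mul_assoc,
        Matrix.mul_assoc A.conjTranspose B J, hBJ, ← Matrix.mul_assoc]
    have e2 : A.conjTranspose * (A * J - J * V) * V.conjTranspose * q * V =
        J * (V.conjTranspose * q * V) - A.conjTranspose * J * q * V := by
      rw [Matrix.mul_sub, ← Matrix.mul_assoc, hA, Matrix.one_mul, Matrix.sub_mul, Matrix.sub_mul,
        Matrix.sub_mul, ← Matrix.mul_assoc, Matrix.mul_assoc (A.conjTranspose * J), hV',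
        Matrix.mul_one]
      simp only [Matrix.mul_assoc]
    rw [e1, e2]; abel
  rw [e]
  have h1 := norm_mul_le_of_le (norm_mul_le_of_le nA hB) h
  have h2 := norm_mul_le_of_le (norm_mul_le_of_le (norm_mul_le_of_le (norm_mul_le_of_le nA h) nV')
    hq) nV
  refine (norm_sub_le _ _).trans ?_
  linarith

end Embedding

/-! ### A controlled query inside the driving evolution -/

section SlotOperator

variable {n w K l : ℕ} {E : Type} [Fintype E] [DecidableEq E]

/-- The wires of the driving circuit in a slot: its time bits are the position bits of the slot. -/
def timeEmb (E : Type) (l : ℕ) (i : Fin K) : Fin l ⊕ E ↪ SlotWire K l E where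
  toFun := Sum.elim (fun b => .comp (.tau i b)) .ext
  inj' := by
    rintro (b | e) (b' | e') h <;> simp_all

theorem timeEmb_inl (i : Fin K) (b : Fin l) : timeEmb E l i (.inl b) = .comp (.tau i b) := rfl

theorem timeEmb_inr (i : Fin K) (e : E) : timeEmb E l i (.inr e) = .ext e := rfl

/-- The wires of a query of the simulation. -/
def queryEmb (n w K l : ℕ) (E : Type) : Fin n ⊕ Unit ↪ SysWire n w ⊕ SlotWire K l E where
  toFun := Sum.elim (fun j => .inl (.inl (.inl j))) fun _ => .inr .qbit
  inj' := by
    rintro (b | e) (b' | e') h <;> simp_all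

/-- The controlled query of a slot. -/
noncomputable def slotQuery (n w : ℕ) (E : Type) [Fintype E] [DecidableEq E] (l : ℕ) (i : Fin K)
    (x : (Fin n → Bool) → Bool) :
    Matrix (SysWire n w ⊕ SlotWire K l E → Bool) (SysWire n w ⊕ SlotWire K l E → Bool) ℂ :=
  Matrix.diagonal fun s => (if s (.inr (.comp (.val i))) then Complex.I else 1) *
    if (s (.inr .qbit) ^^ (s (.inl (.inl (.inr ()))) && s (.inr (.comp (.val i))))) &&
      x fun j => s (.inl (.inl (.inl j))) then -1 else 1

/-- The control is obtained by copying "target bit and event" onto the clean wire `qbit` with a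
Toffoli gate, querying with that wire as target, and uncopying. With the controlled phase `i` this
takes `1 + 2 * 11` gates. -/
theorem hasCircuit_slotQuery (i : Fin K) :
    HasCircuit n 1 23 (slotQuery n w E l i) := by
  have hF : HasFlip n 11 (.inr .qbit : SysWire n w ⊕ SlotWire K l E)
      fun s => s (.inl (.inl (.inr ()))) && s (.inr (.comp (.val i))) :=
    HasFlip.toffoli (by simp) (by simp) (by simp)
  have hI := HasCircuit.diagonal_single (n := n)
    (.inr (.comp (.val i)) : SysWire n w ⊕ SlotWire K l E) (z := fun v => if v then Complex.I else 1)
    (by intro v; cases v <;> simp)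
  have := hI.mul ((hF.conjTranspose.mul (HasCircuit.query (queryEmb n w K l E))).mul hF)
  refine (this.mono (by norm_num) (by norm_num)).congr fun x => ?_
  rw [discreteQuery, conjTranspose_permMat_mul, Matrix.diagonal_mul_diagonal, slotQuery]
  congr 1

/-- The operator of a slot: the driving evolution up to the position of the slot, the controlled
query, and the inverse evolution. -/
noncomputable def slotOp (D : List (TwoQubitGate (SysWire n w ⊕ (Fin l ⊕ E)))) (i : Fin K)
    (x : (Fin n → Bool) → Bool) :
    Matrix (SysWire n w ⊕ SlotWire K l E → Bool) (SysWire n w ⊕ SlotWire K l E → Bool) ℂ :=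
  (locally (embEquiv (sysEmb (SysWire n w) (timeEmb E l i))) fun _ => evalGates D).conjTranspose *
    slotQuery n w E l i x *
    locally (embEquiv (sysEmb (SysWire n w) (timeEmb E l i))) fun _ => evalGates D

theorem hasCircuit_slotOp (D : List (TwoQubitGate (SysWire n w ⊕ (Fin l ⊕ E)))) (i : Fin K) :
    HasCircuit n 1 (2 * D.length + 23) (slotOp D i) := by
  have hD := HasCircuit.submatrix_embedding (n := n) (sysEmb (SysWire n w) (timeEmb E l i)) D
  exact ((hD.conjTranspose.mul (hasCircuit_slotQuery i)).mul hD).mono (by omega) (by omega)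

theorem evalGates_unitary {Q : Type*} [Fintype Q] [DecidableEq Q] (D : List (TwoQubitGate Q)) :
    (evalGates D).conjTranspose * evalGates D = 1 := by
  induction D using List.reverseRecOn with
  | nil => simp [evalGates]
  | append_singleton D G ih =>
    have e : evalGates (D ++ [G]) = G.toMatrix * evalGates D := by
      rw [evalGates, List.foldl_append]; rfl
    rw [e]
    refine mul_unitary ?_ ih
    rw [toMatrix_eq_locally]
    exact locally_unitary _ fun _ => Matrix.mem_unitaryGroup_iff'.1 G.gate.2

/-- Without an event the query is the identity, and the driving circuit cancels against its inverse
whatever its accuracy. The error `2 * δ` therefore occurs only at an event, and the precision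
hypothesis is needed only there. -/
theorem norm_slotOp_mul_attach_sub_le (D : List (TwoQubitGate (SysWire n w ⊕ (Fin l ⊕ E))))
    (i : Fin K) (x : (Fin n → Bool) → Bool) (c : E → Bool) (r : RegIdx K l → Bool)
    (v : CompWire K l → Bool) {t : ℕ} (ht : ∀ b : Fin l, v (.tau i b) = t.testBit b)
    {V : Matrix (SysWire n w → Bool) (SysWire n w → Bool) ℂ} (hV : V.conjTranspose * V = 1) {δ : ℝ}
    (hD : v (.val i) = true → ‖evalGates D * attach (SysWire n w)
        (Sum.elim (fun b : Fin l => t.testBit b) c) -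
      attach (SysWire n w) (Sum.elim (fun b : Fin l => t.testBit b) c) * V‖ ≤ δ) :
    ‖slotOp D i x * attach (SysWire n w) (slotState c r v) - attach (SysWire n w) (slotState c r v) *
      (if v (.val i) then eventOp (sysBit x) V else 1)‖ ≤ if v (.val i) then 2 * δ else 0 := by
  rw [slotOp, slotQuery, diagonal_eq_locally (embEquiv (sysEmb (SysWire n w) (timeEmb E l i))),
    conjTranspose_locally, locally_mul, locally_mul]
  refine (norm_locally_mul_attach_sub_le (timeEmb E l i) (slotState c r v) _ _).trans ?_
  have hsys : ∀ (o : OffWire (sysEmb (SysWire n w) (timeEmb E l i)) → Bool)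
      (u : SysWire n w ⊕ (Fin l ⊕ E) → Bool) (k : SysWire n w),
      (embEquiv (sysEmb (SysWire n w) (timeEmb E l i))).symm (u, o) (.inl k) = u (.inl k) :=
    fun o u k => embEquiv_symm_apply (sysEmb (SysWire n w) (timeEmb E l i)) (u, o) (.inl k)
  have hval : (.inr (.comp (.val i)) : SysWire n w ⊕ SlotWire K l E) ∉
      Set.range (sysEmb (SysWire n w) (timeEmb E l i)) :=
    notMem_range_sysEmb (by rintro (b | e) <;> simp [timeEmb_inl, timeEmb_inr])
  have hq : (.inr .qbit : SysWire n w ⊕ SlotWire K l E) ∉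
      Set.range (sysEmb (SysWire n w) (timeEmb E l i)) :=
    notMem_range_sysEmb (by rintro (b | e) <;> simp [timeEmb_inl, timeEmb_inr])
  have hc : (fun k => slotState c r v (timeEmb E l i k)) =
      Sum.elim (fun b : Fin l => t.testBit b) c := by
    funext k
    rcases k with b | e
    · exact ht b
    · rfl
  rw [hc]
  simp only [hsys, embEquiv_symm_apply_of_notMem _ _ hval, embEquiv_symm_apply_of_notMem _ _ hq,
    Sum.elim_inr, slotState]
  cases hv : v (.val i)
  · have : (Matrix.diagonal fun u : SysWire n w ⊕ (Fin l ⊕ E) → Bool =>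
      (if false = true then Complex.I else 1) *
        if ((false ^^ (u (.inl (.inl (.inr ()))) && false)) &&
          x fun j => u (.inl (.inl (.inl j)))) = true then (-1 : ℂ) else 1) = 1 := by
      rw [← Matrix.diagonal_one]; congr 1; funext u; simp
    rw [this, Matrix.mul_one, evalGates_unitary]
    simp
  · have e : (Matrix.diagonal fun u : SysWire n w ⊕ (Fin l ⊕ E) → Bool =>
      (if true = true then Complex.I else 1) *
        if ((false ^^ (u (.inl (.inl (.inr ()))) && true)) &&
          x fun j => u (.inl (.inl (.inl j)))) = true then (-1 : ℂ) else 1) =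
        Complex.I • discreteQuery fun u : SysWire n w ⊕ (Fin l ⊕ E) → Bool =>
          sysBit x fun k => u (.inl k) := by
      rw [discreteQuery, ← Matrix.diagonal_smul]
      congr 1; funext u
      simp [sysBit, wireBit]
    rw [e, if_pos rfl, if_pos rfl]
    have hq1 : ∀ {β : Type} [Fintype β] [DecidableEq β] (f : β → Bool), ‖discreteQuery f‖ ≤ 1 :=
      fun f => norm_le_one_of_conjTranspose_mul_self (by
        rw [conjTranspose_discreteQuery, discreteQuery_mul_self])
    have key := norm_conj_sub_le (evalGates_unitary D) hV (B := discreteQuery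
      fun u : SysWire n w ⊕ (Fin l ⊕ E) → Bool => sysBit x fun k => u (.inl k))
      (q := discreteQuery (sysBit x)) (hq1 _) (hq1 _)
      (by rw [attach_eq_colMat]; exact diagonal_mul_colMat fun t => rfl) (hD hv)
    have e2 : (evalGates D).conjTranspose * (Complex.I • discreteQuery
        fun u : SysWire n w ⊕ (Fin l ⊕ E) → Bool => sysBit x fun k => u (.inl k)) * evalGates D *
        attach (SysWire n w) (Sum.elim (fun b : Fin l => t.testBit b) c) -
        attach (SysWire n w) (Sum.elim (fun b : Fin l => t.testBit b) c) * eventOp (sysBit x) V =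
        Complex.I • ((evalGates D).conjTranspose * (discreteQuery
        fun u : SysWire n w ⊕ (Fin l ⊕ E) → Bool => sysBit x fun k => u (.inl k)) * evalGates D *
        attach (SysWire n w) (Sum.elim (fun b : Fin l => t.testBit b) c) -
        attach (SysWire n w) (Sum.elim (fun b : Fin l => t.testBit b) c) *
          (V.conjTranspose * discreteQuery (sysBit x) * V)) := by
      rw [eventOp, smul_sub]
      simp only [Matrix.mul_smul, Matrix.smul_mul]
    rw [e2, norm_smul, Complex.norm_I, one_mul]
    exact key

/-- An inaccurate driving circuit may disturb its own time bits and ancillas, but no other ancilla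
wire. -/
theorem preserves_slotOp (D : List (TwoQubitGate (SysWire n w ⊕ (Fin l ⊕ E)))) (i : Fin K)
    (x : (Fin n → Bool) → Bool) {k : SlotWire K l E} (hk : ∀ j, timeEmb E l i j ≠ k) :
    Preserves (.inr k) (slotOp D i x) := by
  have h := Preserves.locally (notMem_range_sysEmb (S := SysWire n w) hk) fun _ => evalGates D
  exact (h.conjTranspose.mul (Preserves.diagonal _ _)).mul h

end SlotOperator

/-! ### The circuit of one segment -/

section SegmentCircuit

variable {n w K l : ℕ} {E : Type} [Fintype E] [DecidableEq E]

theorem norm_timeProd_mul_sub_le {I β : Type*} [Fintype I] [DecidableEq I] [Fintype β]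
    [DecidableEq β] {A : ℕ → Matrix I I ℂ} {V : ℕ → Matrix β β ℂ} {J : Matrix I β ℂ} {d : ℕ → ℝ}
    (m : ℕ) (hA : ∀ i < m, ‖A i‖ ≤ 1) (hV : ∀ i < m, (V i).conjTranspose * V i = 1)
    (h : ∀ i < m, ‖A i * J - J * V i‖ ≤ d i) :
    ‖timeProd A 0 m * J - J * timeProd V 0 m‖ ≤ ∑ i ∈ Finset.range m, d i := by
  have hVm : ∀ m' ≤ m, (timeProd V 0 m').conjTranspose * timeProd V 0 m' = 1 := by
    intro m'
    induction m' with
    | zero => simp [timeProd]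
    | succ m' ih =>
      intro hm
      rw [timeProd]
      exact mul_unitary (hV _ (by omega)) (ih (by omega))
  have : ∀ m' ≤ m, ‖timeProd A 0 m' * J - J * timeProd V 0 m'‖ ≤
      ∑ i ∈ Finset.range m', d i := by
    intro m'
    induction m' with
    | zero => simp [timeProd]
    | succ m' ih =>
      intro hm
      rw [timeProd, timeProd, zero_add, Finset.sum_range_succ, add_comm]
      exact norm_mul_mul_sub_le (hA m' (by omega))
        (norm_le_one_of_conjTranspose_mul_self (hVm m' (by omega))) (h m' (by omega))
        (ih (by omega))
  exact this m le_rfl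

/-- The sequence of slots of a segment. -/
noncomputable def slotsOp (K : ℕ) (D : List (TwoQubitGate (SysWire n w ⊕ (Fin l ⊕ E)))) (i : ℕ)
    (x : (Fin n → Bool) → Bool) :
    Matrix (SysWire n w ⊕ SlotWire K l E → Bool) (SysWire n w ⊕ SlotWire K l E → Bool) ℂ :=
  if h : i < K then slotOp D ⟨i, h⟩ x else 1

/-- The errors of the slots add, and only slots with an event have one. -/
theorem norm_slots_mul_attach_sub_le (D : List (TwoQubitGate (SysWire n w ⊕ (Fin l ⊕ E))))
    (x : (Fin n → Bool) → Bool) (c : E → Bool) (g : BinaryWord K l)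
    {U : ℕ → Matrix (SysWire n w → Bool) (SysWire n w → Bool) ℂ} {δ : ℝ}
    (hU : ∀ j < 2 ^ l, (U j).conjTranspose * U j = 1)
    (hD : ∀ j < 2 ^ l, ‖evalGates D * attach (SysWire n w)
        (Sum.elim (fun b : Fin l => j.testBit b) c) -
      attach (SysWire n w) (Sum.elim (fun b : Fin l => j.testBit b) c) * U j‖ ≤ δ) :
    ‖timeProd (fun i => slotsOp K D i x) 0 K *
        attach (SysWire n w) (slotState c (regBits g) (compVal g)) -
      attach (SysWire n w) (slotState c (regBits g) (compVal g)) *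
        wordProd (fun j => eventOp (sysBit x) (U j)) (2 ^ l)
          (List.ofFn fun i => binaryGap l (g.1 i)) 0‖ ≤
      2 * wordCount (2 ^ l) (List.ofFn fun i => binaryGap l (g.1 i)) 0 * δ := by
  have h1 := timeProd_slotAt (fun j => eventOp (sysBit x) (U j)) (2 ^ l)
    (List.ofFn fun i => binaryGap l (g.1 i)) 0
  have h2 := sum_slotAt (2 ^ l) (List.ofFn fun i => binaryGap l (g.1 i)) 0
  rw [List.length_ofFn] at h1 h2
  rw [← h1, ← h2, Finset.mul_sum, Finset.sum_mul]
  refine norm_timeProd_mul_sub_le K (fun i hi => ?_) (fun i hi => ?_) fun i hi => ?_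
  · rw [slotsOp, dif_pos hi]
    exact norm_le_one_of_conjTranspose_mul_self ((hasCircuit_slotOp D _).unitary x)
  · cases ht : slotAt (2 ^ l) (List.ofFn fun i => binaryGap l (g.1 i)) 0 i with
    | none => simp
    | some t => exact eventOp_unitary _ (hU t (slotAt_lt ht))
  · rw [slotsOp, dif_pos hi, slotAt_word g i hi]
    have hlt : (walkPos (wordGap g) (i + 1)).toNat < 2 ^ l := BitVec.isLt _
    have key := norm_slotOp_mul_attach_sub_le D ⟨i, hi⟩ x c (regBits g) (compVal g)
      (t := (walkPos (wordGap g) (i + 1)).toNat) (fun b => rfl) (hU _ hlt) fun _ => hD _ hlt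
    have hv : compVal g (.val ⟨i, hi⟩) = walkAlive (wordGap g) (wordStop g) (i + 1) := rfl
    rw [hv] at key
    cases ha : walkAlive (wordGap g) (wordStop g) (i + 1)
    · simpa [ha] using key
    · simpa [ha] using key

/-- Even the error of an operator that preserves a wire lives on states with the original value of
that wire. This supplies the support condition for the projection of the error terms. -/
theorem supported_sub {C : Type*} [Fintype C] [DecidableEq C] {Q : Type*} [Fintype Q]
    [DecidableEq Q] {k : Q} {v : Bool}
    {A : Matrix (Q → Bool) (Q → Bool) ℂ} (hA : Preserves k A) {b : C → Q → Bool}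
    (hb : ∀ t, b t k = v) (V : Matrix C C ℂ) {s : Q → Bool} {t : C}
    (h : (A * colMat b - colMat b * V) s t ≠ 0) : s k = v := by
  by_contra hs
  refine h ?_
  rw [Matrix.sub_apply, mul_colMat_apply, hA s (b t) (by rwa [hb]), Matrix.mul_apply,
    Finset.sum_eq_zero, sub_zero]
  intro r _
  rw [colMat, if_neg, zero_mul]
  rintro rfl
  exact hs (hb r)

/-- A segment of the interaction picture evolution is simulated by a circuit that depends neither on
the driving evolution nor on the segment, except through the driving circuit. -/
theorem exists_segment_circuit (K : ℕ) (D : List (TwoQubitGate (SysWire n w ⊕ (Fin l ⊕ E))))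
    {α : ℝ} (hα : IsSegment α (2 ^ l)) :
    ∃ A : ((Fin n → Bool) → Bool) → Matrix (SysWire n w ⊕ SlotWire K l E → Bool)
        (SysWire n w ⊕ SlotWire K l E → Bool) ℂ,
      HasCircuit n (3 * K) (800 * ((K + 1) * (D.length + l + 1))) A ∧
      ∀ (c : E → Bool) (U : ℕ → Matrix (SysWire n w → Bool) (SysWire n w → Bool) ℂ) (δ : ℝ),
        (∀ j < 2 ^ l, (U j).conjTranspose * U j = 1) →
        (∀ j < 2 ^ l, ‖evalGates D * attach (SysWire n w)
            (Sum.elim (fun b : Fin l => j.testBit b) c) -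
          attach (SysWire n w) (Sum.elim (fun b : Fin l => j.testBit b) c) * U j‖ ≤ δ) →
        ∀ x, ‖A x * attach (SysWire n w) (slotState c (fun _ => false) fun _ => false) -
          attach (SysWire n w) (slotState c (fun _ => false) fun _ => false) *
            segmentProd (sysBit x) U α 0 (2 ^ l)‖ ≤ 16 / K.factorial + 10 * δ := by
  have hp := hα.eventProb_pos
  have hq : 0 ≤ 1 - eventProb α := by linarith [hα.eventProb_lt_one]
  have hq' : 1 - eventProb α ≤ 1 := by linarith
  have hw := isGeometric_gapWeight hp hα.eventProb_lt_one.le l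
  set u : RegIdx K l → Matrix Bool Bool ℂ := fun g => regRotation (1 - eventProb α) g
  have hne : ∀ i j, regW n w K l E i ≠ chainW n w K l E j := fun i j => by
    simp [regW_apply, chainW_apply]
  obtain ⟨φ, hR, hφ⟩ := exists_reflection (n := n) (regW n w K l E) (chainW n w K l E) hne
  obtain ⟨σ, hσ, hσ1, hσ2⟩ := exists_compute_word (n := n) (w := w) (K := K) (l := l) (E := E)
  have hP := hasCircuit_wireProd (n := n) (regW n w K l E)
    (fun g => regRotation_unitary hq hq' g) Finset.univ
  set P := wireProd (regW n w K l E) u Finset.univ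
  set Ph : Matrix (SysWire n w ⊕ SlotWire K l E → Bool) (SysWire n w ⊕ SlotWire K l E → Bool) ℂ :=
    Matrix.diagonal fun s => halfPhase α (2 ^ l) (s (.inr (.reg none)))
  have hPh : HasCircuit n 0 1 fun _ => Ph := HasCircuit.diagonal_single _
    (z := fun v => halfPhase α (2 ^ l) v) fun v => by
      rw [Complex.star_def, mul_comm, Complex.mul_conj, Complex.normSq_eq_norm_sq, norm_halfPhase]
      simp
  have hT : HasCircuit n (K * 1) (K * (2 * D.length + 23)) fun x =>
      timeProd (fun i => slotsOp K D i x) 0 K :=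
    HasCircuit.timeProd K 0 fun i _ hi => by
      have : slotsOp K D i = slotOp D ⟨i, by omega⟩ := by
        funext x; rw [slotsOp, dif_pos (by omega : i < K)]
      rw [this]; exact hasCircuit_slotOp D _
  -- The positions are computed, used by the slots and uncomputed; the sign bit selects one of the
  -- two phases.
  set Sel : ((Fin n → Bool) → Bool) → Matrix (SysWire n w ⊕ SlotWire K l E → Bool)
      (SysWire n w ⊕ SlotWire K l E → Bool) ℂ := fun x =>
    Ph * ((permMat σ).conjTranspose * (timeProd (fun i => slotsOp K D i x) 0 K * permMat σ))
  have hSel := hPh.mul (hσ.conjTranspose.mul (hT.mul hσ))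
  have hW := (hP.conjTranspose.mul hSel).mul hP
  have hA := hW.amplify hR HasCircuit.neg_one
  refine ⟨_, hA.mono ?_ ?_, fun c U δ hU hD x => ?_⟩
  · omega
  · rw [Finset.card_univ]
    have hcard : Fintype.card (RegIdx K l) = K * (l + 1) + 1 := by simp
    rw [hcard]
    have e1 : 800 * ((K + 1) * (D.length + l + 1)) = 800 * (K * D.length) + 800 * (K * l) + 800 * K +
        800 * D.length + 800 * l + 800 := by ring
    have e2 : K * (l + 1) = K * l + K := by ring
    have e3 : K * (2 * l + 3) = 2 * (K * l) + 3 * K := by ring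
    have e4 : K * (2 * D.length + 23) = 2 * (K * D.length) + 23 * K := by ring
    rw [e1, e2, e3, e4]
    omega
  · have hδ : 0 ≤ δ := (norm_nonneg _).trans (hD 0 (by positivity))
    -- Errors can spread to the computed and external wires only; the word and the chain stay
    -- intact, so the projection can still be evaluated.
    have hpres : ∀ k : SlotWire K l E, (∀ z, k ≠ .comp z) → (∀ e, k ≠ .ext e) →
        Preserves (.inr k) (Sel x) := by
      intro k hk hk'
      have hs : Preserves (.inr k) (permMat σ) := Preserves.permMat fun s =>
        hσ1 s _ fun z => by rw [compW_apply]; simpa using (hk z).symm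
      refine (Preserves.diagonal _ _).mul (hs.conjTranspose.mul (Preserves.mul ?_ hs))
      refine Preserves.timeProd _ _ fun i _ hi => ?_
      rw [slotsOp, dif_pos (by omega)]
      refine preserves_slotOp D _ x ?_
      rintro (b | e)
      · exact (hk _).symm
      · exact (hk' _).symm
    have hreg : ∀ i, Preserves (regW n w K l E i) (Sel x) := fun i =>
      hpres (.reg i) (by simp) (by simp)
    have hch : ∀ i, Preserves (chainW n w K l E i) (Sel x) := fun i =>
      hpres (.chain i) (by simp) (by simp)
    set J := attach (SysWire n w) (slotState (K := K) (l := l) c (fun _ => false) fun _ => false)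
    set Jg : BinaryWord K l → Matrix (SysWire n w ⊕ SlotWire K l E → Bool) (SysWire n w → Bool) ℂ :=
      fun g => attach (SysWire n w) (slotState c (regBits g) fun _ => false)
    have hperm : ∀ g : BinaryWord K l, permMat (xorPerm (regW n w K l E) (regBits g)) * Jg g = J := by
      intro g
      simp only [Jg, J, attach_eq_colMat]
      rw [permMat_mul_colMat]
      congr 1; funext t
      rw [← xorPerm_slotState]
      exact (xorPerm (regW n w K l E) (regBits g)).symm_apply_apply _
    have hsupp : ∀ (g : BinaryWord K l)
        {N : Matrix (SysWire n w ⊕ SlotWire K l E → Bool) (SysWire n w → Bool) ℂ},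
        (∀ s t, N s t ≠ 0 → (∀ i, s (regW n w K l E i) = regBits g i) ∧
          ∀ i, s (chainW n w K l E i) = false) →
        (Matrix.diagonal fun s : SysWire n w ⊕ SlotWire K l E → Bool =>
          if φ s then (1 : ℂ) else 0) * P.conjTranspose * N =
        (√(wordWeight (gapWeight (1 - eventProb α) l) g) : ℂ) •
          ((Matrix.diagonal fun s : SysWire n w ⊕ SlotWire K l E → Bool =>
            if ∀ i, s (regW n w K l E i) = false then (1 : ℂ) else 0) *
          (permMat (xorPerm (regW n w K l E) (regBits g)) * N)) := by
      intro g N hN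
      have e := diagonal_mul_wireProd_mul (regW n w K l E) (chainW n w K l E) hne u hφ (regBits g) hN
      rw [← star_prod, prod_regRotation hq hq'] at e
      simpa using e
    -- The projection damps any error belonging to the word `g` by the amplitude of `g`; this is
    -- what turns a sum of errors into their average.
    have hbound : ∀ (g : BinaryWord K l)
        {N : Matrix (SysWire n w ⊕ SlotWire K l E → Bool) (SysWire n w → Bool) ℂ},
        (∀ s t, N s t ≠ 0 → (∀ i, s (regW n w K l E i) = regBits g i) ∧
          ∀ i, s (chainW n w K l E i) = false) →
        ‖(Matrix.diagonal fun s : SysWire n w ⊕ SlotWire K l E → Bool =>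
          if φ s then (1 : ℂ) else 0) * P.conjTranspose * N‖ ≤
          √(wordWeight (gapWeight (1 - eventProb α) l) g) * ‖N‖ := by
      intro g N hN
      rw [hsupp g hN, norm_smul, Complex.norm_real, Real.norm_of_nonneg (Real.sqrt_nonneg _)]
      refine mul_le_mul_of_nonneg_left ?_ (Real.sqrt_nonneg _)
      have := norm_mul_le_of_le (norm_diagonal_ite_le
        fun s : SysWire n w ⊕ SlotWire K l E → Bool => ∀ i, s (regW n w K l E i) = false)
        (norm_mul_le_of_le (norm_le_one_of_conjTranspose_mul_self
          (permMat_unitary (xorPerm (regW n w K l E) (regBits g)))) (le_refl ‖N‖))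
      simpa using this
    refine norm_amplify_segment_sub_le (w := gapWeight (1 - eventProb α) l) (gap := binaryGap l) hα
      hw (sysBit x) hU (Jg := Jg) (hP.unitary x) (hSel.unitary x) (norm_diagonal_ite_le _)
      (conjTranspose_attach_mul _) hδ ?_ ?_ ?_ ?_ ?_ ?_
    · have := diagonal_mul_colMat
        (d := fun s : SysWire n w ⊕ SlotWire K l E → Bool => if φ s then (1 : ℂ) else 0)
        (b := fun t : SysWire n w → Bool => Sum.elim t
          (slotState (K := K) (l := l) c (fun _ => false) fun _ => false)) (d' := fun _ => 1)
        (fun t => by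
          refine if_pos ?_
          rw [hφ _ fun i => rfl, decide_eq_true_eq]
          exact fun i => rfl)
      rw [Matrix.diagonal_one, Matrix.mul_one] at this
      exact this
    · have := wireProd_mul_colMat (regW n w K l E) u (b := fun t : SysWire n w → Bool => Sum.elim t
          (slotState (K := K) (l := l) c (fun _ => false) fun _ => false)) fun t i => rfl
      refine this.trans ?_
      rw [← (Equiv.ofBijective _ (regBits_bijective (K := K) (l := l))).sum_comp]
      refine Finset.sum_congr rfl fun g _ => ?_
      rw [Equiv.ofBijective_apply, prod_regRotation hq hq']
      simp only [xorPerm_slotState]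
      rfl
    · intro g
      rw [hsupp g, hperm]
      · congr 1
        have := diagonal_mul_colMat
          (d := fun s : SysWire n w ⊕ SlotWire K l E → Bool =>
            if ∀ i, s (regW n w K l E i) = false then (1 : ℂ) else 0)
          (b := fun t : SysWire n w → Bool => Sum.elim t
            (slotState (K := K) (l := l) c (fun _ => false) fun _ => false)) (d' := fun _ => 1)
          (fun t => if_pos fun i => rfl)
        rw [Matrix.diagonal_one, Matrix.mul_one] at this
        exact this
      · intro s t h
        have : s = Sum.elim t (slotState c (regBits g) fun _ => false) := by
          by_contra hs; exact h (if_neg hs)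
        rw [this]
        exact ⟨fun i => rfl, fun i => rfl⟩
    · intro g
      have hc1 : permMat σ * Jg g = attach (SysWire n w) (slotState c (regBits g) (compVal g)) := by
        simp only [Jg, attach_eq_colMat]
        rw [permMat_mul_colMat]
        congr 1; funext t
        refine hσ2 _ _ (fun k hk => ?_) (fun i => rfl) fun i =>
          (compFun_compVal g c t i).symm
        rcases k with k | k
        · rfl
        · cases k with
          | comp z => exact absurd rfl (hk z)
          | _ => rfl
      have hc2 : (permMat σ).conjTranspose *
          attach (SysWire n w) (slotState c (regBits g) (compVal g)) = Jg g := by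
        rw [← hc1, ← Matrix.mul_assoc, permMat_unitary, Matrix.one_mul]
      have hc3 : Ph * Jg g = halfPhase α (2 ^ l) g.2 • Jg g := by
        have := diagonal_mul_colMat
          (d := fun s : SysWire n w ⊕ SlotWire K l E → Bool =>
            halfPhase α (2 ^ l) (s (.inr (.reg none))))
          (b := fun t : SysWire n w → Bool => Sum.elim t
            (slotState (K := K) (l := l) c (regBits g) fun _ => false))
          (d' := fun _ => halfPhase α (2 ^ l) g.2) (fun t => rfl)
        refine this.trans ?_
        ext s t
        rw [Matrix.mul_diagonal, Matrix.smul_apply, smul_eq_mul, mul_comm]; rfl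
      have e : Sel x * Jg g - Jg g * wordOp (binaryGap l) (sysBit x) U α (2 ^ l) g =
          Ph * (permMat σ).conjTranspose * (timeProd (fun i => slotsOp K D i x) 0 K *
            attach (SysWire n w) (slotState c (regBits g) (compVal g)) -
          attach (SysWire n w) (slotState c (regBits g) (compVal g)) *
            wordProd (fun j => eventOp (sysBit x) (U j)) (2 ^ l)
              (List.ofFn fun i => binaryGap l (g.1 i)) 0) := by
        rw [Matrix.mul_sub, ← Matrix.mul_assoc (Ph * (permMat σ).conjTranspose)
          (attach (SysWire n w) (slotState c (regBits g) (compVal g))),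
          Matrix.mul_assoc Ph _ (attach (SysWire n w) (slotState c (regBits g) (compVal g))), hc2,
          hc3, ← hc1, wordOp, Matrix.mul_smul, Matrix.smul_mul]
        simp only [Sel, Matrix.mul_assoc]
      rw [e]
      have n1 := norm_mul_le_of_le (norm_mul_le_of_le
        (norm_le_one_of_conjTranspose_mul_self (hPh.unitary x))
        (norm_le_one_of_conjTranspose_mul_self (hσ.conjTranspose.unitary x)))
        (norm_slots_mul_attach_sub_le D x c g hU hD)
      simpa using n1
    · exact fun g => hbound g fun s t h => ⟨fun i => supported_sub (hreg i) (fun t => rfl) _ h,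
        fun i => supported_sub (hch i) (fun t => rfl) _ h⟩
    · exact fun g => hbound g fun s t h =>
        ⟨fun i => supported_sub (hreg i).conjTranspose (fun t => rfl) _ h,
          fun i => supported_sub (hch i).conjTranspose (fun t => rfl) _ h⟩

end SegmentCircuit

/-! ### Renaming of wires -/

section Relabel

variable {Q Q' : Type*} [Fintype Q] [DecidableEq Q] [Fintype Q'] [DecidableEq Q']

/-- The gate that acts on the images of the wires. -/
def TwoQubitGate.relabel (e : Q ≃ Q') (G : TwoQubitGate Q) : TwoQubitGate Q' :=
  ⟨e G.fst, e G.snd, fun h => G.ne (e.injective h), G.gate⟩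

/-- The basis states of relabelled wires. -/
def stateEquiv (e : Q ≃ Q') : (Q' → Bool) ≃ (Q → Bool) := (e.arrowCongr (Equiv.refl Bool)).symm

theorem toMatrix_relabel (e : Q ≃ Q') (G : TwoQubitGate Q) :
    (G.relabel e).toMatrix = G.toMatrix.submatrix (stateEquiv e) (stateEquiv e) := by
  ext s t
  rw [Matrix.submatrix_apply, TwoQubitGate.toMatrix, TwoQubitGate.toMatrix]
  have : (∀ k, k ≠ (G.relabel e).fst → k ≠ (G.relabel e).snd → s k = t k) ↔
      ∀ k, k ≠ G.fst → k ≠ G.snd → stateEquiv e s k = stateEquiv e t k := by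
    constructor
    · intro h k h1 h2
      exact h (e k) (fun h => h1 (e.injective h)) fun h => h2 (e.injective h)
    · intro h k h1 h2
      obtain ⟨k, rfl⟩ := e.surjective k
      exact h k (fun h => h1 (congrArg e h)) fun h => h2 (congrArg e h)
  simp only [this]
  rfl

theorem evalGates_append_singleton (D : List (TwoQubitGate Q)) (G : TwoQubitGate Q) :
    evalGates (D ++ [G]) = G.toMatrix * evalGates D := by
  rw [evalGates, List.foldl_append]; rfl

theorem evalGates_relabel (e : Q ≃ Q') (D : List (TwoQubitGate Q)) :
    evalGates (D.map (TwoQubitGate.relabel e)) =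
      (evalGates D).submatrix (stateEquiv e) (stateEquiv e) := by
  induction D using List.reverseRecOn with
  | nil => simp [evalGates]
  | append_singleton D G ih =>
    rw [List.map_append, List.map_singleton, evalGates_append_singleton, ih, toMatrix_relabel,
      Matrix.submatrix_mul_equiv, evalGates_append_singleton]

theorem HasCircuit.relabel {n q g : ℕ} (e : Q ≃ Q')
    {M : ((Fin n → Bool) → Bool) → Matrix (Q → Bool) (Q → Bool) ℂ} (h : HasCircuit n q g M) :
    HasCircuit n q g fun x => (M x).submatrix (stateEquiv e) (stateEquiv e) := by
  obtain ⟨K, h1, h2, h3⟩ := h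
  suffices ∃ L : List (Gate Q' n), queryCount L = queryCount K ∧ gateCount L = gateCount K ∧
      ∀ x, evalCircuit x L = (evalCircuit x K).submatrix (stateEquiv e) (stateEquiv e) by
    obtain ⟨L, e1, e2, e3⟩ := this
    exact ⟨L, e1.trans_le h1, e2.trans_le h2, fun x => by rw [e3, h3]⟩
  clear h1 h2 h3
  induction K with
  | nil => exact ⟨[], rfl, rfl, fun x => by simp [evalCircuit]⟩
  | cons G K ih =>
    obtain ⟨L, e1, e2, e3⟩ := ih
    obtain ⟨G', hG, hG'⟩ : ∃ G' : Gate Q' n, G'.isQuery = G.isQuery ∧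
        ∀ x, G'.toMatrix x = (G.toMatrix x).submatrix (stateEquiv e) (stateEquiv e) := by
      cases G with
      | twoQubit G => exact ⟨.twoQubit (G.relabel e), rfl, fun x => toMatrix_relabel e G⟩
      | query i =>
        refine ⟨.query (i.trans e.toEmbedding), rfl, fun x => ?_⟩
        rw [Gate.toMatrix, Gate.toMatrix, discreteQuery, discreteQuery,
          Matrix.submatrix_diagonal_equiv]
        rfl
    refine ⟨G' :: L, ?_, ?_, fun x => ?_⟩
    · simp only [queryCount, List.countP_cons, hG] at e1 ⊢
      rw [e1]
    · simp only [gateCount, List.countP_cons, hG] at e2 ⊢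
      rw [e2]
    · rw [evalCircuit_cons, evalCircuit_cons, e3, hG', Matrix.submatrix_mul_equiv]

variable {S R R' : Type*} [Fintype S] [DecidableEq S] [Fintype R] [DecidableEq R] [Fintype R']
  [DecidableEq R']

theorem norm_relabel_mul_attach_sub_le (e : R ≃ R') (A : Matrix (S ⊕ R → Bool) (S ⊕ R → Bool) ℂ)
    (c : R' → Bool) (V : Matrix (S → Bool) (S → Bool) ℂ) :
    ‖A.submatrix (stateEquiv ((Equiv.refl S).sumCongr e)) (stateEquiv ((Equiv.refl S).sumCongr e)) *
        attach S c - attach S c * V‖ ≤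
      ‖A * attach S (fun k => c (e k)) - attach S (fun k => c (e k)) * V‖ := by
  have h : attach S c =
      (attach S fun k => c (e k)).submatrix (stateEquiv ((Equiv.refl S).sumCongr e)) id := by
    ext s t
    rw [Matrix.submatrix_apply, attach, attach]
    have : s = Sum.elim t c ↔
        stateEquiv ((Equiv.refl S).sumCongr e) s = Sum.elim (id t) fun k => c (e k) := by
      constructor
      · rintro rfl
        funext k
        rcases k with k | k <;> rfl
      · intro h
        funext k
        rcases k with k | k
        · exact congrFun h (.inl k)
        · obtain ⟨k, rfl⟩ := e.surjective k
          exact congrFun h (.inr k)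
    simp only [this]
  have h2 : A.submatrix (stateEquiv ((Equiv.refl S).sumCongr e))
      (stateEquiv ((Equiv.refl S).sumCongr e)) * attach S c - attach S c * V =
      (A * attach S (fun k => c (e k)) - attach S (fun k => c (e k)) * V).submatrix
        (stateEquiv ((Equiv.refl S).sumCongr e)) id := by
    rw [h, Matrix.submatrix_mul_equiv]
    rfl
  rw [h2]
  exact norm_submatrix_equiv_le _ _

theorem norm_evalGates_relabel_mul_attach_sub_le (e : R ≃ R') (D : List (TwoQubitGate (S ⊕ R)))
    (c : R' → Bool) (V : Matrix (S → Bool) (S → Bool) ℂ) :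
    ‖evalGates (D.map (TwoQubitGate.relabel ((Equiv.refl S).sumCongr e))) * attach S c -
        attach S c * V‖ ≤
      ‖evalGates D * attach S (fun k => c (e k)) - attach S (fun k => c (e k)) * V‖ := by
  rw [evalGates_relabel]
  exact norm_relabel_mul_attach_sub_le e _ c V

end Relabel

/-! ### Concatenation of segments by bit flips in the time register -/

section Segments

variable {n w K l s : ℕ} {E : Type} [Fintype E] [DecidableEq E]

/-- The ancilla qubits in the zero state, up to the external ones. -/
abbrev restState (K l : ℕ) (c : E → Bool) : SlotWire K l E → Bool :=
  slotState c (fun _ => false) fun _ => false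

theorem flip_mul_attach (e : E) {c c' : E → Bool} (h : c' e = !c e)
    (h' : ∀ e', e' ≠ e → c' e' = c e') :
    permMat (flipPerm (.inr (.ext e) : SysWire n w ⊕ SlotWire K l E) fun _ => true) *
      attach (SysWire n w) (restState K l c) = attach (SysWire n w) (restState K l c') := by
  rw [attach_eq_colMat, attach_eq_colMat, permMat_mul_colMat]
  congr 1; funext t
  rw [flipPerm_apply]
  funext k
  by_cases hk : k = .inr (.ext e)
  · subst hk
    rw [Function.update_self]
    simp [slotState, h]
  · rw [Function.update_of_ne hk]
    rcases k with k | k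
    · rfl
    · cases k with
      | ext e' => exact (h' e' fun he => hk (by rw [he])).symm
      | _ => rfl

theorem norm_flip_conj_sub_le {I β : Type*} [Fintype I] [DecidableEq I] [Fintype β] [DecidableEq β]
    {X A : Matrix I I ℂ} {J J' : Matrix I β ℂ} {V : Matrix β β ℂ} {δ : ℝ} (hX : ‖X‖ ≤ 1)
    (h : X * J = J') (h' : X * J' = J) (hA : ‖A * J' - J' * V‖ ≤ δ) :
    ‖X * A * X * J - J * V‖ ≤ δ := by
  have e : X * A * X * J - J * V = X * (A * J' - J' * V) := by
    rw [Matrix.mul_assoc, h, Matrix.mul_sub, ← Matrix.mul_assoc X J', h', Matrix.mul_assoc]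
  rw [e]
  have := norm_mul_le_of_le hX hA
  linarith

/-- Simulation of `2 ^ p` consecutive segments, the number of the segment being held by the external
wires. -/
theorem exists_segments_circuit (K : ℕ) (D : List (TwoQubitGate (SysWire n w ⊕ (Fin l ⊕ E))))
    {α : ℝ} (hα : IsSegment α (2 ^ l)) (sb : Fin s → E) (cfg : ℕ → E → Bool)
    (hcfg : ∀ (m : Fin s) (j : ℕ), 2 ^ ((m : ℕ) + 1) ∣ j →
      cfg (j + 2 ^ (m : ℕ)) (sb m) = !cfg j (sb m) ∧
      ∀ e, e ≠ sb m → cfg (j + 2 ^ (m : ℕ)) e = cfg j e) (p : ℕ) (hp : p ≤ s) :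
    ∃ A : ((Fin n → Bool) → Bool) → Matrix (SysWire n w ⊕ SlotWire K l E → Bool)
        (SysWire n w ⊕ SlotWire K l E → Bool) ℂ,
      HasCircuit n (2 ^ p * (3 * K)) (2 ^ p * (800 * ((K + 1) * (D.length + l + 1)) + 6) - 6) A ∧
      ∀ (U : ℕ → Matrix (SysWire n w → Bool) (SysWire n w → Bool) ℂ) (δ : ℝ),
        (∀ j, (U j).conjTranspose * U j = 1) →
        (∀ j < 2 ^ s, ∀ t < 2 ^ l, ‖evalGates D * attach (SysWire n w)
            (Sum.elim (fun b : Fin l => t.testBit b) (cfg j)) -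
          attach (SysWire n w) (Sum.elim (fun b : Fin l => t.testBit b) (cfg j)) *
            U (j * 2 ^ l + t)‖ ≤ δ) →
        ∀ j, 2 ^ p ∣ j → j + 2 ^ p ≤ 2 ^ s → ∀ x,
          ‖A x * attach (SysWire n w) (restState K l (cfg j)) -
            attach (SysWire n w) (restState K l (cfg j)) *
              segmentProd (sysBit x) U α (j * 2 ^ l) (2 ^ p * 2 ^ l)‖ ≤
            2 ^ p * (16 / K.factorial + 10 * δ) := by
  induction p with
  | zero =>
    obtain ⟨A, hA, hA'⟩ := exists_segment_circuit K D hα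
    refine ⟨A, hA.mono (by omega) (by omega), fun U δ hU hD j _ hj x => ?_⟩
    have := hA' (cfg j) (fun t => U (j * 2 ^ l + t)) δ (fun t _ => hU _)
      (fun t ht => hD j (by omega) t ht) x
    rw [← segmentProd_shift] at this
    simp only [pow_zero, one_mul]
    exact this
  | succ p ih =>
    obtain ⟨A, hA, hA'⟩ := ih (by omega)
    set X := permMat (flipPerm (.inr (.ext (sb ⟨p, by omega⟩)) : SysWire n w ⊕ SlotWire K l E)
      fun _ => true) with hX
    have cX : HasCircuit n 0 3 fun _ => X := HasFlip.not _
    -- The second half is the first with bit `p` of the segment number flipped before and after, so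
    -- the register always returns to its initial state and no counter is needed. The cost doubles
    -- plus two flips of 3 gates, which gives the term `6 * 2 ^ p - 6`.
    refine ⟨fun x => X * A x * X * A x, ?_, fun U δ hU hD j hj hj' x => ?_⟩
    · refine (((cX.mul hA).mul cX).mul hA).mono ?_ ?_
      · rw [pow_succ]; apply le_of_eq; ring
      · have : 2 ^ (p + 1) * (800 * ((K + 1) * (D.length + l + 1)) + 6) =
            2 * (2 ^ p * (800 * ((K + 1) * (D.length + l + 1)) + 6)) := by
          rw [pow_succ]; ring
        have h6 : 6 ≤ 2 ^ p * (800 * ((K + 1) * (D.length + l + 1)) + 6) :=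
          (Nat.le_add_left 6 _).trans (Nat.le_mul_of_pos_left _ (by positivity))
        rw [this]; omega
    · have hpj : 2 ^ p ∣ j := (pow_dvd_pow 2 (Nat.le_succ p)).trans hj
      have h2p : 2 ^ (p + 1) = 2 ^ p + 2 ^ p := by rw [pow_succ]; ring
      have h1 := hA' U δ hU hD j hpj (by omega) x
      have h2 := hA' U δ hU hD (j + 2 ^ p) (hpj.add (dvd_refl _)) (by omega) x
      obtain ⟨f1, f2⟩ := hcfg ⟨p, by omega⟩ j hj
      have x1 : X * attach (SysWire n w) (restState K l (cfg j)) =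
          attach (SysWire n w) (restState K l (cfg (j + 2 ^ p))) := flip_mul_attach _ f1 f2
      have x2 : X * attach (SysWire n w) (restState K l (cfg (j + 2 ^ p))) =
          attach (SysWire n w) (restState K l (cfg j)) :=
        flip_mul_attach _ (by rw [f1, Bool.not_not]) fun e he => (f2 e he).symm
      have nX : ‖X‖ ≤ 1 := norm_le_one_of_conjTranspose_mul_self (cX.unitary x)
      have nA : ‖A x‖ ≤ 1 := norm_le_one_of_conjTranspose_mul_self (hA.unitary x)
      have h3 : ‖X * A x * X * attach (SysWire n w) (restState K l (cfg j)) -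
          attach (SysWire n w) (restState K l (cfg j)) *
            segmentProd (sysBit x) U α ((j + 2 ^ p) * 2 ^ l) (2 ^ p * 2 ^ l)‖ ≤
          2 ^ p * (16 / K.factorial + 10 * δ) :=
        norm_flip_conj_sub_le nX x1 x2 h2
      have nXAX : ‖X * A x * X‖ ≤ 1 := by
        simpa using norm_mul_le_of_le (norm_mul_le_of_le nX nA) nX
      have e : segmentProd (sysBit x) U α (j * 2 ^ l) (2 ^ (p + 1) * 2 ^ l) =
          segmentProd (sysBit x) U α ((j + 2 ^ p) * 2 ^ l) (2 ^ p * 2 ^ l) *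
            segmentProd (sysBit x) U α (j * 2 ^ l) (2 ^ p * 2 ^ l) := by
        rw [h2p, add_mul, segmentProd_add, ← add_mul]
      rw [e]
      refine (norm_mul_mul_sub_le nXAX (norm_le_one_of_conjTranspose_mul_self
        (segmentProd_unitary (sysBit x) fun j _ _ => hU j)) h3 h1).trans (le_of_eq ?_)
      rw [pow_succ]; ring

/-- Simulation of `2 ^ s` consecutive segments followed by the driving evolution, the number of the
segment being held by the external wires. -/
theorem exists_evolution_circuit (hK : 1 ≤ K) (D : List (TwoQubitGate (SysWire n w ⊕ (Fin l ⊕ E))))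
    {α : ℝ} (hα : IsSegment α (2 ^ l)) (sb : Fin s → E) (top : E) (cfg : ℕ → E → Bool)
    (hcfg : ∀ (m : Fin s) (j : ℕ), 2 ^ ((m : ℕ) + 1) ∣ j →
      cfg (j + 2 ^ (m : ℕ)) (sb m) = !cfg j (sb m) ∧
      ∀ e, e ≠ sb m → cfg (j + 2 ^ (m : ℕ)) e = cfg j e)
    (htop : cfg (2 ^ s) top = !cfg 0 top) (htop' : ∀ e, e ≠ top → cfg (2 ^ s) e = cfg 0 e)
    (hzero : ∀ e, cfg 0 e = false) :
    ∃ (b : ℕ) (A : ((Fin n → Bool) → Bool) →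
        Matrix (SysWire n w ⊕ Fin b → Bool) (SysWire n w ⊕ Fin b → Bool) ℂ),
      HasCircuit n (2 ^ s * (3 * K))
        (2 ^ s * (800 * ((K + 1) * (D.length + l + 1)) + 6) + D.length) A ∧
      ∀ (U : ℕ → Matrix (SysWire n w → Bool) (SysWire n w → Bool) ℂ) (δ : ℝ),
        (∀ j, (U j).conjTranspose * U j = 1) →
        (∀ j t, t < 2 ^ l → j * 2 ^ l + t ≤ 2 ^ s * 2 ^ l → ‖evalGates D * attach (SysWire n w)
            (Sum.elim (fun b : Fin l => t.testBit b) (cfg j)) -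
          attach (SysWire n w) (Sum.elim (fun b : Fin l => t.testBit b) (cfg j)) *
            U (j * 2 ^ l + t)‖ ≤ δ) →
        ∀ x, ‖A x * attach (SysWire n w) (fun _ => false) -
          attach (SysWire n w) (fun _ => false) *
            (U (2 ^ s * 2 ^ l) * segmentProd (sysBit x) U α 0 (2 ^ s * 2 ^ l))‖ ≤
          δ + 2 ^ s * (16 / K.factorial + 10 * δ) := by
  obtain ⟨A, hA, hA'⟩ := exists_segments_circuit K D hα sb cfg hcfg s le_rfl
  -- Flipping the top bit makes the time register hold the final time, for the driving evolution
  -- that leaves the interaction picture.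
  set X := permMat (flipPerm (.inr (.ext top) : SysWire n w ⊕ SlotWire K l E) fun _ => true) with hX
  have cX : HasCircuit n 0 3 fun _ => X := HasFlip.not _
  -- The final evolution borrows the position wires of the first slot, which are zero between
  -- segments; this requires at least one slot.
  set F := locally (embEquiv (sysEmb (SysWire n w)
    (timeEmb E l (⟨0, hK⟩ : Fin K)))) fun _ => evalGates D
  have cF : HasCircuit n 0 D.length fun _ => F := HasCircuit.submatrix_embedding _ _
  let e := Fintype.equivFin (SlotWire K l E)
  have hAll := ((((cX.mul cF).mul cX).mul hA).relabel ((Equiv.refl (SysWire n w)).sumCongr e))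
  refine ⟨_, _, hAll.mono (by omega) ?_, fun U δ hU hD x => ?_⟩
  · have h6 : 6 ≤ 2 ^ s * (800 * ((K + 1) * (D.length + l + 1)) + 6) :=
      (Nat.le_add_left 6 _).trans (Nat.le_mul_of_pos_left _ (by positivity))
    omega
  · refine (norm_relabel_mul_attach_sub_le e _ _ _).trans ?_
    have hcfg0 : (fun _ => false : SlotWire K l E → Bool) = restState K l (cfg 0) := by
      funext k
      cases k with
      | ext k => exact (hzero k).symm
      | _ => rfl
    have hseg := hA' U δ hU (fun j hj t ht => by
      have : (j + 1) * 2 ^ l ≤ 2 ^ s * 2 ^ l := Nat.mul_le_mul_right _ hj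
      rw [add_mul, one_mul] at this
      exact hD _ _ ht (by omega)) 0 (dvd_zero _) (by omega) x
    rw [zero_mul] at hseg
    simp only [hcfg0]
    have x1 : X * attach (SysWire n w) (restState K l (cfg 0)) =
        attach (SysWire n w) (restState K l (cfg (2 ^ s))) := flip_mul_attach _ htop htop'
    have x2 : X * attach (SysWire n w) (restState K l (cfg (2 ^ s))) =
        attach (SysWire n w) (restState K l (cfg 0)) :=
      flip_mul_attach _ (by rw [htop, Bool.not_not]) fun e he => (htop' e he).symm
    have nX : ‖X‖ ≤ 1 := norm_le_one_of_conjTranspose_mul_self (cX.unitary x)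
    have nF : ‖F‖ ≤ 1 := norm_le_one_of_conjTranspose_mul_self (cF.unitary x)
    have hF : ‖F * attach (SysWire n w) (restState K l (cfg (2 ^ s))) -
        attach (SysWire n w) (restState K l (cfg (2 ^ s))) * U (2 ^ s * 2 ^ l)‖ ≤ δ := by
      refine (norm_locally_mul_attach_sub_le _ _ _ _).trans ?_
      have h2 : (fun k => restState K l (cfg (2 ^ s)) (timeEmb E l (⟨0, hK⟩ : Fin K) k)) =
          Sum.elim (fun b : Fin l => (0 : ℕ).testBit b) (cfg (2 ^ s)) := by
        funext k
        rcases k with b | k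
        · simp [timeEmb_inl, slotState]
        · rfl
      rw [h2]
      exact hD _ 0 (by positivity) le_rfl
    have hXFX : ‖X * F * X * attach (SysWire n w) (restState K l (cfg 0)) -
        attach (SysWire n w) (restState K l (cfg 0)) * U (2 ^ s * 2 ^ l)‖ ≤ δ :=
      norm_flip_conj_sub_le nX x1 x2 hF
    have nXFX : ‖X * F * X‖ ≤ 1 := by
      simpa using norm_mul_le_of_le (norm_mul_le_of_le nX nF) nX
    exact norm_mul_mul_sub_le nXFX (norm_le_one_of_conjTranspose_mul_self
      (segmentProd_unitary (sysBit x) fun j _ _ => hU j)) hXFX hseg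

end Segments

/-! ### Layout of the time register -/

section DrivingCircuit

variable {n w r a l s d K : ℕ}

/-- The wires of the low bits of the position. -/
def lowBit (a : ℕ) (hr : d + l + s = r) : Fin l ↪ TimeWire r a where
  toFun b := .inl (.inr ⟨d + b, by omega⟩)
  inj' b b' h := by simpa [Fin.ext_iff] using h

theorem lowBit_apply (hr : d + l + s = r) (b : Fin l) :
    lowBit a hr b = .inl (.inr ⟨d + b, by omega⟩) := rfl

/-- The wires of a driving circuit, split into the low bits of the position and the others. -/
noncomputable def timeSplit (a : ℕ) (hr : d + l + s = r) :
    TimeWire r a ≃ Fin l ⊕ OffWire (lowBit a hr) :=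
  (Equiv.ofBijective (Sum.elim (lowBit a hr) OffWire.wire) ⟨by
    rintro (b | e) (b' | e') h
    · exact congrArg _ ((lowBit a hr).injective h)
    · exact absurd ⟨b, h⟩ e'.notMem
    · exact absurd ⟨b', h.symm⟩ e.notMem
    · exact congrArg _ (OffWire.ext h), fun k => by
    by_cases hk : k ∈ Set.range (lowBit a hr)
    · obtain ⟨b, rfl⟩ := hk
      exact ⟨.inl b, rfl⟩
    · exact ⟨.inr ⟨k, hk⟩, rfl⟩⟩).symm

theorem elim_timeSplit (hr : d + l + s = r) {c : TimeWire r a → Bool} {f : Fin l → Bool}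
    {g : OffWire (lowBit a hr) → Bool} (hf : ∀ b, c (lowBit a hr b) = f b)
    (hg : ∀ e : OffWire (lowBit a hr), c e.wire = g e) (k : TimeWire r a) :
    Sum.elim f g (timeSplit a hr k) = c k := by
  obtain ⟨k, rfl⟩ := (timeSplit a hr).symm.surjective k
  rw [Equiv.apply_symm_apply]
  rcases k with b | e
  · exact (hf b).symm
  · exact (hg e).symm

/-- From the lowest digit on, the grid index consists of `d` zeros, `l` digits for the position in
the segment, and the digits of the segment number. -/
theorem testBit_position {t : ℕ} (ht : t < 2 ^ l) (j i : ℕ) :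
    ((j * 2 ^ l + t) * 2 ^ d).testBit i =
      (decide (d ≤ i) && if i - d < l then t.testBit (i - d) else j.testBit (i - d - l)) := by
  rw [Nat.testBit_mul_two_pow, mul_comm j, Nat.testBit_two_pow_mul_add _ ht]

theorem testBit_flip {m j : ℕ} (hj : 2 ^ (m + 1) ∣ j) (i : ℕ) :
    (j + 2 ^ m).testBit i = if i = m then !j.testBit m else j.testBit i := by
  obtain ⟨k, rfl⟩ := hj
  have e1 : 2 ^ (m + 1) * k + 2 ^ m = (2 * k + 1) * 2 ^ m := by rw [pow_succ]; ring
  have e2 : 2 ^ (m + 1) * k = (2 * k) * 2 ^ m := by rw [pow_succ]; ring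
  rw [e1, e2, Nat.testBit_mul_two_pow, Nat.testBit_mul_two_pow, Nat.testBit_mul_two_pow]
  by_cases him : i = m
  · subst him; simp
  · rw [if_neg him]
    by_cases h : m ≤ i
    · obtain ⟨q, hq⟩ : ∃ q, i - m = q + 1 := ⟨i - m - 1, by omega⟩
      rw [hq, Nat.testBit_succ, Nat.testBit_succ]
      congr 2; omega
    · simp [h]

/-- A circuit for the whole interaction picture evolution, made from a circuit `D` for the driving
evolution. -/
theorem exists_driving_circuit (hK : 1 ≤ K) (hr : d + l + s = r)
    (D : List (TwoQubitGate (SysWire n w ⊕ TimeWire r a))) {α : ℝ} (hα : IsSegment α (2 ^ l)) :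
    ∃ (b : ℕ) (A : ((Fin n → Bool) → Bool) →
        Matrix (SysWire n w ⊕ Fin b → Bool) (SysWire n w ⊕ Fin b → Bool) ℂ),
      HasCircuit n (2 ^ s * (3 * K))
        (2 ^ s * (800 * ((K + 1) * (D.length + l + 1)) + 6) + D.length) A ∧
      ∀ (U : ℕ → Matrix (SysWire n w → Bool) (SysWire n w → Bool) ℂ) (δ : ℝ),
        (∀ j, (U j).conjTranspose * U j = 1) →
        (∀ j ≤ 2 ^ s * 2 ^ l, ‖evalGates D * attach (SysWire n w) (timeState r a 0 (j * 2 ^ d)) -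
          attach (SysWire n w) (timeState r a 0 (j * 2 ^ d)) * U j‖ ≤ δ) →
        ∀ x, ‖A x * attach (SysWire n w) (fun _ => false) -
          attach (SysWire n w) (fun _ => false) *
            (U (2 ^ s * 2 ^ l) * segmentProd (sysBit x) U α 0 (2 ^ s * 2 ^ l))‖ ≤
          δ + 2 ^ s * (16 / K.factorial + 10 * δ) := by
  let D' := D.map (TwoQubitGate.relabel ((Equiv.refl (SysWire n w)).sumCongr (timeSplit a hr)))
  have hlen : D'.length = D.length := List.length_map _
  -- The external wires hold the starting time 0, the zeros below the position, the segment number,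
  -- and the clean ancillas of the driving circuit.
  let cfg : ℕ → OffWire (lowBit a hr) → Bool := fun j e => timeState r a 0 (j * 2 ^ l * 2 ^ d) e.wire
  have hoff : ∀ i : Fin (r + 1), ¬ (d ≤ (i : ℕ) ∧ (i : ℕ) < d + l) →
      (.inl (.inr i) : TimeWire r a) ∉ Set.range (lowBit a hr) := by
    rintro i hi ⟨b, hb⟩
    have : d + (b : ℕ) = i := by simpa [lowBit_apply, Fin.ext_iff] using hb
    omega
  have hoff' : ∀ i : Fin (r + 1), (.inl (.inr i) : TimeWire r a) ∉ Set.range (lowBit a hr) →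
      ¬ (d ≤ (i : ℕ) ∧ (i : ℕ) < d + l) := by
    rintro i hi ⟨h1, h2⟩
    refine hi ⟨⟨i - d, by omega⟩, ?_⟩
    rw [lowBit_apply]
    congr 2
    exact Fin.ext (by simp only; omega)
  let sb : Fin s → OffWire (lowBit a hr) := fun m =>
    ⟨.inl (.inr ⟨d + l + m, by omega⟩), hoff _ (by simp only; omega)⟩
  -- The grid index `2 ^ r` of the final time needs the extra bit `r` of the time register.
  let top : OffWire (lowBit a hr) := ⟨.inl (.inr ⟨d + l + s, by omega⟩), hoff _ (by simp only; omega)⟩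
  have hzero : ∀ j i : ℕ, (j * 2 ^ l * 2 ^ d).testBit i =
      (decide (d ≤ i) && if i - d < l then false else j.testBit (i - d - l)) := by
    intro j i
    have := testBit_position (l := l) (d := d) (t := 0) (by positivity) j i
    simpa using this
  have hstate : ∀ j t : ℕ, t < 2 ^ l → ∀ k, Sum.elim (fun b : Fin l => t.testBit b) (cfg j)
      (timeSplit a hr k) = timeState r a 0 ((j * 2 ^ l + t) * 2 ^ d) k := by
    intro j t ht k
    refine elim_timeSplit hr (fun b => ?_) (fun e => ?_) k
    · show ((j * 2 ^ l + t) * 2 ^ d).testBit (d + b) = t.testBit b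
      rw [testBit_position ht]; simp
    · obtain ⟨(i | i) | i, he⟩ := e
      · rfl
      · show ((j * 2 ^ l + t) * 2 ^ d).testBit i = (j * 2 ^ l * 2 ^ d).testBit i
        have := hoff' i he
        rw [testBit_position ht, hzero]
        by_cases h1 : d ≤ (i : ℕ)
        · rw [if_neg (by omega), if_neg (by omega)]
        · simp [h1]
      · rfl
  have hcfg : ∀ (m : Fin s) (j : ℕ), 2 ^ ((m : ℕ) + 1) ∣ j →
      cfg (j + 2 ^ (m : ℕ)) (sb m) = !cfg j (sb m) ∧
      ∀ e, e ≠ sb m → cfg (j + 2 ^ (m : ℕ)) e = cfg j e := by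
    intro m j hj
    constructor
    · show ((j + 2 ^ (m : ℕ)) * 2 ^ l * 2 ^ d).testBit (d + l + m) =
        !(j * 2 ^ l * 2 ^ d).testBit (d + l + m)
      have h1 : d ≤ d + l + m := by omega
      have h2 : ¬ d + l + (m : ℕ) - d < l := by omega
      have h3 : d + l + (m : ℕ) - d - l = m := by omega
      simp only [hzero, h1, h2, h3, testBit_flip hj]
      simp
    · rintro ⟨(i | i) | i, he⟩ hne
      · rfl
      · show ((j + 2 ^ (m : ℕ)) * 2 ^ l * 2 ^ d).testBit i = (j * 2 ^ l * 2 ^ d).testBit i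
        rw [hzero, hzero]
        by_cases h1 : d ≤ (i : ℕ)
        · have := hoff' i he
          have h4 : (i : ℕ) ≠ d + l + m := fun h => hne (OffWire.ext (by
            simp only [sb]; congr 2; exact Fin.ext h))
          rw [if_neg (by omega), if_neg (by omega), testBit_flip hj, if_neg (by omega)]
        · simp [h1]
      · rfl
  have htop : ∀ e, e ≠ top → cfg (2 ^ s) e = cfg 0 e := by
    rintro ⟨(i | i) | i, he⟩ hne
    · rfl
    · show (2 ^ s * 2 ^ l * 2 ^ d).testBit i = (0 * 2 ^ l * 2 ^ d).testBit i
      have h4 : (i : ℕ) ≠ d + l + s := fun h => hne (OffWire.ext (by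
        simp only [top]; congr 2; exact Fin.ext h))
      rw [hzero, hzero]
      by_cases h1 : d ≤ (i : ℕ)
      · have := hoff' i he
        rw [if_neg (by omega), if_neg (by omega), Nat.testBit_two_pow_of_ne (by omega)]
        simp
      · simp [h1]
    · rfl
  obtain ⟨b, A, hA, hA'⟩ := exists_evolution_circuit hK D' hα sb top cfg hcfg (by
    show (2 ^ s * 2 ^ l * 2 ^ d).testBit (d + l + s) = !(0 * 2 ^ l * 2 ^ d).testBit (d + l + s)
    have h1 : d ≤ d + l + s := by omega
    have h2 : ¬ d + l + s - d < l := by omega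
    have h3 : d + l + s - d - l = s := by omega
    simp [hzero, h1, h2, h3]) htop (by
    rintro ⟨(i | i) | i, he⟩ <;> simp [cfg, timeState])
  rw [hlen] at hA
  refine ⟨b, A, hA, fun U δ hU hD x => hA' U δ hU (fun j t ht hj => ?_) x⟩
  refine (norm_evalGates_relabel_mul_attach_sub_le (timeSplit a hr) D _ _).trans ?_
  simp only [hstate j t ht]
  exact hD _ hj

end DrivingCircuit

/-! ### Negligible driving -/

section WeakDriving

variable {β : Type*} [Fintype β] [DecidableEq β]

theorem averageNorm_mul {T : ℝ} (hT : 0 < T) (HD : ℝ → Matrix β β ℂ) :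
    averageNorm T HD * T = ∫ t in (0 : ℝ)..T, ‖HD t‖ := by
  rw [averageNorm]; field_simp

theorem averageNorm_nonneg {T : ℝ} (hT : 0 < T) (HD : ℝ → Matrix β β ℂ) : 0 ≤ averageNorm T HD :=
  mul_nonneg (by positivity) (intervalIntegral.integral_nonneg hT.le fun _ _ => norm_nonneg _)

/-- A weak driving Hamiltonian can be neglected. -/
theorem norm_continuous_sub_fractionalQuery_le {f : β → Bool} {HD : ℝ → Matrix β β ℂ} {T : ℝ}
    {V : Matrix β β ℂ} (hT : 0 ≤ T) (hD : IsDriving T HD) (hV : ContinuousImplements f T HD V) :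
    ‖V - fractionalQuery f T‖ ≤ ∫ t in (0 : ℝ)..T, ‖HD t‖ := by
  obtain ⟨Y, hY, hY0, rfl⟩ := IsEvolution.exists_isSolution hT hV
  have hQ : IsSolution (fun _ => queryHamiltonian f) 0 T (fractionalQuery f) := by
    have := isSolution_projRotation (queryProj_mul_self f) (a := 0) (b := T)
    rw [queryHamiltonian_eq]
    simpa only [sub_zero, ← fractionalQuery_eq_projRotation] using this
  have hH : (queryHamiltonian f).IsHermitian := by
    rw [queryHamiltonian_eq, Matrix.IsHermitian, Matrix.conjTranspose_smul,
      (queryProj_isHermitian f).eq]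
    simp
  have iQ : IntervalIntegrable (fun _ : ℝ => queryHamiltonian f) volume 0 T :=
    intervalIntegrable_const
  have h := IsSolution.conjTranspose_mul hT (fun _ _ => hH) iQ (iQ.add hD.2) hQ hY
  have hYu : ∀ t ∈ Set.Icc 0 T, (Y t).conjTranspose * Y t = 1 := fun t ht =>
    hY.conjTranspose_mul_self (fun t ht => hH.add (hD.1 t ht)) (iQ.add hD.2) hY0 ht
  have hQT := mul_eq_one_comm.1 (fractionalQuery_unitary f T)
  have e : Y T - fractionalQuery f T =
      fractionalQuery f T * ((fractionalQuery f T).conjTranspose * Y T - 1) := by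
    rw [mul_sub, ← mul_assoc, hQT, one_mul, mul_one]
  have e2 : (fractionalQuery f T).conjTranspose * Y T - 1 =
      -(Complex.I • ∫ t in (0 : ℝ)..T, (fractionalQuery f t).conjTranspose * HD t * Y t) := by
    rw [h, hY0, fractionalQuery_zero]
    simp
  rw [e]
  refine (norm_mul_le _ _).trans ((mul_le_of_le_one_left (norm_nonneg _)
    (norm_le_one_of_conjTranspose_mul_self (fractionalQuery_unitary f T))).trans ?_)
  rw [e2, norm_neg, norm_smul, Complex.norm_I, one_mul]
  refine intervalIntegral.norm_integral_le_of_norm_le hT (ae_of_all _ fun t ht => ?_) hD.2.norm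
  have n1 : ‖(fractionalQuery f t).conjTranspose‖ ≤ 1 := by
    rw [Matrix.l2_opNorm_conjTranspose]
    exact norm_le_one_of_conjTranspose_mul_self (fractionalQuery_unitary f t)
  have n2 := norm_le_one_of_conjTranspose_mul_self (hYu t ⟨ht.1.le, ht.2⟩)
  have := norm_mul_le_of_le (norm_mul_le_of_le n1 (le_refl ‖HD t‖)) n2
  simpa using this

end WeakDriving

/-! ### Choice of parameters and the gate count -/

section GateCount

theorem exists_two_pow_near {z : ℝ} (hz : 1 ≤ z) : ∃ s : ℕ, z ≤ 2 ^ s ∧ (2 : ℝ) ^ s ≤ 2 * z := by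
  obtain ⟨s, h1, h2⟩ := exists_nat_pow_near hz (one_lt_two (α := ℝ))
  exact ⟨s + 1, h2.le, by rw [pow_succ]; linarith⟩

/-- Since `log (2 + y) ≥ log 2`, the additive constants are absorbed into the factor 10. -/
theorem add_one_le_log {l : ℕ} {y : ℝ} (hy : 0 ≤ y) (hl : (2 : ℝ) ^ l ≤ 16 * (2 + y)) :
    (l + 1 : ℝ) ≤ 10 * Real.log (2 + y) := by
  have h1 : Real.log 2 ≤ Real.log (2 + y) := Real.log_le_log two_pos (by linarith)
  have h2 := Real.log_le_log (by positivity) hl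
  rw [Real.log_mul (by norm_num) (by positivity), show (16 : ℝ) = 2 ^ 4 by norm_num, Real.log_pow,
    Real.log_pow] at h2
  have h3 := Real.log_two_gt_d9
  push_cast at h2
  have h4 : (l : ℝ) * 0.69 ≤ l * Real.log 2 := by gcongr; linarith
  nlinarith

theorem gate_bound {s K l g : ℕ} {T R L : ℝ} (hT : 1 ≤ T) (hR : 1 ≤ R) (hs : (2 : ℝ) ^ s ≤ 8 * T)
    (hK : (K : ℝ) ≤ 21 * R) (hl : (l + 1 : ℝ) ≤ 10 * L) {G : ℕ}
    (hG : G ≤ 2 ^ s * (800 * ((K + 1) * (g + l + 1)) + 6) + g) :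
    (G : ℝ) ≤ 1500000 * (T * R * (g + L)) := by
  have hL : 0 ≤ L := by
    have : (0 : ℝ) ≤ l := l.cast_nonneg
    linarith
  have h1 : G ≤ 2 ^ s * (807 * ((K + 1) * (g + l + 1))) := by
    have a1 : g + l + 1 ≤ (K + 1) * (g + l + 1) := Nat.le_mul_of_pos_left _ (by omega)
    have a2 : g ≤ 2 ^ s * g := Nat.le_mul_of_pos_left _ (by positivity)
    refine hG.trans ?_
    calc _ ≤ 2 ^ s * (800 * ((K + 1) * (g + l + 1)) + 6) + 2 ^ s * g := by omega
      _ = 2 ^ s * (800 * ((K + 1) * (g + l + 1)) + 6 + g) := by ring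
      _ ≤ _ := Nat.mul_le_mul_left _ (by omega)
  have h2 : (G : ℝ) ≤ 2 ^ s * (807 * ((K + 1) * (g + l + 1))) := by exact_mod_cast h1
  refine h2.trans ?_
  -- `K + 1 ≤ 22 R`, and `g + l + 1 ≤ 10 (g + L)`.
  calc _ ≤ 8 * T * (807 * ((22 * R) * (10 * (g + L)))) := by
        have : (0 : ℝ) ≤ g := g.cast_nonneg
        gcongr <;> linarith
    _ = 1420320 * (T * R * (g + L)) := by ring
    _ ≤ _ := by gcongr; norm_num

variable {n w r a g : ℕ} {T ε : ℝ}
  {HD : ℝ → Matrix (SysWire n w → Bool) (SysWire n w → Bool) ℂ}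
  {V : ((Fin n → Bool) → Bool) → Matrix (SysWire n w → Bool) (SysWire n w → Bool) ℂ}

theorem norm_sub_attach_mul_le {b : ℕ}
    {A : Matrix (SysWire n w ⊕ Fin b → Bool) (SysWire n w ⊕ Fin b → Bool) ℂ}
    {V V' : Matrix (SysWire n w → Bool) (SysWire n w → Bool) ℂ} {c : Fin b → Bool} {e₁ e₂ : ℝ}
    (h₁ : ‖A * attach (SysWire n w) c - attach (SysWire n w) c * V'‖ ≤ e₁) (h₂ : ‖V - V'‖ ≤ e₂) :
    ‖A * attach (SysWire n w) c - attach (SysWire n w) c * V‖ ≤ e₁ + e₂ := by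
  have e : A * attach (SysWire n w) c - attach (SysWire n w) c * V =
      (A * attach (SysWire n w) c - attach (SysWire n w) c * V') -
        attach (SysWire n w) c * (V - V') := by
    rw [Matrix.mul_sub]; abel
  rw [e]
  refine (norm_sub_le _ _).trans (add_le_add h₁ ?_)
  have hn : ‖attach (SysWire n w) c‖ ≤ 1 :=
    norm_le_one_of_conjTranspose_mul_self (conjTranspose_attach_mul _)
  simpa using norm_mul_le_of_le hn h₂

/-- With `y = h̄T/ε`, there are `2 ^ s` segments with `4T ≤ 2 ^ s ≤ 8T`, each of `2 ^ l` steps with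
`2πy ≤ 2 ^ l ≤ 4πy`. The errors are at most `0.128 ε` from truncation, `0.08 ε` and `0.001 ε` from
the driving circuit, and `ε/4` from discretization. If `2πy < 1`, the driving is left out
altogether. -/
theorem continuous_gate_simulable (hT : 1 ≤ T) (hε : 0 < ε) (h : Real.exp 1 < T / ε)
    (hD : IsDriving T HD) (hV : ∀ x, ContinuousImplements (sysBit x) T HD (V x))
    {D : List (TwoQubitGate (SysWire n w ⊕ TimeWire r a))} (hg : D.length ≤ g)
    (hr : 101 * (averageNorm T HD * T ^ 2 / ε) ≤ 2 ^ r)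
    (hDr : ImplementsDriving D T HD (1 / 1000 * (ε / T))) :
    ∃ (b : ℕ) (L : List (Gate (SysWire n w ⊕ Fin b) n)),
      (queryCount L : ℝ) ≤ 1500000 * (T * logRatio T ε) ∧
      (gateCount L : ℝ) ≤
        1500000 * (T * logRatio T ε * (g + Real.log (2 + averageNorm T HD * T / ε))) ∧
      ∀ x, ‖evalCircuit x L * attach (SysWire n w) (fun _ => false) -
        attach (SysWire n w) (fun _ => false) * V x‖ ≤ ε := by
  have hT0 : 0 < T := by linarith
  obtain ⟨hR, K, hK1, hK, hKf⟩ := exists_truncation hT hε h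
  have hf : (0 : ℝ) < K.factorial := by exact_mod_cast K.factorial_pos
  obtain ⟨s, hs1, hs2⟩ := exists_two_pow_near (z := 4 * T) (by linarith)
  have hs3 : (2 : ℝ) ^ s ≤ 8 * T := by linarith
  set y := averageNorm T HD * T / ε with hy
  have hy0 : 0 ≤ y := div_nonneg (mul_nonneg (averageNorm_nonneg hT0 HD) hT0.le) hε.le
  have hyI : ∫ t in (0 : ℝ)..T, ‖HD t‖ = y * ε := by
    rw [← averageNorm_mul hT0, hy]; field_simp
  have hpi := Real.pi_gt_three
  have hpi' := Real.pi_lt_d2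
  have hquery : ∀ q : ℕ, q ≤ 2 ^ s * (3 * K) → (q : ℝ) ≤ 1500000 * (T * logRatio T ε) := by
    intro q hq
    have h1 : (q : ℝ) ≤ 2 ^ s * (3 * K) := by exact_mod_cast hq
    calc (q : ℝ) ≤ 8 * T * (3 * (21 * logRatio T ε)) := h1.trans (by gcongr)
      _ = 504 * (T * logRatio T ε) := by ring
      _ ≤ _ := by gcongr; norm_num
  have htrunc : (2 : ℝ) ^ s * (16 / K.factorial) ≤ 0.128 * ε := by
    calc _ ≤ 8 * T * (16 / (K.factorial : ℝ)) := by gcongr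
      _ = 0.128 * (1000 * T / K.factorial) := by ring
      _ ≤ _ := by gcongr
  by_cases hcase : 1 ≤ 2 * Real.pi * y
  · obtain ⟨l, hl1, hl2⟩ := exists_two_pow_near hcase
    -- The grid must be at least as fine as the steps: `2 ^ (l + s) ≤ 32π y T`, and `32π < 101`
    -- accounts for the constant `κ`.
    obtain ⟨d, hd⟩ : ∃ d, d + l + s = r := by
      have : (2 : ℝ) ^ (l + s) ≤ 2 ^ r := by
        rw [pow_add]
        calc (2 : ℝ) ^ l * 2 ^ s ≤ (2 * (2 * Real.pi * y)) * (8 * T) := by gcongr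
          _ = 32 * Real.pi * (y * T) := by ring
          _ ≤ 101 * (y * T) := by gcongr; linarith
          _ = 101 * (averageNorm T HD * T ^ 2 / ε) := by rw [hy]; ring
          _ ≤ 2 ^ r := hr
      have := (pow_le_pow_iff_right₀ (one_lt_two (α := ℝ))).1 this
      exact ⟨r - (l + s), by omega⟩
    have hm : 0 < 2 ^ s * 2 ^ l := by positivity
    have hm' : (0 : ℝ) < (2 ^ s * 2 ^ l : ℕ) := by exact_mod_cast hm
    have hα : IsSegment (T / (2 ^ s * 2 ^ l : ℕ)) (2 ^ l) :=
      isSegment_div hT0 (by push_cast; exact hs1) (by positivity)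
    obtain ⟨b, A, ⟨L, hq, hG, hL⟩, hA⟩ := exists_driving_circuit hK1 hd D hα
    obtain ⟨U, hU, hU0⟩ := exists_driving_solution (f := sysBit fun _ => false)
      (fun s => by simp [sysBit, wireBit]) hT0.le (hV _)
    have hu : ∀ t ∈ Set.Icc 0 T, (U t).conjTranspose * U t = 1 := fun t ht =>
      hU.conjTranspose_mul_self hD.1 hD.2 hU0 ht
    have hmem : ∀ j : ℕ, j ≤ 2 ^ s * 2 ^ l → j * (T / (2 ^ s * 2 ^ l : ℕ)) ∈ Set.Icc 0 T := by
      intro j hj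
      have hj' : (j : ℝ) ≤ (2 ^ s * 2 ^ l : ℕ) := by exact_mod_cast hj
      refine ⟨by positivity, ?_⟩
      rw [mul_div_assoc', div_le_iff₀ hm']; nlinarith
    refine ⟨b, L, hquery _ hq, ?_, fun x => ?_⟩
    · refine gate_bound hT hR hs3 hK (add_one_le_log hy0 (hl2.trans ?_)) (hG.trans ?_)
      · nlinarith
      · gcongr
    · rw [hL]
      have h1 := hA (fun j => if j ≤ 2 ^ s * 2 ^ l then U (j * (T / (2 ^ s * 2 ^ l : ℕ))) else 1)
        (1 / 1000 * (ε / T)) (fun j => by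
          split_ifs with hj
          · exact hu _ (hmem j hj)
          · simp) (fun j hj => by
          have hjr : j * 2 ^ d ≤ 2 ^ r := by
            rw [← hd, pow_add, pow_add]
            calc j * 2 ^ d ≤ 2 ^ s * 2 ^ l * 2 ^ d := Nat.mul_le_mul_right _ hj
              _ = _ := by ring
          -- Only evolutions starting at time 0 are used; by uniqueness they are those of `U`.
          obtain ⟨W, hW, hW'⟩ := hDr 0 (j * 2 ^ d) (Nat.zero_le _) hjr
          have e0 : gridTime T r 0 = 0 := by simp [gridTime]
          have e1 : gridTime T r (j * 2 ^ d) = j * (T / (2 ^ s * 2 ^ l : ℕ)) := by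
            rw [gridTime, ← hd]; push_cast; rw [pow_add, pow_add]; field_simp
          rw [e0, e1] at hW
          have ht := hmem j hj
          obtain ⟨Y, hY, hY0, hYW⟩ := hW.exists_isSolution ht.1
          have : U (j * (T / (2 ^ s * 2 ^ l : ℕ))) = W := by
            rw [← hYW]
            exact IsSolution.eq ht.1 (fun t h => hD.1 t ⟨h.1, h.2.trans ht.2⟩)
              (intervalIntegrable_of_subset hD.2 le_rfl ht.1 ht.2)
              (hU.mono hD.2 le_rfl ht.1 ht.2) hY hU0 hY0
          rw [if_pos hj, this]
          exact hW') x
      have h2 := norm_continuous_sub_timeProd_le hT0.le hD hU hU0 (hV x) hm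
      have e1 : segmentProd (sysBit x)
          (fun j => if j ≤ 2 ^ s * 2 ^ l then U (j * (T / (2 ^ s * 2 ^ l : ℕ))) else 1)
          (T / (2 ^ s * 2 ^ l : ℕ)) 0 (2 ^ s * 2 ^ l) =
          timeProd (fun j : ℕ => (U (j * (T / (2 ^ s * 2 ^ l : ℕ)))).conjTranspose *
            fractionalQuery (sysBit x) (T / (2 ^ s * 2 ^ l : ℕ)) *
              U (j * (T / (2 ^ s * 2 ^ l : ℕ)))) 0 (2 ^ s * 2 ^ l) :=
        timeProd_congr fun j _ hj => by
          simp only [if_pos (show j ≤ 2 ^ s * 2 ^ l by omega)]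
      rw [e1, if_pos le_rfl, mul_div_cancel₀ _ hm'.ne'] at h1
      refine (norm_sub_attach_mul_le h1 h2).trans ?_
      rw [hyI]
      -- The discretization error is `2π y T ε` divided by the number of steps, which is at least
      -- `4T * 2πy`.
      have h3 : 2 * Real.pi * (T / (2 ^ s * 2 ^ l : ℕ)) * (y * ε) ≤ ε / 4 := by
        have h5 : 4 * T * (2 * Real.pi * y) ≤ 2 ^ s * 2 ^ l := by gcongr
        have e : 2 * Real.pi * (T / (2 ^ s * 2 ^ l : ℕ)) * (y * ε) =
            (2 * Real.pi * y * T) * ε / (2 ^ s * 2 ^ l : ℕ) := by ring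
        rw [e, div_le_iff₀ hm']
        push_cast
        nlinarith
      have h4 : (2 : ℝ) ^ s * (10 * (1 / 1000 * (ε / T))) ≤ 0.08 * ε := by
        calc _ ≤ 8 * T * (10 * (1 / 1000 * (ε / T))) := by gcongr
          _ = _ := by field_simp; norm_num
      have h5 : ε / T ≤ ε := div_le_self hε.le hT
      rw [mul_add]
      linarith
  · push Not at hcase
    have hα : IsSegment (T / (2 ^ s * 2 ^ 0 : ℕ)) (2 ^ 0) :=
      isSegment_div hT0 (by push_cast; exact hs1) (by positivity)
    -- For weak driving the given time register may be too short to number the segments. A register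
    -- of its own with `l = 0` and the empty driving circuit simulates the pure query evolution, at
    -- distance at most `yε ≤ ε/4` from the target.
    obtain ⟨b, A, ⟨L, hq, hG, hL⟩, hA⟩ := exists_driving_circuit (n := n) (w := w) (a := 0) hK1
      (show 0 + 0 + s = s by omega) [] hα
    refine ⟨b, L, hquery _ hq, ?_, fun x => ?_⟩
    · refine gate_bound hT hR hs3 hK (add_one_le_log hy0 (l := 0) ?_) (hG.trans ?_)
      · norm_num; linarith
      · simp only [List.length_nil]; gcongr <;> omega
    · rw [hL]
      have h1 := hA (fun _ => 1) 0 (fun _ => by simp) (fun j _ => by simp [evalGates]) x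
      rw [segmentProd_const (u := 1) _ (by simp) _ _ _ (fun _ _ _ => rfl)] at h1
      have hm' : ((2 ^ s * 2 ^ 0 : ℕ) : ℝ) ≠ 0 := by positivity
      rw [mul_div_cancel₀ _ hm', Matrix.conjTranspose_one, one_mul, one_mul, mul_one] at h1
      have h2 := norm_continuous_sub_fractionalQuery_le hT0.le hD (hV x)
      refine (norm_sub_attach_mul_le h1 h2).trans ?_
      rw [hyI]
      have h3 : y * ε ≤ 1 / 4 * ε := by gcongr; nlinarith
      linarith

theorem DiscretelySimulable.mono {N : ℕ} {W : Type*} [Fintype W] [DecidableEq W]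
    {V : (Fin N → Bool) → Matrix (Fin N × Bool × W) (Fin N × Bool × W) ℂ} {ε q q' : ℝ}
    (h : DiscretelySimulable V ε q) (hq : q ≤ q') : DiscretelySimulable V ε q' := by
  obtain ⟨d, A, h1, h2⟩ := h
  exact ⟨d, A, h1.trans hq, h2⟩

theorem query_bound_le (hT : 1 ≤ T) (hε : 0 < ε) (h : Real.exp 1 < T / ε) :
    315 * (T * logRatio T ε) ≤ 1500000 * (T * logRatio T ε) := by
  have := (exists_truncation hT hε h).1
  gcongr
  norm_num

end GateCount

end QuerySim

/-! ### The theorem -/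

open QuerySim in
theorem theorem3 :
    ∃ C c κ : ℝ, 0 < C ∧ 0 < c ∧ 0 < κ ∧
      -- fractional queries
      (∀ (N : ℕ) (W : Type) [Fintype W] [DecidableEq W]
        (A : FractionalAlgorithm (Fin N × Bool × W)) (T ε : ℝ),
        1 ≤ T → 0 < ε → Real.exp 1 < T / ε → A.cost = T →
        DiscretelySimulable (fun x => A.eval (registerBit x)) ε (C * (T * logRatio T ε))) ∧
      -- continuous queries
      (∀ (N : ℕ) (W : Type) [Fintype W] [DecidableEq W] (T ε : ℝ)
        (HD : ℝ → Matrix (Fin N × Bool × W) (Fin N × Bool × W) ℂ)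
        (V : (Fin N → Bool) → Matrix (Fin N × Bool × W) (Fin N × Bool × W) ℂ),
        1 ≤ T → 0 < ε → Real.exp 1 < T / ε → IsDriving T HD →
        (∀ x, ContinuousImplements (registerBit x) T HD (V x)) →
        DiscretelySimulable V ε (C * (T * logRatio T ε))) ∧
      -- continuous queries with a gate count
      (∀ (n w r a g : ℕ) (T ε : ℝ)
        (HD : ℝ → Matrix (SysWire n w → Bool) (SysWire n w → Bool) ℂ)
        (V : ((Fin n → Bool) → Bool) → Matrix (SysWire n w → Bool) (SysWire n w → Bool) ℂ)
        (D : List (TwoQubitGate (SysWire n w ⊕ TimeWire r a))),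
        1 ≤ T → 0 < ε → Real.exp 1 < T / ε → IsDriving T HD →
        (∀ x, ContinuousImplements (sysBit x) T HD (V x)) →
        D.length ≤ g →
        κ * (averageNorm T HD * T ^ 2 / ε) ≤ 2 ^ r →
        ImplementsDriving D T HD (c * (ε / T)) →
        ∃ (b : ℕ) (K : List (Gate (SysWire n w ⊕ Fin b) n)),
          (queryCount K : ℝ) ≤ C * (T * logRatio T ε) ∧
          (gateCount K : ℝ) ≤
            C * (T * logRatio T ε * (g + Real.log (2 + averageNorm T HD * T / ε))) ∧
          ∀ x, ‖evalCircuit x K * attach (SysWire n w) (fun _ => false) -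
            attach (SysWire n w) (fun _ => false) * V x‖ ≤ ε) := by
  -- `C` is dictated by the gate count and `κ` by the grid condition; `c` keeps the total error of
  -- the driving circuit over at most `8T` segments well below `ε`.
  refine ⟨1500000, 1 / 1000, 101, by norm_num, by norm_num, by norm_num, ?_, ?_, ?_⟩
  · intro N W _ _ A T ε hT hε h hA
    exact (fractional_simulable A hT hε h hA).mono (query_bound_le hT hε h)
  · intro N W _ _ T ε HD V hT hε h hD hV
    exact (continuous_simulable hT hε h hD hV).mono (query_bound_le hT hε h)
  · intro n w r a g T ε HD V D hT hε h hD hV hg hr hDr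
    exact continuous_gate_simulable hT hε h hD hV hg hr hDr
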